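/- **Setting.** Let $(\Omega,\mathcal F,P)$ be a probability space, $\mathsf p\ge 1$, $\Theta\subset\mathbb R^{\mathsf p}$ a bounded open set, $\theta^*\in\Theta$, and $\mathbb T\subset[0,\infty)$ with $\sup\mathbb T=\infty$; limits $T\to\infty$ are taken along $\mathbb T$. For each $T\in\mathbb T$ let $\mathbb H_T:\Omega\times\overline\Theta\to\mathbb R$ be a random field (measurable in $\omega$ for each $\theta$) such that for every $\omega$ the map $\theta\mapsto\mathbb H_T(\theta)$ is continuous on $\overline\Theta$ and of class $C^2$ on $\Theta$. Let $a_T\in GL(\mathbb R^{\mathsf p})$ be deterministic with $|a_T|\to0$, put $b_T=\lambda_{\min}(a_T^\star a_T)^{-1}$ ($\star$ denotes the transpose), and assume $b_T^{-1}\le\lambda_{\max}(a_T^\star a_T)\le C_0b_T^{-1}$ for all $T\in\mathbb T$, for some constant $C_0\in[1,\infty)$. Here $|\cdot|$ is the Euclidean norm of vectors and matrices. Put $$\Delta_T=\partial_\theta\mathbb H_T(\theta^*)a_T,\qquad \Gamma_T(\theta)=-a_T^\star\,\partial_\theta^2\mathbb H_T(\theta)\,a_T,\qquad \mathbb Y_T(\theta)=b_T^{-1}\{\mathbb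 H_T(\theta)-\mathbb H_T(\theta^*)\}.$$ Let $\mathbb Y:\Omega\times\Theta\to\mathbb R$ be a continuous random field, $\Gamma$ a symmetric $\mathsf p\times\mathsf p$ random matrix on $\Omega$, $\mathcal G$ a $\sigma$-field with $\sigma[\Gamma]\subset\mathcal G\subset\mathcal F$, and $\Delta$ a $\mathsf p$-dimensional random vector on an extension of $(\Omega,\mathcal F,P)$, that is, on a probability space with a measure-preserving map to $(\Omega,\mathcal F,P)$ through which random variables on $\Omega$ are regarded as defined on the extension; $\mathbb E$ is the expectation on the extension. Put $\hat u=\Gamma^{-1}\Delta$. Random variables $V_T$ on $\Omega$ are said to converge $\mathcal G$-stably to $V_\infty$ on the extension if $(V_T,\Psi)\to(V_\infty,\Psi)$ in distribution as $T\to\infty$ for every $\mathcal G$-measurable real random variable $\Psi$. Write $U(\theta,r)$ for the open ball of radius $r$ about $\theta$, and $\|V\|_m=E[|V|^m]^{1/m}$. Let $\varpi:\Theta\to\mathbb R$ be continuous with $0<\inf_\Theta\varpi\le\sup_\Theta\varpi<\infty$. The quasi-Bayesian estimator and its normalized error are $$\hat\theta_T^B=\Big[\int_\Theta e^{\mathbb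 H_T(\theta)}\varpi(\theta)d\theta\Big]^{-1}\int_\Theta\theta\, e^{\mathbb H_T(\theta)}\varpi(\theta)d\theta,\qquad \hat u_T^B=a_T^{-1}(\hat\theta_T^B-\theta^*).$$ **Conditions**, for a number $L>0$ and real parameters $\alpha,\beta_1,\beta_2,\rho_1,\rho_2$: * [S1] $0<\beta_1<1/2$, $0<\rho_1<\min\{1,\alpha/(1-\alpha),2\beta_1/(1-\alpha)\}$, $0<2\alpha<\rho_2$, $\beta_2\ge0$, $1-2\beta_2-\rho_2>0$. * [S2] (i) There is a random variable $\chi_0$, almost surely positive, such that almost surely $\mathbb Y(\theta^*)=0$ and $\mathbb Y(\theta)\le-\chi_0|\theta-\theta^*|^2$ for all $\theta\in\Theta$, and such that, for some constant $C$, $P[\chi_0\le r^{-(\rho_2-2\alpha)}]\le Cr^{-L}$ for all $r>0$. (ii) For some constant $C$, $P[\lambda_{\min}(\Gamma)<r^{-\rho_1}]\le Cr^{-L}$ for all $r>0$. * [S3] (i) $\sup_{T\in\mathbb T}\||\Delta_T|\|_{M_1}<\infty$ for $M_1=L(1-\rho_1)^{-1}$. (ii) $\sup_{T\in\mathbb T}\big\|\sup_{\theta\in\Theta\setminus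 U(\theta^*,b_T^{-\alpha/2})}b_T^{1/2-\beta_2}|\mathbb Y_T(\theta)-\mathbb Y(\theta)|\big\|_{M_2}<\infty$ for $M_2=L(1-2\beta_2-\rho_2)^{-1}$. (iii) For $M_3=L(\beta-\rho_1)^{-1}$ with $\beta=\alpha/(1-\alpha)$, $\sup_{T\in\mathbb T}\big\|\sup_{u\in\delta^{-1}(\Theta-\theta^*),\,|u|\le1}|\Gamma_T(\theta^*+\delta u)-\Gamma_T(\theta^*)|\big\|_{M_3}=O(\delta)$ as $\delta\downarrow0$. (iv) $\sup_{T\in\mathbb T}\big\|b_T^{\beta_1}|\Gamma_T(\theta^*)-\Gamma|\big\|_{M_4}<\infty$ for $M_4=L(2\beta_1(1-\alpha)^{-1}-\rho_1)^{-1}$. **Theorem.** Suppose that [S1], [S2] and [S3] hold for some $L>0$ and some parameters, and that $\Delta_T\to\Delta$ $\mathcal G$-stably as $T\to\infty$. **(I)** If $L>1$, then as $T\to\infty$: (a) $\hat u_T^B-\Gamma^{-1}\Delta_T\to0$ in probability; (b) $\hat u_T^B\to\hat u$ $\mathcal G$-stably. **(II)** Let $p\ge0$ and $L>(p+1)\vee2$.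 Suppose moreover that there are positive constants $q,c_0,\delta$ and $T_0\in\mathbb T$ with $q>\mathsf p$ such that $$E\big[|\mathbb H_T(\theta^*+a_Tu)-\mathbb H_T(\theta^*)|^q\big]\le c_0|u|^q$$ for all $u\in U(0,\delta)$ and all $T\ge T_0$ in $\mathbb T$ with $\theta^*+a_Tu\in\Theta$. Then $\hat u_T^B-\Gamma^{-1}\Delta_T\to0$ in probability, and for every bounded $\mathcal G$-measurable random variable $\Phi$ and every $f\in C(\mathbb R^{\mathsf p})$ with $\limsup_{|u|\to\infty}|u|^{-p}|f(u)|<\infty$, the variables $f(\hat u_T^B)\Phi$ ($T\in\mathbb T$) and $f(\hat u)\Phi$ are integrable and $$E\big[f(\hat u_T^B)\Phi\big]\to\mathbb E\big[f(\hat u)\Phi\big]\qquad(T\to\infty).$$ -/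

import Mathlib

open MeasureTheory Filter Topology
open scoped ENNReal NNReal Matrix

noncomputable section

namespace QLA

/-- The space `ℝᵈ` with its Euclidean norm. -/
abbrev E (d : ℕ) : Type := EuclideanSpace ℝ (Fin d)

/-- The Euclidean (Frobenius) norm `|M|` of a matrix. -/
def frob {d : ℕ} (M : Matrix (Fin d) (Fin d) ℝ) : ℝ :=
  Real.sqrt (∑ i, ∑ j, M i j ^ 2)

/-- The minimum eigenvalue of a symmetric matrix. -/
def lambdaMin {d : ℕ} (M : Matrix (Fin d) (Fin d) ℝ) : ℝ := sInf (spectrum ℝ M)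

/-- The maximum eigenvalue of a symmetric matrix. -/
def lambdaMax {d : ℕ} (M : Matrix (Fin d) (Fin d) ℝ) : ℝ := sSup (spectrum ℝ M)

/-- The matrix-vector product `M v`, as a vector of Euclidean space. -/
def act {d : ℕ} (M : Matrix (Fin d) (Fin d) ℝ) (v : E d) : E d :=
  WithLp.toLp 2 (M *ᵥ (fun i => v i))

/-- The gradient `∂_θ h(θ)`, as a tuple of partial derivatives. -/
def grad {d : ℕ} (h : E d → ℝ) (θ : E d) : Fin d → ℝ :=
  fun i => fderiv ℝ h θ (EuclideanSpace.single i 1)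

/-- The Hessian matrix `∂_θ² h(θ)`. -/
def hess {d : ℕ} (h : E d → ℝ) (θ : E d) : Matrix (Fin d) (Fin d) ℝ :=
  Matrix.of fun i j =>
    iteratedFDeriv ℝ 2 h θ ![EuclideanSpace.single i 1, EuclideanSpace.single j 1]

/-- `Δ_T = ∂_θ H_T(θ*) a_T` (row vector times matrix). -/
def score {d : ℕ} (h : E d → ℝ) (θs : E d) (a : Matrix (Fin d) (Fin d) ℝ) : E d :=
  WithLp.toLp 2 (grad h θs ᵥ* a)

/-- `Γ_T(θ) = - a_T^⋆ ∂_θ² H_T(θ) a_T`. -/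
def obsInfo {d : ℕ} (h : E d → ℝ) (a : Matrix (Fin d) (Fin d) ℝ) (θ : E d) :
    Matrix (Fin d) (Fin d) ℝ :=
  -(aᵀ * hess h θ * a)

/-- `b_T = λ_min(a_T^⋆ a_T)⁻¹`. -/
def rate {d : ℕ} (a : Matrix (Fin d) (Fin d) ℝ) : ℝ := (lambdaMin (aᵀ * a))⁻¹

/-- `𝕐_T(θ) = b_T⁻¹ (H_T(θ) - H_T(θ*))`. -/
def contrast {d : ℕ} (h : E d → ℝ) (θs : E d) (a : Matrix (Fin d) (Fin d) ℝ) (θ : E d) : ℝ :=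
  (rate a)⁻¹ * (h θ - h θs)

/-- The quasi-Bayesian estimator for `h` with respect to the prior density `ϖ` on `Θ`. -/
def qbe {d : ℕ} (Θ : Set (E d)) (ϖ : E d → ℝ) (h : E d → ℝ) : E d :=
  (∫ θ in Θ, Real.exp (h θ) * ϖ θ)⁻¹ • ∫ θ in Θ, (Real.exp (h θ) * ϖ θ) • θ

/-- The normalized error `û_T^B = a_T⁻¹ (θ̂_T^B - θ*)`. -/
def qbeError {d : ℕ} (Θ : Set (E d)) (ϖ : E d → ℝ) (h : E d → ℝ) (θs : E d)
    (a : Matrix (Fin d) (Fin d) ℝ) : E d :=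
  act a⁻¹ (qbe Θ ϖ h - θs)

/-- A random field on the closure of `Θ`: every path is continuous on the closure of `Θ` and of
class `C²` in `Θ`. By continuity, measurability at each `θ ∈ Θ` is joint measurability. -/
structure IsC2RandomField {Ω : Type*} [MeasurableSpace Ω] {d : ℕ} (Θ : Set (E d))
    (h : Ω → E d → ℝ) : Prop where
  measurable : ∀ θ ∈ Θ, Measurable fun ω => h ω θ
  continuousOn : ∀ ω, ContinuousOn (h ω) (closure Θ)
  contDiffOn : ∀ ω, ContDiffOn ℝ 2 (h ω) Θ

/-- A continuous random field on `Θ`. -/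
structure IsContRandomField {Ω : Type*} [MeasurableSpace Ω] {d : ℕ} (Θ : Set (E d))
    (Y : Ω → E d → ℝ) : Prop where
  measurable : ∀ θ ∈ Θ, Measurable fun ω => Y ω θ
  continuousOn : ∀ ω, ContinuousOn (Y ω) Θ

/-- The scaling matrices: `|a_T| → 0` as `T → ∞`, and
`b_T⁻¹ ≤ λ_max(a_T^⋆ a_T) ≤ C₀ b_T⁻¹` for all `T`, with a constant `C₀ ≥ 1`. -/
structure IsScaling {d : ℕ} {𝕋 : Set ℝ≥0} (a : 𝕋 → GL (Fin d) ℝ) : Prop where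
  tendsto_zero : Tendsto (fun T => frob (a T : Matrix (Fin d) (Fin d) ℝ)) atTop (𝓝 0)
  comparable : ∃ C₀ : ℝ, 1 ≤ C₀ ∧ ∀ T : 𝕋,
    (rate (a T).1)⁻¹ ≤ lambdaMax ((a T).1ᵀ * (a T).1) ∧
      lambdaMax ((a T).1ᵀ * (a T).1) ≤ C₀ * (rate (a T).1)⁻¹

/-- A prior density: continuous on `Θ`, bounded, and bounded away from zero. -/
structure IsPrior {d : ℕ} (Θ : Set (E d)) (ϖ : E d → ℝ) : Prop where
  continuousOn : ContinuousOn ϖ Θ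
  bounds : ∃ c C : ℝ, 0 < c ∧ ∀ θ ∈ Θ, c ≤ ϖ θ ∧ ϖ θ ≤ C

/-- Condition [S1] on the parameters. -/
structure S1 (α β₁ β₂ ρ₁ ρ₂ : ℝ) : Prop where
  beta₁_pos : 0 < β₁
  beta₁_lt : β₁ < 1 / 2
  rho₁_pos : 0 < ρ₁
  rho₁_lt : ρ₁ < min 1 (min (α / (1 - α)) (2 * β₁ / (1 - α)))
  alpha_pos : 0 < 2 * α
  alpha_lt : 2 * α < ρ₂
  beta₂_nonneg : 0 ≤ β₂
  gap : 0 < 1 - 2 * β₂ - ρ₂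

/-- Condition [S2]: separation of the limit field `Y` and nondegeneracy of `Γ`. -/
structure S2 {Ω : Type*} [MeasurableSpace Ω] (P : Measure Ω) {d : ℕ} (Θ : Set (E d)) (θs : E d)
    (Y : Ω → E d → ℝ) (Γ : Ω → Matrix (Fin d) (Fin d) ℝ) (L α ρ₁ ρ₂ : ℝ) : Prop where
  separation : ∃ χ₀ : Ω → ℝ, Measurable χ₀ ∧ (∀ᵐ ω ∂P, 0 < χ₀ ω) ∧
    (∀ᵐ ω ∂P, Y ω θs = 0 ∧ ∀ θ ∈ Θ, Y ω θ ≤ -χ₀ ω * ‖θ - θs‖ ^ 2) ∧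
    ∃ C : ℝ, ∀ r : ℝ, 0 < r → P.real {ω | χ₀ ω ≤ r ^ (-(ρ₂ - 2 * α))} ≤ C / r ^ L
  nondegenerate : ∃ C : ℝ, ∀ r : ℝ, 0 < r →
    P.real {ω | lambdaMin (Γ ω) < r ^ (-ρ₁)} ≤ C / r ^ L

/-- Condition [S3]: moment conditions. Suprema over `θ` are taken in `[0, ∞]`. -/
structure S3 {Ω : Type*} [MeasurableSpace Ω] (P : Measure Ω) {d : ℕ} {𝕋 : Set ℝ≥0}
    (Θ : Set (E d)) (θs : E d) (H : 𝕋 → Ω → E d → ℝ) (a : 𝕋 → GL (Fin d) ℝ)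
    (Y : Ω → E d → ℝ) (Γ : Ω → Matrix (Fin d) (Fin d) ℝ) (L α β₁ β₂ ρ₁ ρ₂ : ℝ) : Prop where
  score_bound :
    ⨆ T : 𝕋, eLpNorm (fun ω => score (H T ω) θs (a T).1) (ENNReal.ofReal (L / (1 - ρ₁))) P < ∞
  contrast_bound :
    ⨆ T : 𝕋, eLpNorm
      (fun ω => ⨆ θ ∈ Θ \ Metric.ball θs (rate (a T).1 ^ (-α / 2)),
        ENNReal.ofReal (rate (a T).1 ^ (1 / 2 - β₂) *
          |contrast (H T ω) θs (a T).1 θ - Y ω θ|))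
      (ENNReal.ofReal (L / (1 - 2 * β₂ - ρ₂))) P < ∞
  info_modulus : ∃ C : ℝ, ∀ᶠ δ : ℝ in 𝓝[>] 0,
    ⨆ T : 𝕋, eLpNorm
      (fun ω => ⨆ u ∈ {u : E d | θs + δ • u ∈ Θ ∧ ‖u‖ ≤ 1},
        ENNReal.ofReal
          (frob (obsInfo (H T ω) (a T).1 (θs + δ • u) - obsInfo (H T ω) (a T).1 θs)))
      (ENNReal.ofReal (L / (α / (1 - α) - ρ₁))) P ≤ ENNReal.ofReal (C * δ)
  info_limit :
    ⨆ T : 𝕋, eLpNorm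
      (fun ω => rate (a T).1 ^ β₁ * frob (obsInfo (H T ω) (a T).1 θs - Γ ω))
      (ENNReal.ofReal (L / (2 * β₁ / (1 - α) - ρ₁))) P < ∞

/-- `𝒢`-stable convergence of `V i` (on `(Ω, P)`) to `V∞`, which lives on an extension `(Ω', P')`
of `(Ω, P)` with projection `π`: for every `𝒢`-measurable `Ψ`, the pairs `(V i, Ψ)` converge in
distribution to `(V∞, Ψ)`. -/
def StableConv {Ω Ω' ι S : Type*} (𝒢 : MeasurableSpace Ω) [mΩ : MeasurableSpace Ω]
    [MeasurableSpace Ω']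
    [MetricSpace S] [SecondCountableTopology S] [MeasurableSpace S] [BorelSpace S]
    (P : Measure Ω) [IsProbabilityMeasure P] (P' : Measure Ω') [IsProbabilityMeasure P']
    (π : Ω' → Ω) (V : ι → Ω → S) (l : Filter ι) (Vlim : Ω' → S) : Prop :=
  ∀ Ψ : Ω → ℝ, Measurable[𝒢] Ψ →
    TendstoInDistribution (Ω := fun _ : ι => Ω) (fun i ω => (V i ω, Ψ ω)) l
      (fun ω' => (Vlim ω', Ψ (π ω'))) (fun _ => P) P'

/-- `limsup_{|u| → ∞} |u|^{-p} |f u| < ∞`. -/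
def PolyGrowth {d : ℕ} (p : ℝ) (f : E d → ℝ) : Prop :=
  limsup (fun u : E d => ENNReal.ofReal (‖u‖ ^ (-p) * |f u|)) (Bornology.cobounded (E d)) < ∞

end QLA

end

/-! In the local coordinate u = a_T⁻¹(θ − θ*) the normalized error û_T^B is the mean of the density
proportional to exp(H_T(θ* + a_T u) − H_T(θ*)) ϖ(θ* + a_T u) (`qbeError_eq_densityMean`). On a fixed
ball Taylor's formula makes the exponent ⟨Δ_T, u⟩ − u^⋆Γu/2 up to a small error. Completing the
square shows that this quadratic is symmetric about Γ⁻¹Δ_T, so the posterior mean is close to Γ⁻¹Δ_T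
as soon as the mass far out is negligible (`norm_densityMean_sub_le`).

Negligibility is `exists_large_deviation`: outside an event of probability O(r^{-L}), uniformly in
large T, the exponent is at most −|u|/4 for every local u with |u| ≥ r. Where |a_T u| < b_T^{-α/2},
the Taylor expansion and λ_min(Γ) ≥ r^{-ρ₁} give this (`sub_le_of_near`). Farther away it comes from
the closeness of 𝕐_T to 𝕐 ≤ −χ₀|θ − θ*|² (`sub_le_of_far`). The moment orders in [S3] are those for
which Markov's inequality bounds each failure by a multiple of r^{-L}.

For (I), tightness of Γ, Γ⁻¹ and Δ_T turns the deterministic estimate into convergence in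
probability (`eventually_measureReal_qbeError_sub_le`). Stable convergence of Δ_T upgrades to joint
convergence with (Γ, Ψ) (`StableConv.tendstoInDistribution_prod`); continuous mapping and Slutsky's
lemma conclude.

For (II) a polynomial tail of û_T^B is needed, and the danger is a small normalizing constant. The
extra moment hypothesis bounds below the integral over a ball of radius r^{-L/q}, by e⁻¹ times its
volume, outside probability O(r^{-L}). That volume decays polynomially in r, whereas the mass beyond
r decays faster than any power, so P[|û_T^B| > 2r] = O(r^{-L}) (`exists_qbeError_tail`). Moments of
an order between p and L are then bounded, and truncation carries the convergence over to f of
growth p. -/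

namespace QLA

/-! ### Matrices acting on Euclidean space, least eigenvalue, rate b_T -/

section LinearAlgebra

variable {d : ℕ}

/-- The matrix `M` as a linear map of Euclidean space. -/
def actLin (M : Matrix (Fin d) (Fin d) ℝ) : E d →ₗ[ℝ] E d where
  toFun := act M
  map_add' u v := by
    ext i
    simp [act, Matrix.mulVec, dotProduct, mul_add, Finset.sum_add_distrib]
  map_smul' c v := by
    ext i
    simp [act, Matrix.mulVec, dotProduct, Finset.mul_sum, mul_left_comm]

@[simp] lemma actLin_apply (M : Matrix (Fin d) (Fin d) ℝ) (v : E d) : actLin M v = act M v := rfl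

lemma act_apply (M : Matrix (Fin d) (Fin d) ℝ) (v : E d) (i : Fin d) :
    act M v i = ∑ j, M i j * v j := rfl

lemma act_sub (M : Matrix (Fin d) (Fin d) ℝ) (u v : E d) : act M (u - v) = act M u - act M v :=
  (actLin M).map_sub u v

lemma act_neg (M : Matrix (Fin d) (Fin d) ℝ) (v : E d) : act M (-v) = -act M v :=
  (actLin M).map_neg v

lemma act_smul (M : Matrix (Fin d) (Fin d) ℝ) (c : ℝ) (v : E d) : act M (c • v) = c • act M v :=
  (actLin M).map_smul c v

@[simp] lemma act_zero (M : Matrix (Fin d) (Fin d) ℝ) : act M 0 = 0 := (actLin M).map_zero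

lemma sub_act (M N : Matrix (Fin d) (Fin d) ℝ) (v : E d) : act (M - N) v = act M v - act N v := by
  ext i
  simp [act_apply, sub_mul]

lemma act_mul (M N : Matrix (Fin d) (Fin d) ℝ) (v : E d) : act (M * N) v = act M (act N v) := by
  ext i
  simp only [act_apply, Matrix.mul_apply, Finset.sum_mul, Finset.mul_sum, mul_assoc]
  exact Finset.sum_comm

@[simp] lemma act_one (v : E d) : act 1 v = v := by
  ext i
  simp [act]

lemma act_inv_act {M : Matrix (Fin d) (Fin d) ℝ} (hM : IsUnit M.det) (v : E d) :
    act M⁻¹ (act M v) = v := by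
  rw [← act_mul, Matrix.nonsing_inv_mul _ hM, act_one]

lemma act_act_inv {M : Matrix (Fin d) (Fin d) ℝ} (hM : IsUnit M.det) (v : E d) :
    act M (act M⁻¹ v) = v := by
  rw [← act_mul, Matrix.mul_nonsing_inv _ hM, act_one]

lemma continuous_act (M : Matrix (Fin d) (Fin d) ℝ) : Continuous (act M) :=
  (actLin M).continuous_of_finiteDimensional

lemma continuous_act_uncurry :
    Continuous fun q : Matrix (Fin d) (Fin d) ℝ × E d => act q.1 q.2 := by
  refine (PiLp.continuous_toLp 2 _).comp ?_
  refine continuous_pi fun i => ?_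
  simp only [Matrix.mulVec, dotProduct]
  fun_prop

lemma frob_nonneg (M : Matrix (Fin d) (Fin d) ℝ) : 0 ≤ frob M := Real.sqrt_nonneg _

lemma frob_sq (M : Matrix (Fin d) (Fin d) ℝ) : frob M ^ 2 = ∑ i, ∑ j, M i j ^ 2 :=
  Real.sq_sqrt (by positivity)

lemma continuous_frob : Continuous (frob : Matrix (Fin d) (Fin d) ℝ → ℝ) := by
  unfold frob
  refine Real.continuous_sqrt.comp ?_
  fun_prop

lemma norm_act_le (M : Matrix (Fin d) (Fin d) ℝ) (v : E d) : ‖act M v‖ ≤ frob M * ‖v‖ := by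
  refine abs_le_of_sq_le_sq' ?_ (by positivity [frob_nonneg M]) |>.2
  rw [mul_pow, frob_sq, EuclideanSpace.norm_sq_eq, EuclideanSpace.norm_sq_eq, Finset.sum_mul]
  refine Finset.sum_le_sum fun i _ => ?_
  simp only [act_apply, Real.norm_eq_abs, sq_abs]
  exact Finset.sum_mul_sq_le_sq_mul_sq _ _ _

lemma abs_inner_act_le (M : Matrix (Fin d) (Fin d) ℝ) (u : E d) :
    |inner ℝ u (act M u)| ≤ frob M * ‖u‖ ^ 2 := by
  refine (abs_real_inner_le_norm _ _).trans ?_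
  nlinarith [norm_act_le M u, norm_nonneg u]

lemma inner_act_eq_sum (M : Matrix (Fin d) (Fin d) ℝ) (u v : E d) :
    inner ℝ u (act M v) = ∑ i, ∑ j, u i * (M i j * v j) := by
  simp [PiLp.inner_apply, act_apply, Finset.mul_sum, mul_comm]

lemma inner_act_transpose (M : Matrix (Fin d) (Fin d) ℝ) (u v : E d) :
    inner ℝ u (act Mᵀ v) = inner ℝ v (act M u) := by
  rw [inner_act_eq_sum, inner_act_eq_sum, Finset.sum_comm]
  simp only [Matrix.transpose_apply]
  exact Finset.sum_congr rfl fun i _ => Finset.sum_congr rfl fun j _ => by ring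

lemma finite_spectrum (M : Matrix (Fin d) (Fin d) ℝ) : (spectrum ℝ M).Finite :=
  Matrix.finite_real_spectrum

/-- Subtracting `lambdaMin M` times the identity shifts the spectrum into the nonnegative reals, so
the difference is positive semidefinite. -/
lemma lambdaMin_mul_le {M : Matrix (Fin d) (Fin d) ℝ} (hM : M.IsSymm) (u : E d) :
    lambdaMin M * ‖u‖ ^ 2 ≤ inner ℝ u (act M u) := by
  have hpos : (M - algebraMap ℝ (Matrix (Fin d) (Fin d) ℝ) (lambdaMin M)).PosSemidef := by
    refine Matrix.posSemidef_iff_isHermitian_and_spectrum_nonneg.2 ⟨?_, ?_⟩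
    · ext i j
      have := congrFun (congrFun hM i) j
      simp only [Matrix.transpose_apply] at this
      simp [Matrix.algebraMap_matrix_apply, this, eq_comm]
    · intro x hx
      have : x + lambdaMin M ∈ spectrum ℝ M := by
        have h := (spectrum.add_mem_add_iff (s := lambdaMin M)).2 hx
        rwa [add_sub_cancel] at h
      have := csInf_le (finite_spectrum M).bddBelow this
      change lambdaMin M ≤ _ at this
      simpa using this
  have h := hpos.dotProduct_mulVec_nonneg (fun i => u i)
  rw [Matrix.sub_mulVec, dotProduct_sub, Algebra.algebraMap_eq_smul_one, Matrix.smul_mulVec,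
    Matrix.one_mulVec, dotProduct_smul, sub_nonneg, smul_eq_mul] at h
  rw [EuclideanSpace.norm_sq_eq]
  refine le_of_eq_of_le ?_ (h.trans_eq ?_)
  · simp [dotProduct, sq]
  · simp [dotProduct, PiLp.inner_apply, act, mul_comm]

lemma isUnit_det_of_lambdaMin_pos {M : Matrix (Fin d) (Fin d) ℝ} (h : 0 < lambdaMin M) :
    IsUnit M.det := by
  by_contra hM
  have h0 : (0 : ℝ) ∈ spectrum ℝ M := by
    rw [spectrum.zero_mem_iff]
    rwa [Matrix.isUnit_iff_isUnit_det]
  exact absurd (csInf_le (finite_spectrum M).bddBelow h0) (not_le.2 h)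

lemma lambdaMin_pos {M : Matrix (Fin d) (Fin d) ℝ} (hd : 0 < d) (hM : M.PosDef) :
    0 < lambdaMin M := by
  have : Nonempty (Fin d) := ⟨⟨0, hd⟩⟩
  have hne : (spectrum ℝ M).Nonempty := by
    rw [hM.isHermitian.spectrum_real_eq_range_eigenvalues]
    exact Set.range_nonempty _
  have hmem : lambdaMin M ∈ spectrum ℝ M := hne.csInf_mem (finite_spectrum M)
  rw [hM.isHermitian.spectrum_real_eq_range_eigenvalues] at hmem
  obtain ⟨i, hi⟩ := hmem
  rw [← hi]
  exact hM.eigenvalues_pos i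

lemma isUnit_det (a : GL (Fin d) ℝ) : IsUnit (a : Matrix (Fin d) (Fin d) ℝ).det :=
  (Matrix.isUnit_iff_isUnit_det _).1 a.isUnit

lemma rate_pos (hd : 0 < d) (a : GL (Fin d) ℝ) : 0 < rate a.1 := by
  refine inv_pos.2 (lambdaMin_pos hd ?_)
  have := Matrix.PosDef.conjTranspose_mul_self a.1
    (Matrix.mulVec_injective_iff_isUnit.2 a.isUnit)
  simpa using this

/-- This is the quadratic-form bound for aᵀa, whose least eigenvalue is b⁻¹. It bounds the local
size of u by the size of θ − θ* = a u. -/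
lemma sq_norm_le_rate_mul (hd : 0 < d) (a : GL (Fin d) ℝ) (u : E d) :
    ‖u‖ ^ 2 ≤ rate a.1 * ‖act a.1 u‖ ^ 2 := by
  have hb := rate_pos hd a
  have h := lambdaMin_mul_le (M := a.1ᵀ * a.1) (by simp [Matrix.IsSymm]) u
  rw [act_mul, inner_act_transpose, real_inner_self_eq_norm_sq] at h
  have hl : lambdaMin (a.1ᵀ * a.1) = (rate a.1)⁻¹ := by simp [rate]
  rw [hl, inv_mul_le_iff₀ hb] at h
  exact h

/-- Testing the previous bound on one unit vector gives 1 ≤ b|a|², so |a| → 0 forces b → ∞. -/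
lemma tendsto_rate {ι : Type*} {l : Filter ι} (hd : 0 < d) {a : ι → GL (Fin d) ℝ}
    (ha : Tendsto (fun T => frob (a T).1) l (𝓝 0)) :
    Tendsto (fun T => rate (a T).1) l atTop := by
  have hle : ∀ T, (rate (a T).1)⁻¹ ≤ frob (a T).1 ^ 2 := by
    intro T
    have hb := rate_pos hd (a T)
    set u : E d := EuclideanSpace.single ⟨0, hd⟩ 1
    have h1 : ‖u‖ = 1 := by simp [u]
    have h2 := sq_norm_le_rate_mul hd (a T) u
    have h3 := norm_act_le (a T).1 u
    rw [h1, mul_one] at h3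
    rw [h1, one_pow] at h2
    rw [inv_le_iff_one_le_mul₀ hb]
    refine h2.trans (by rw [mul_comm]; gcongr)
  have h0 : Tendsto (fun T => (rate (a T).1)⁻¹) l (𝓝[>] 0) := by
    refine tendsto_nhdsWithin_iff.2 ⟨?_, .of_forall fun T => inv_pos.2 (rate_pos hd (a T))⟩
    refine squeeze_zero (fun T => (inv_pos.2 (rate_pos hd (a T))).le) hle ?_
    simpa using ha.pow 2
  simpa [Function.comp_def] using tendsto_inv_nhdsGT_zero.comp h0

end LinearAlgebra

end QLA

namespace QLA

/-! ### Taylor expansion and measurability of C² random fields -/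

section Fields

variable {d : ℕ} {Ω : Type*} [MeasurableSpace Ω]

lemma hess_apply (h : E d → ℝ) (θ : E d) (i j : Fin d) :
    hess h θ i j = fderiv ℝ (fderiv ℝ h) θ (EuclideanSpace.single i 1)
      (EuclideanSpace.single j 1) := by
  simp [hess, iteratedFDeriv_two_apply]

lemma eq_sum_smul_single (v : E d) : v = ∑ i, v i • EuclideanSpace.single i (1 : ℝ) := by
  ext j
  simp [Pi.single_apply]

lemma inner_score (h : E d → ℝ) (θ : E d) (a : Matrix (Fin d) (Fin d) ℝ) (u : E d) :
    inner ℝ (score h θ a) u = fderiv ℝ h θ (act a u) := by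
  rw [eq_sum_smul_single (act a u), map_sum]
  simp only [map_smul, smul_eq_mul, act_apply, Finset.sum_mul]
  rw [Finset.sum_comm]
  simp only [PiLp.inner_apply, score, Matrix.vecMul, dotProduct, grad]
  refine Finset.sum_congr rfl fun i _ => ?_
  simp only [RCLike.inner_apply, conj_trivial, Finset.mul_sum]
  exact Finset.sum_congr rfl fun j _ => by ring

lemma inner_act_hess (h : E d → ℝ) (θ v : E d) :
    inner ℝ v (act (hess h θ) v) = fderiv ℝ (fderiv ℝ h) θ v v := by
  conv_rhs => rw [eq_sum_smul_single v]
  rw [inner_act_eq_sum]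
  simp only [map_sum, map_smul, sum_apply, smul_apply,
    smul_eq_mul, Finset.mul_sum, hess_apply]
  rw [Finset.sum_comm]
  exact Finset.sum_congr rfl fun i _ => Finset.sum_congr rfl fun j _ => by ring

lemma inner_act_obsInfo (h : E d → ℝ) (θ : E d) (a : Matrix (Fin d) (Fin d) ℝ) (u : E d) :
    inner ℝ u (act (obsInfo h a θ) u) = -fderiv ℝ (fderiv ℝ h) θ (act a u) (act a u) := by
  rw [← inner_act_hess, obsInfo, ← zero_sub, sub_act, inner_sub_right, act_mul, act_mul,
    inner_act_transpose, real_inner_comm (act a u)]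
  have h0 : inner ℝ u (act 0 u) = 0 := by simp [inner_act_eq_sum]
  rw [h0, zero_sub]

/-- Second order Taylor formula with the Lagrange remainder on `[0, 1]`. -/
lemma exists_second_order_taylor {f f' f'' : ℝ → ℝ}
    (hf : ∀ t ∈ Set.Icc (0 : ℝ) 1, HasDerivAt f (f' t) t)
    (hf' : ∀ t ∈ Set.Icc (0 : ℝ) 1, HasDerivAt f' (f'' t) t) :
    ∃ s ∈ Set.Ioo (0 : ℝ) 1, f 1 - f 0 = f' 0 + f'' s / 2 := by
  have hg : ∀ t ∈ Set.Icc (0 : ℝ) 1,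
      HasDerivAt (fun t => f t - f 0 - f' 0 * t) (f' t - f' 0) t := fun t ht => by
    simpa using ((hf t ht).sub_const (f 0)).fun_sub ((hasDerivAt_id' t).const_mul (f' 0))
  -- Cauchy's mean value theorem against t² gives f 1 − f 0 − f' 0 = (f' c − f' 0) / (2c), and the
  -- mean value theorem for f' on [0, c] turns this into f'' s / 2.
  obtain ⟨c, hc, hc'⟩ := exists_ratio_hasDerivAt_eq_ratio_slope
    (fun t => f t - f 0 - f' 0 * t) (fun t => f' t - f' 0) (zero_lt_one' ℝ)
    (fun t ht => (hg t ht).continuousAt.continuousWithinAt)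
    (fun t ht => hg t (Set.Ioo_subset_Icc_self ht))
    (fun t => t ^ 2) (fun t => 2 * t) (by fun_prop)
    (fun t _ => by simpa using hasDerivAt_pow 2 t)
  obtain ⟨s, hs, hs'⟩ := exists_hasDerivAt_eq_slope f' f'' hc.1
    (fun t ht => (hf' t ⟨ht.1, ht.2.trans hc.2.le⟩).continuousAt.continuousWithinAt)
    (fun t ht => hf' t ⟨ht.1.le, ht.2.le.trans hc.2.le⟩)
  refine ⟨s, ⟨hs.1, hs.2.trans hc.2⟩, ?_⟩
  have hc0 : c ≠ 0 := hc.1.ne'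
  rw [hs', sub_zero]
  field_simp
  linarith

/-- The locally quadratic expansion of a `C²` function in the local coordinate `u`. -/
lemma exists_sub_eq_quadratic {Θ : Set (E d)} (hΘ : IsOpen Θ) {h : E d → ℝ}
    (hh : ContDiffOn ℝ 2 h Θ) (θ : E d) (a : Matrix (Fin d) (Fin d) ℝ) (u : E d)
    (hseg : ∀ s ∈ Set.Icc (0 : ℝ) 1, θ + s • act a u ∈ Θ) :
    ∃ s ∈ Set.Ioo (0 : ℝ) 1, h (θ + act a u) - h θ = inner ℝ (score h θ a) u
      - inner ℝ u (act (obsInfo h a (θ + s • act a u)) u) / 2 := by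
  generalize hv : act a u = v at hseg ⊢
  have hline : ∀ t : ℝ, HasDerivAt (fun t : ℝ => θ + t • v) v t := fun t => by
    simpa using ((hasDerivAt_id t).smul_const v).const_add θ
  have h1 : ∀ t ∈ Set.Icc (0 : ℝ) 1, HasDerivAt (fun t : ℝ => h (θ + t • v))
      (fderiv ℝ h (θ + t • v) v) t := fun t ht =>
    ((hh.contDiffAt (hΘ.mem_nhds (hseg t ht))).differentiableAt
      two_ne_zero).hasFDerivAt.comp_hasDerivAt t (hline t)
  have h2 : ∀ t ∈ Set.Icc (0 : ℝ) 1, HasDerivAt (fun t : ℝ => fderiv ℝ h (θ + t • v) v)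
      (fderiv ℝ (fderiv ℝ h) (θ + t • v) v v) t := fun t ht => by
    have hd : DifferentiableAt ℝ (fderiv ℝ h) (θ + t • v) :=
      ((hh.fderiv_of_isOpen hΘ (m := 1) (by norm_num)).contDiffAt
        (hΘ.mem_nhds (hseg t ht))).differentiableAt one_ne_zero
    have hc : HasDerivAt (fun t : ℝ => fderiv ℝ h (θ + t • v))
        (fderiv ℝ (fderiv ℝ h) (θ + t • v) v) t := hd.hasFDerivAt.comp_hasDerivAt t (hline t)
    simpa using hc.clm_apply (hasDerivAt_const t v)
  obtain ⟨s, hs, hs'⟩ := exists_second_order_taylor h1 h2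
  refine ⟨s, hs, ?_⟩
  rw [inner_act_obsInfo, inner_score, hv]
  simp only [one_smul, zero_smul, add_zero] at hs'
  rw [hs']
  ring

lemma continuousOn_obsInfo {Θ : Set (E d)} (hΘ : IsOpen Θ) {h : E d → ℝ}
    (hh : ContDiffOn ℝ 2 h Θ) (a : Matrix (Fin d) (Fin d) ℝ) :
    ContinuousOn (obsInfo h a) Θ := by
  have h2 : ContinuousOn (fderiv ℝ (fderiv ℝ h)) Θ :=
    (hh.fderiv_of_isOpen hΘ (m := 1) (by norm_num)).continuousOn_fderiv_of_isOpen hΘ le_rfl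
  have hc : ContinuousOn (hess h) Θ := by
    refine continuousOn_pi.2 fun i => continuousOn_pi.2 fun j => ?_
    simp only [hess_apply]
    fun_prop
  have hcont : Continuous fun M : Matrix (Fin d) (Fin d) ℝ => -(aᵀ * M * a) := by fun_prop
  exact hcont.comp_continuousOn hc

/-- The derivative along v is the limit of the difference quotients n (g(θ + v/n) − g(θ)), each
measurable in ω. -/
lemma measurable_fderiv_apply_of_differentiableAt {Θ : Set (E d)} (hΘ : IsOpen Θ)
    {g : Ω → E d → ℝ} {θ : E d} (hθ : θ ∈ Θ) (hm : ∀ θ' ∈ Θ, Measurable fun ω => g ω θ')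
    (hd : ∀ ω, DifferentiableAt ℝ (g ω) θ) (v : E d) :
    Measurable fun ω => fderiv ℝ (g ω) θ v := by
  have hlim : Tendsto (fun n : ℕ => θ + ((n : ℝ))⁻¹ • v) atTop (𝓝 θ) := by
    simpa using (tendsto_inv_atTop_nhds_zero_nat (𝕜 := ℝ)).smul_const v |>.const_add θ
  -- The points θ + v/n lie in Θ only for large n, hence the shift of the sequence by `N`.
  obtain ⟨N, hN⟩ := eventually_atTop.1 (hlim.eventually (hΘ.mem_nhds hθ))
  refine measurable_of_tendsto_metrizable
    (f := fun (n : ℕ) ω => ((n + N : ℕ) : ℝ) •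
      (g ω (θ + (((n + N : ℕ) : ℝ))⁻¹ • v) - g ω θ)) (fun n => ?_) ?_
  · exact ((hm _ (hN _ (Nat.le_add_left N n))).sub (hm θ hθ)).const_mul _
  · refine tendsto_pi_nhds.2 fun ω => ?_
    have := (hd ω).hasFDerivAt.lim v (c := fun n : ℕ => (n : ℝ)) (l := atTop) (by
      simpa using tendsto_natCast_atTop_atTop (R := ℝ))
    exact this.comp (tendsto_add_atTop_nat N)

variable {Θ : Set (E d)} {h : Ω → E d → ℝ}

lemma IsC2RandomField.measurable_fderiv (hh : IsC2RandomField Θ h) (hΘ : IsOpen Θ) {θ : E d}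
    (hθ : θ ∈ Θ) (v : E d) : Measurable fun ω => fderiv ℝ (h ω) θ v :=
  measurable_fderiv_apply_of_differentiableAt hΘ hθ hh.measurable
    (fun ω => ((hh.contDiffOn ω).contDiffAt (hΘ.mem_nhds hθ)).differentiableAt two_ne_zero) v

/-- A partial derivative of the field is again a differentiable field with measurable values, so the
difference quotient argument applies a second time. -/
lemma IsC2RandomField.measurable_hess (hh : IsC2RandomField Θ h) (hΘ : IsOpen Θ) {θ : E d}
    (hθ : θ ∈ Θ) (i j : Fin d) : Measurable fun ω => hess (h ω) θ i j := by
  have hd : ∀ ω, DifferentiableAt ℝ (fderiv ℝ (h ω)) θ := fun ω =>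
    (((hh.contDiffOn ω).fderiv_of_isOpen hΘ (m := 1) (by norm_num)).contDiffAt
        (hΘ.mem_nhds hθ)).differentiableAt one_ne_zero
  have hm := measurable_fderiv_apply_of_differentiableAt hΘ
    (g := fun ω θ' => fderiv ℝ (h ω) θ' (EuclideanSpace.single j 1)) hθ
    (fun θ' hθ' => hh.measurable_fderiv hΘ hθ' _)
    (fun ω => (hd ω).clm_apply (differentiableAt_const _)) (EuclideanSpace.single i 1)
  have heq : ∀ ω, hess (h ω) θ i j = fderiv ℝ (fun θ' => fderiv ℝ (h ω) θ'
      (EuclideanSpace.single j 1)) θ (EuclideanSpace.single i 1) := fun ω => by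
    rw [fderiv_clm_apply (hd ω) (differentiableAt_const _), hess_apply]
    simp
  simpa only [heq] using hm

lemma IsC2RandomField.measurable_score (hh : IsC2RandomField Θ h) (hΘ : IsOpen Θ) {θ : E d}
    (hθ : θ ∈ Θ) (a : Matrix (Fin d) (Fin d) ℝ) : Measurable fun ω => score (h ω) θ a := by
  refine (WithLp.measurable_toLp 2 _).comp (measurable_pi_iff.2 fun i => ?_)
  simp only [Matrix.vecMul, dotProduct, grad]
  exact Finset.measurable_sum _ fun j _ => (hh.measurable_fderiv hΘ hθ _).mul_const _

lemma IsC2RandomField.measurable_obsInfo (hh : IsC2RandomField Θ h) (hΘ : IsOpen Θ) {θ : E d}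
    (hθ : θ ∈ Θ) (a : Matrix (Fin d) (Fin d) ℝ) (i j : Fin d) :
    Measurable fun ω => obsInfo (h ω) a θ i j := by
  simp only [obsInfo, Matrix.neg_apply, Matrix.mul_apply]
  exact (Finset.measurable_sum _ fun k _ => (Finset.measurable_sum _ fun l _ =>
    (hh.measurable_hess hΘ hθ _ _).const_mul _).mul_const _).neg

lemma measurable_frob_sub {M N : Ω → Matrix (Fin d) (Fin d) ℝ}
    (hM : ∀ i j, Measurable fun ω => M ω i j) (hN : ∀ i j, Measurable fun ω => N ω i j) :
    Measurable fun ω => frob (M ω - N ω) := by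
  simp only [frob, Matrix.sub_apply]
  exact (Finset.measurable_sum _ fun i _ => Finset.measurable_sum _ fun j _ =>
    ((hM i j).sub (hN i j)).pow_const 2).sqrt

/-- By continuity along S the supremum is already attained in the limit along a countable dense
sequence of S. -/
lemma measurable_biSup_of_continuousOn {X : Type*} [TopologicalSpace X]
    [SecondCountableTopology X] {S : Set X} {g : Ω → X → ℝ≥0∞}
    (hm : ∀ x ∈ S, Measurable fun ω => g ω x) (hc : ∀ ω, ContinuousOn (g ω) S) :
    Measurable fun ω => ⨆ x ∈ S, g ω x := by
  rcases S.eq_empty_or_nonempty with rfl | hS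
  · simp
  have : Nonempty S := hS.to_subtype
  have heq : (fun ω => ⨆ x ∈ S, g ω x)
      = fun ω => ⨆ n : ℕ, g ω (TopologicalSpace.denseSeq S n) := by
    funext ω
    rw [← iSup_subtype'']
    refine le_antisymm (iSup_le fun x => ?_) (iSup_le fun n => le_iSup (fun x : S => g ω x) _)
    have hcl : IsClosed {x : S | g ω x ≤ ⨆ n : ℕ, g ω (TopologicalSpace.denseSeq S n)} :=
      isClosed_le (hc ω).domRestrict continuous_const
    have hsub : Set.range (TopologicalSpace.denseSeq S)
        ⊆ {x : S | g ω x ≤ ⨆ n : ℕ, g ω (TopologicalSpace.denseSeq S n)} := by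
      rintro _ ⟨n, rfl⟩
      exact le_iSup (fun n => g ω (TopologicalSpace.denseSeq S n)) n
    exact hcl.closure_subset_iff.2 hsub ((TopologicalSpace.denseRange_denseSeq S) x)
  rw [heq]
  exact Measurable.iSup fun n => hm _ (TopologicalSpace.denseSeq S n).2

/-- A field with continuous paths on a measurable set is jointly measurable there. -/
lemma measurable_indicator_uncurry {S : Set (E d)} (hS : MeasurableSet S) {g : Ω → E d → ℝ}
    (hm : ∀ x ∈ S, Measurable fun ω => g ω x) (hc : ∀ ω, ContinuousOn (g ω) S) :
    Measurable fun q : Ω × E d => S.indicator (g q.1) q.2 := by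
  have h1 : Measurable (Function.uncurry fun (x : S) (ω : Ω) => g ω x) :=
    measurable_uncurry_of_continuous_of_measurable (fun ω => (hc ω).domRestrict)
      fun x => hm x x.2
  have hSm : MeasurableSet {q : Ω × E d | q.2 ∈ S} := measurable_snd hS
  refine measurable_of_restrict_of_restrict_compl hSm ?_ ?_
  · have : ({q : Ω × E d | q.2 ∈ S}.domRestrict fun q : Ω × E d => S.indicator (g q.1) q.2)
        = fun q => Function.uncurry (fun (x : S) (ω : Ω) => g ω x) (⟨q.1.2, q.2⟩, q.1.1) := by
      funext q
      exact Set.indicator_of_mem (s := S) q.2 _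
    rw [this]
    refine h1.comp (Measurable.prodMk ?_ ?_)
    · exact (measurable_snd.comp measurable_subtype_coe).subtype_mk
    · exact measurable_fst.comp measurable_subtype_coe
  · have : ({q : Ω × E d | q.2 ∈ S}ᶜ.domRestrict fun q : Ω × E d => S.indicator (g q.1) q.2)
        = fun _ => 0 := by
      funext q
      exact Set.indicator_of_notMem (s := S) q.2 _
    rw [this]
    exact measurable_const

end Fields

end QLA

namespace QLA

/-! ### Markov bounds extracted from [S3] -/

section TailBounds

variable {d : ℕ} {Ω : Type*} [MeasurableSpace Ω] {P : Measure Ω}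

/-- Markov's inequality for a function of bounded `L^p` norm. -/
lemma measureReal_lt_enorm_le [IsProbabilityMeasure P] {ε' : Type*} [TopologicalSpace ε']
    [ContinuousENorm ε']
    {f : Ω → ε'} (hf : AEStronglyMeasurable f P) {p K x : ℝ} (hp : 0 < p) (hK : 0 ≤ K)
    (hx : 0 < x) (h : eLpNorm f (ENNReal.ofReal p) P ≤ ENNReal.ofReal K) :
    P.real {ω | ENNReal.ofReal x < ‖f ω‖ₑ} ≤ (K / x) ^ p := by
  have h1 := meas_ge_le_mul_pow_eLpNorm_enorm P (p := ENNReal.ofReal p)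
    (by simpa using hp) ENNReal.ofReal_ne_top hf (ε := ENNReal.ofReal x) (by simpa using hx)
    (by simp)
  rw [ENNReal.toReal_ofReal hp.le] at h1
  have h2 : (ENNReal.ofReal x)⁻¹ ^ p * eLpNorm f (ENNReal.ofReal p) P ^ p
      ≤ ENNReal.ofReal ((K / x) ^ p) := by
    rw [← ENNReal.mul_rpow_of_nonneg _ _ hp.le, ← ENNReal.ofReal_rpow_of_nonneg
      (by positivity) hp.le, ENNReal.ofReal_div_of_pos hx, ENNReal.div_eq_inv_mul]
    gcongr
  refine ENNReal.toReal_le_of_le_ofReal (by positivity) ?_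
  refine le_trans (measure_mono fun ω hω => ?_) (h1.trans h2)
  rw [Set.mem_ofPred_eq] at hω ⊢
  exact hω.le

lemma exists_eLpNorm_le_of_iSup_lt_top {ι ε' : Type*} [TopologicalSpace ε'] [ContinuousENorm ε']
    {f : ι → Ω → ε'} {p : ℝ≥0∞} (h : ⨆ T, eLpNorm (f T) p P < ∞) :
    ∃ K : ℝ, 0 ≤ K ∧ ∀ T, eLpNorm (f T) p P ≤ ENNReal.ofReal K :=
  ⟨(⨆ T, eLpNorm (f T) p P).toReal, ENNReal.toReal_nonneg, fun T => by
    rw [ENNReal.ofReal_toReal h.ne]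
    exact le_iSup (fun T => eLpNorm (f T) p P) T⟩

variable [IsProbabilityMeasure P] {Θ : Set (E d)} {θs : E d} {𝕋 : Set ℝ≥0}
  {H : 𝕋 → Ω → E d → ℝ} {a : 𝕋 → GL (Fin d) ℝ}
  {Y : Ω → E d → ℝ} {Γ : Ω → Matrix (Fin d) (Fin d) ℝ} {L α β₁ β₂ ρ₁ ρ₂ : ℝ}

lemma S1.alpha_lt_half (h : S1 α β₁ β₂ ρ₁ ρ₂) : α < 1 / 2 := by
  linarith [h.alpha_lt, h.gap, h.beta₂_nonneg]

lemma S1.rho₁_lt_one (h : S1 α β₁ β₂ ρ₁ ρ₂) : ρ₁ < 1 := (lt_min_iff.1 h.rho₁_lt).1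

lemma S1.rho₁_lt_modulus (h : S1 α β₁ β₂ ρ₁ ρ₂) : 0 < α / (1 - α) - ρ₁ :=
  sub_pos.2 (lt_min_iff.1 (lt_min_iff.1 h.rho₁_lt).2).1

lemma S1.rho₁_lt_limit (h : S1 α β₁ β₂ ρ₁ ρ₂) : 0 < 2 * β₁ / (1 - α) - ρ₁ :=
  sub_pos.2 (lt_min_iff.1 (lt_min_iff.1 h.rho₁_lt).2).2

lemma S3.score_tail (hS3 : S3 P Θ θs H a Y Γ L α β₁ β₂ ρ₁ ρ₂) (hS1 : S1 α β₁ β₂ ρ₁ ρ₂)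
    (hL : 0 < L) (hΘ : IsOpen Θ) (hθs : θs ∈ Θ) (hH : ∀ T, IsC2RandomField Θ (H T)) :
    ∃ K : ℝ, 0 ≤ K ∧ ∀ T, ∀ x > 0,
      P.real {ω | x < ‖score (H T ω) θs (a T).1‖} ≤ (K / x) ^ (L / (1 - ρ₁)) := by
  obtain ⟨K, hK, h⟩ := exists_eLpNorm_le_of_iSup_lt_top hS3.score_bound
  refine ⟨K, hK, fun T x hx => ?_⟩
  have hp : 0 < L / (1 - ρ₁) := div_pos hL (by linarith [hS1.rho₁_lt_one])
  refine (measureReal_mono fun ω hω => ?_).trans (measureReal_lt_enorm_le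
    ((hH T).measurable_score hΘ hθs (a T).1).aestronglyMeasurable hp hK hx (h T))
  simp only [Set.mem_ofPred_eq] at hω ⊢
  rw [← ofReal_norm]
  exact (ENNReal.ofReal_lt_ofReal_iff_of_nonneg hx.le).2 hω

/-- The event with an existential quantifier lies in the event that the supremum exceeds x; the
supremum is measurable because the paths are continuous, so Markov's inequality applies to it. -/
lemma S3.contrast_tail (hS3 : S3 P Θ θs H a Y Γ L α β₁ β₂ ρ₁ ρ₂) (hS1 : S1 α β₁ β₂ ρ₁ ρ₂)
    (hL : 0 < L) (hθs : θs ∈ Θ) (hH : ∀ T, IsC2RandomField Θ (H T))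
    (hY : IsContRandomField Θ Y) :
    ∃ K : ℝ, 0 ≤ K ∧ ∀ T, ∀ x > 0,
      P.real {ω | ∃ θ ∈ Θ, rate (a T).1 ^ (-α / 2) ≤ ‖θ - θs‖ ∧
        x < rate (a T).1 ^ (1 / 2 - β₂) * |contrast (H T ω) θs (a T).1 θ - Y ω θ|}
          ≤ (K / x) ^ (L / (1 - 2 * β₂ - ρ₂)) := by
  obtain ⟨K, hK, h⟩ := exists_eLpNorm_le_of_iSup_lt_top hS3.contrast_bound
  refine ⟨K, hK, fun T x hx => ?_⟩
  have hp : 0 < L / (1 - 2 * β₂ - ρ₂) := div_pos hL hS1.gap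
  have hmeas : Measurable fun ω => ⨆ θ ∈ Θ \ Metric.ball θs (rate (a T).1 ^ (-α / 2)),
        ENNReal.ofReal (rate (a T).1 ^ (1 / 2 - β₂) *
          |contrast (H T ω) θs (a T).1 θ - Y ω θ|) := by
    refine measurable_biSup_of_continuousOn (fun θ hθ => ?_) (fun ω => ?_)
    · exact ((((((hH T).measurable θ hθ.1).sub ((hH T).measurable θs hθs)).const_mul _).sub
        (hY.measurable θ hθ.1)).norm.const_mul _).ennreal_ofReal
    · have h1 : ContinuousOn (H T ω) (Θ \ Metric.ball θs (rate (a T).1 ^ (-α / 2))) :=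
        ((hH T).continuousOn ω).mono (Set.sdiff_subset.trans subset_closure)
      have h2 : ContinuousOn (Y ω) (Θ \ Metric.ball θs (rate (a T).1 ^ (-α / 2))) :=
        (hY.continuousOn ω).mono Set.sdiff_subset
      unfold contrast
      exact ENNReal.continuous_ofReal.comp_continuousOn (by fun_prop)
  refine (measureReal_mono fun ω hω => ?_).trans (measureReal_lt_enorm_le
    hmeas.aestronglyMeasurable hp hK hx (h T))
  obtain ⟨θ, hθ, hθ', hlt⟩ := hω
  rw [Set.mem_ofPred_eq, enorm_eq_self]
  refine lt_of_lt_of_le ((ENNReal.ofReal_lt_ofReal_iff_of_nonneg hx.le).2 hlt) ?_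
  refine le_iSup₂_of_le θ ⟨hθ, ?_⟩ le_rfl
  rw [Metric.mem_ball, dist_eq_norm, not_lt]
  exact hθ'

/-- The substitution θ = θ* + δu turns the unit ball in [S3] (iii) into the δ-ball about θ*. The
O(δ) there supplies one constant for all small δ and all T. -/
lemma S3.info_modulus_tail (hS3 : S3 P Θ θs H a Y Γ L α β₁ β₂ ρ₁ ρ₂) (hS1 : S1 α β₁ β₂ ρ₁ ρ₂)
    (hL : 0 < L) (hΘ : IsOpen Θ) (hθs : θs ∈ Θ) (hH : ∀ T, IsC2RandomField Θ (H T)) :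
    ∃ K : ℝ, 0 ≤ K ∧ ∃ δ₀ > 0, ∀ δ ∈ Set.Ioo 0 δ₀, ∀ T, ∀ x > 0,
      P.real {ω | ∃ θ ∈ Θ, ‖θ - θs‖ ≤ δ ∧
        x < frob (obsInfo (H T ω) (a T).1 θ - obsInfo (H T ω) (a T).1 θs)}
          ≤ (K * δ / x) ^ (L / (α / (1 - α) - ρ₁)) := by
  obtain ⟨C, hC⟩ := hS3.info_modulus
  obtain ⟨δ₀, hδ₀, hδ⟩ := mem_nhdsGT_iff_exists_Ioo_subset.1 hC
  refine ⟨max C 0, le_max_right _ _, δ₀, hδ₀, fun δ hδ' T x hx => ?_⟩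
  have hp : 0 < L / (α / (1 - α) - ρ₁) := div_pos hL hS1.rho₁_lt_modulus
  have hbound := (iSup_le_iff.1 (Set.mem_ofPred_eq ▸ hδ hδ')) T
  have hmeas : Measurable fun ω => ⨆ u ∈ {u : E d | θs + δ • u ∈ Θ ∧ ‖u‖ ≤ 1},
        ENNReal.ofReal
          (frob (obsInfo (H T ω) (a T).1 (θs + δ • u) - obsInfo (H T ω) (a T).1 θs)) := by
    refine measurable_biSup_of_continuousOn (fun u hu => ?_) (fun ω => ?_)
    · exact (measurable_frob_sub ((hH T).measurable_obsInfo hΘ hu.1 _)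
        ((hH T).measurable_obsInfo hΘ hθs _)).ennreal_ofReal
    · refine ENNReal.continuous_ofReal.comp_continuousOn (continuous_frob.comp_continuousOn
        (ContinuousOn.sub ?_ continuousOn_const))
      exact (continuousOn_obsInfo hΘ ((hH T).contDiffOn ω) (a T).1).comp
        (by fun_prop) (fun u hu => hu.1)
  have hKδ : 0 ≤ max C 0 * δ := mul_nonneg (le_max_right _ _) hδ'.1.le
  refine (measureReal_mono fun ω hω => ?_).trans (measureReal_lt_enorm_le
    hmeas.aestronglyMeasurable hp hKδ hx (hbound.trans (ENNReal.ofReal_le_ofReal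
      (mul_le_mul_of_nonneg_right (le_max_left _ _) hδ'.1.le))))
  obtain ⟨θ, hθ, hθ', hlt⟩ := hω
  rw [Set.mem_ofPred_eq, enorm_eq_self]
  have hθeq : θs + δ • (δ⁻¹ • (θ - θs)) = θ := by
    rw [smul_inv_smul₀ hδ'.1.ne']
    abel
  refine lt_of_lt_of_le ((ENNReal.ofReal_lt_ofReal_iff_of_nonneg hx.le).2 hlt) ?_
  refine le_iSup₂_of_le (δ⁻¹ • (θ - θs)) ⟨by rwa [hθeq], ?_⟩ (by rw [hθeq])
  rw [norm_smul, norm_inv, Real.norm_of_nonneg hδ'.1.le, inv_mul_le_iff₀ hδ'.1, mul_one]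
  exact hθ'

lemma S3.info_limit_tail (hS3 : S3 P Θ θs H a Y Γ L α β₁ β₂ ρ₁ ρ₂) (hS1 : S1 α β₁ β₂ ρ₁ ρ₂)
    (hd : 0 < d) (hL : 0 < L) (hΘ : IsOpen Θ) (hθs : θs ∈ Θ)
    (hH : ∀ T, IsC2RandomField Θ (H T)) (hΓ : ∀ i j, Measurable fun ω => Γ ω i j) :
    ∃ K : ℝ, 0 ≤ K ∧ ∀ T, ∀ x > 0,
      P.real {ω | x < frob (obsInfo (H T ω) (a T).1 θs - Γ ω)}
          ≤ (K * rate (a T).1 ^ (-β₁) / x) ^ (L / (2 * β₁ / (1 - α) - ρ₁)) := by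
  obtain ⟨K, hK, h⟩ := exists_eLpNorm_le_of_iSup_lt_top hS3.info_limit
  refine ⟨K, hK, fun T x hx => ?_⟩
  have hb := rate_pos hd (a T)
  have hbβ : 0 < rate (a T).1 ^ β₁ := by positivity
  have hp : 0 < L / (2 * β₁ / (1 - α) - ρ₁) := div_pos hL hS1.rho₁_lt_limit
  have hmeas := (measurable_frob_sub ((hH T).measurable_obsInfo hΘ hθs (a T).1) hΓ).const_mul
    (rate (a T).1 ^ β₁)
  have hle := measureReal_lt_enorm_le hmeas.aestronglyMeasurable hp hK
    (x := rate (a T).1 ^ β₁ * x) (by positivity) (h T)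
  have heq : K * rate (a T).1 ^ (-β₁) / x = K / (rate (a T).1 ^ β₁ * x) := by
    rw [Real.rpow_neg hb.le]
    field_simp
  rw [heq]
  refine (measureReal_mono fun ω hω => ?_).trans hle
  rw [Set.mem_ofPred_eq, ← ofReal_norm, Real.norm_of_nonneg
    (mul_nonneg hbβ.le (frob_nonneg _))]
  exact (ENNReal.ofReal_lt_ofReal_iff_of_nonneg (by positivity)).2
    (mul_lt_mul_of_pos_left hω hbβ)

end TailBounds

end QLA

namespace QLA

/-! ### Deterministic bounds on the log-likelihood ratio for |u| ≥ r -/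

section LargeDeviation

variable {d : ℕ}

/-- This converts decay of order r^{-ρ}|u|² into the linear decay |u|, uniformly in the random scale
r^{-ρ} allowed for the curvature. -/
lemma one_le_rpow_neg_mul {r s ρ : ℝ} (hr : 1 ≤ r) (hs : r ≤ s) (hρ : ρ ≤ 1) :
    1 ≤ r ^ (-ρ) * s := by
  have hr0 : 0 < r := by linarith
  calc (1 : ℝ) ≤ r ^ (1 - ρ) := Real.one_le_rpow hr (by linarith)
    _ = r ^ (-ρ) * r := by rw [← Real.rpow_add_one hr0.ne']; ring_nf
    _ ≤ r ^ (-ρ) * s := by gcongr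

/-- The log-likelihood ratio in the region where its quadratic approximation is valid. -/
lemma sub_le_of_near {Θ : Set (E d)} (hΘ : IsOpen Θ) {h : E d → ℝ} (hh : ContDiffOn ℝ 2 h Θ)
    {θs : E d} {a Γ : Matrix (Fin d) (Fin d) ℝ} (hΓ : Γ.IsSymm) {δ r ρ : ℝ} (hr : 1 ≤ r)
    (hρ : ρ ≤ 1) (hball : Metric.ball θs δ ⊆ Θ) {u : E d} (hu : ‖act a u‖ < δ) (hru : r ≤ ‖u‖)
    (h1 : ‖score h θs a‖ ≤ r ^ (1 - ρ) / 8) (h2 : r ^ (-ρ) ≤ lambdaMin Γ)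
    (h3 : ∀ θ ∈ Θ, ‖θ - θs‖ ≤ δ → frob (obsInfo h a θ - obsInfo h a θs) ≤ r ^ (-ρ) / 8)
    (h4 : frob (obsInfo h a θs - Γ) ≤ r ^ (-ρ) / 8) :
    h (θs + act a u) - h θs ≤ -‖u‖ / 4 := by
  have hr0 : 0 < r := by linarith
  have hsmall : ∀ s ∈ Set.Icc (0 : ℝ) 1, ‖s • act a u‖ < δ := fun s hs => by
    rw [norm_smul, Real.norm_of_nonneg hs.1]
    exact (mul_le_of_le_one_left (norm_nonneg _) hs.2).trans_lt hu
  have hseg : ∀ s ∈ Set.Icc (0 : ℝ) 1, θs + s • act a u ∈ Θ := fun s hs => by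
    refine hball ?_
    simpa using hsmall s hs
  obtain ⟨s, hs, heq⟩ := exists_sub_eq_quadratic hΘ hh θs a u hseg
  rw [heq]
  have hs' := Set.Ioo_subset_Icc_self hs
  set θ := θs + s • act a u with hθ
  -- In units of r^{-ρ}|u|² the score contributes at most 1/8, the form of Γ at most −1/2, and each
  -- of the two errors in Γ at most 1/16; the total is −1/4.
  have e1 : inner ℝ (score h θs a) u ≤ r ^ (1 - ρ) / 8 * ‖u‖ :=
    (real_inner_le_norm _ _).trans (by gcongr)
  have e2 := lambdaMin_mul_le hΓ u
  have e3 := abs_inner_act_le (obsInfo h a θ - obsInfo h a θs) u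
  have e4 := abs_inner_act_le (obsInfo h a θs - Γ) u
  rw [sub_act, inner_sub_right, abs_le] at e3 e4
  have f3 := h3 θ (hseg s hs') (by simpa [hθ] using (hsmall s hs').le)
  have hsq : 0 ≤ ‖u‖ ^ 2 := by positivity
  have g2 := mul_le_mul_of_nonneg_right h2 hsq
  have g3 := mul_le_mul_of_nonneg_right f3 hsq
  have g4 := mul_le_mul_of_nonneg_right h4 hsq
  have g1 : r ^ (1 - ρ) * ‖u‖ ≤ r ^ (-ρ) * ‖u‖ ^ 2 := by
    have : r ^ (1 - ρ) = r ^ (-ρ) * r := by rw [← Real.rpow_add_one hr0.ne']; ring_nf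
    rw [this, sq, mul_assoc]
    gcongr
  have g5 : ‖u‖ ≤ r ^ (-ρ) * ‖u‖ ^ 2 := by
    have := mul_le_mul_of_nonneg_right (one_le_rpow_neg_mul hr hru hρ) (norm_nonneg u)
    linarith
  linarith [e3.1, e4.1]

/-- The log-likelihood ratio away from the true value. -/
lemma sub_le_of_far {Θ : Set (E d)} {h Y : E d → ℝ} {θs : E d} {a : GL (Fin d) ℝ} (hd : 0 < d)
    {α β₁ β₂ ρ₁ ρ₂ D χ r : ℝ} (hS1 : S1 α β₁ β₂ ρ₁ ρ₂) (hr : 1 ≤ r) (hD : 1 ≤ D)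
    (hΘD : ∀ θ ∈ Θ, ‖θ - θs‖ ≤ D) {u : E d} (huΘ : θs + act a.1 u ∈ Θ)
    (hfar : rate a.1 ^ (-α / 2) ≤ ‖act a.1 u‖) (hru : r ≤ ‖u‖)
    (hY : ∀ θ ∈ Θ, Y θ ≤ -χ * ‖θ - θs‖ ^ 2) (hχ : r ^ (-(ρ₂ - 2 * α)) ≤ χ)
    (hc : ∀ θ ∈ Θ, rate a.1 ^ (-α / 2) ≤ ‖θ - θs‖ →
      rate a.1 ^ (1 / 2 - β₂) * |contrast h θs a.1 θ - Y θ|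
        ≤ r ^ (1 - 2 * β₂ - ρ₂) / (2 * D)) :
    h (θs + act a.1 u) - h θs ≤ -‖u‖ / 4 := by
  have hr0 : 0 < r := by linarith
  have hb := rate_pos hd a
  have hub := sq_norm_le_rate_mul hd a u
  have hv := hΘD _ huΘ
  have hYu := hY _ huΘ
  have hcu := hc _ huΘ (by simpa using hfar)
  rw [add_sub_cancel_left] at hv hYu
  have hcontr : h (θs + act a.1 u) - h θs = rate a.1 * contrast h θs a.1 (θs + act a.1 u) := by
    rw [contrast, mul_inv_cancel_left₀ hb.ne']
  rw [hcontr]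
  set b := rate a.1
  set n := ‖act a.1 u‖
  have hn0 : 0 < n := lt_of_lt_of_le (Real.rpow_pos_of_pos hb _) hfar
  have hrb : r ≤ b ^ (1 / 2 : ℝ) * n := by
    refine hru.trans (abs_le_of_sq_le_sq' ?_ (by positivity)).2
    rw [mul_pow, ← Real.sqrt_eq_rpow, Real.sq_sqrt hb.le]
    exact hub
  have hbn : b ^ (-α) ≤ n ^ 2 := by
    have h1 : b ^ (-α) = (b ^ (-α / 2)) ^ 2 := by
      rw [← Real.rpow_natCast, ← Real.rpow_mul hb.le]
      norm_num
    rw [h1]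
    gcongr
  -- Raising r ≤ b^{1/2} n to the power γ produces b^{1/2−β₂} b^{-α} n^γ. Here b^{-α} ≤ n² because
  -- the point is far, and n^γ ≤ D because γ ≤ 1 and D ≥ 1. The error of the contrast is thereby
  -- absorbed into half of κn².
  set γ := 1 - 2 * β₂ - 2 * α
  have hγ0 : 0 ≤ γ := by linarith [hS1.gap, hS1.alpha_lt]
  have hγ1 : γ ≤ 1 := by linarith [hS1.beta₂_nonneg, hS1.alpha_pos]
  have hnγ : n ^ γ ≤ D := by
    calc n ^ γ ≤ D ^ γ := by gcongr
      _ ≤ D ^ (1 : ℝ) := Real.rpow_le_rpow_of_exponent_le hD hγ1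
      _ = D := Real.rpow_one D
  have hrγ : r ^ γ ≤ b ^ (1 / 2 - β₂) * n ^ 2 * D := by
    calc r ^ γ ≤ (b ^ (1 / 2 : ℝ) * n) ^ γ := by gcongr
      _ = b ^ (1 / 2 - β₂) * b ^ (-α) * n ^ γ := by
        rw [Real.mul_rpow (by positivity) hn0.le, ← Real.rpow_mul hb.le, ← Real.rpow_add hb]
        congr 2
        ring
      _ ≤ b ^ (1 / 2 - β₂) * n ^ 2 * D := by gcongr
  have hsplit : r ^ (1 - 2 * β₂ - ρ₂) = r ^ (-(ρ₂ - 2 * α)) * r ^ γ := by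
    rw [← Real.rpow_add hr0]
    congr 1
    ring
  set κ := r ^ (-(ρ₂ - 2 * α))
  have hκ : 0 < κ := by positivity
  have hdiff : |contrast h θs a.1 (θs + act a.1 u) - Y (θs + act a.1 u)| ≤ κ * n ^ 2 / 2 := by
    have hbb : 0 < b ^ (1 / 2 - β₂) := by positivity
    refine le_of_mul_le_mul_left (hcu.trans ?_) hbb
    rw [hsplit, div_le_iff₀ (by positivity)]
    have := mul_le_mul_of_nonneg_left hrγ hκ.le
    linarith
  have hcon : contrast h θs a.1 (θs + act a.1 u) ≤ -(κ * n ^ 2 / 2) := by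
    have := mul_le_mul_of_nonneg_right hχ (sq_nonneg n)
    linarith [(abs_le.1 hdiff).2]
  have h1 := mul_le_mul_of_nonneg_left hcon hb.le
  have h2 := mul_le_mul_of_nonneg_left hub hκ.le
  have h3 := mul_le_mul_of_nonneg_right (one_le_rpow_neg_mul hr hru
    (ρ := ρ₂ - 2 * α) (by linarith [hS1.gap, hS1.beta₂_nonneg, hS1.alpha_pos])) (norm_nonneg u)
  have h4 : 1 * ‖u‖ ≤ κ * ‖u‖ ^ 2 := h3.trans_eq (by ring)
  linarith [norm_nonneg u]

end LargeDeviation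

end QLA

namespace QLA

/-! ### The large deviation inequality -/

section LargeDeviationProbability

variable {d : ℕ} {Ω : Type*} [MeasurableSpace Ω] {P : Measure Ω} [IsProbabilityMeasure P]
  {Θ : Set (E d)} {θs : E d} {𝕋 : Set ℝ≥0} {H : 𝕋 → Ω → E d → ℝ} {a : 𝕋 → GL (Fin d) ℝ}
  {Y : Ω → E d → ℝ} {Γ : Ω → Matrix (Fin d) (Fin d) ℝ} {L α β₁ β₂ ρ₁ ρ₂ : ℝ}

/-- A Markov bound of order L/κ for a quantity of size r^{-κ} gives exactly r^{-L}. Each κ is the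
denominator of a moment order in [S3]. -/
lemma rpow_div_le_of_le {c r κ L y : ℝ} (hc : 0 ≤ c) (hr : 0 < r) (hκ : 0 < κ) (hL : 0 < L)
    (hy0 : 0 ≤ y) (hy : y ≤ c * r ^ (-κ)) : y ^ (L / κ) ≤ c ^ (L / κ) / r ^ L := by
  calc y ^ (L / κ) ≤ (c * r ^ (-κ)) ^ (L / κ) := by gcongr
    _ = c ^ (L / κ) / r ^ L := by
      have e : -κ * (L / κ) = -L := by field_simp
      rw [Real.mul_rpow hc (by positivity), ← Real.rpow_mul hr.le, e, Real.rpow_neg hr.le]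
      exact (div_eq_mul_inv _ _).symm

lemma rpow_neg_le_rpow_neg_of_le_rpow {b r s t : ℝ} (hb : 0 < b) (hr : 0 < r) (hs : 0 < s)
    (ht : 0 ≤ t) (h : r ≤ b ^ s) : b ^ (-t) ≤ r ^ (-(t / s)) := by
  have h1 : b ^ (-t) = (b ^ s) ^ (-(t / s)) := by
    rw [← Real.rpow_mul hb.le]
    congr 1
    field_simp
  rw [h1]
  exact Real.rpow_le_rpow_of_nonpos hr h (by have := div_nonneg ht hs.le; linarith)

/-- Polynomial type large deviation inequality. -/
theorem exists_large_deviation (hd : 0 < d) (hΘo : IsOpen Θ) (hΘb : Bornology.IsBounded Θ)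
    (hθs : θs ∈ Θ) (hH : ∀ T, IsC2RandomField Θ (H T)) (hY : IsContRandomField Θ Y)
    (hΓsymm : ∀ ω, (Γ ω).IsSymm) (hΓ : ∀ i j, Measurable fun ω => Γ ω i j)
    (hS1 : S1 α β₁ β₂ ρ₁ ρ₂) (hS2 : S2 P Θ θs Y Γ L α ρ₁ ρ₂)
    (hS3 : S3 P Θ θs H a Y Γ L α β₁ β₂ ρ₁ ρ₂) (hL : 0 < L) :
    ∃ C b₀ : ℝ, 0 ≤ C ∧ 0 < b₀ ∧ ∀ T, b₀ ≤ rate (a T).1 → ∀ r : ℝ, 1 ≤ r →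
      P.real {ω | ∃ u, θs + act (a T).1 u ∈ Θ ∧ r ≤ ‖u‖ ∧
        -‖u‖ / 4 < H T ω (θs + act (a T).1 u) - H T ω θs} ≤ C / r ^ L := by
  obtain ⟨K₁, hK₁, t₁⟩ := hS3.score_tail hS1 hL hΘo hθs hH
  obtain ⟨C₂, t₂⟩ := hS2.nondegenerate
  obtain ⟨K₃, hK₃, δ₀, hδ₀, t₃⟩ := hS3.info_modulus_tail hS1 hL hΘo hθs hH
  obtain ⟨K₄, hK₄, t₄⟩ := hS3.info_limit_tail hS1 hd hL hΘo hθs hH hΓ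
  obtain ⟨χ₀, -, -, hsep, C₅, t₅⟩ := hS2.separation
  obtain ⟨K₆, hK₆, t₆⟩ := hS3.contrast_tail hS1 hL hθs hH hY
  obtain ⟨D, hD1, hD⟩ : ∃ D : ℝ, 1 ≤ D ∧ ∀ θ ∈ Θ, ‖θ - θs‖ ≤ D := by
    obtain ⟨D, hD⟩ := hΘb.subset_closedBall θs
    refine ⟨max D 1, le_max_right _ _, fun θ hθ => ?_⟩
    have := hD hθ
    rw [Metric.mem_closedBall, dist_eq_norm] at this
    exact this.trans (le_max_left _ _)
  obtain ⟨ε, hε, hball⟩ := Metric.isOpen_iff.1 hΘo θs hθs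
  have hα := hS1.alpha_pos
  have hα2 := hS1.alpha_lt_half
  -- From `b₀` on, the near region is contained in Θ (radius `ε`) and in the range where the modulus
  -- bound is valid (radius `δ₀`).
  obtain ⟨b₀, hb₀, hbound⟩ : ∃ b₀ > 0, ∀ b : ℝ, b₀ ≤ b → b ^ (-α / 2) < min ε δ₀ := by
    have h1 : Tendsto (fun b : ℝ => b ^ (-(α / 2))) atTop (𝓝 0) :=
      tendsto_rpow_neg_atTop (by linarith)
    obtain ⟨b₀, hb₀⟩ := eventually_atTop.1 (h1.eventually_lt_const (lt_min hε hδ₀))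
    exact ⟨max b₀ 1, by positivity, fun b hb => by
      rw [neg_div]; exact hb₀ b ((le_max_left _ _).trans hb)⟩
  have k1 : 0 < 1 - ρ₁ := sub_pos.2 hS1.rho₁_lt_one
  have k3 := hS1.rho₁_lt_modulus
  have k4 := hS1.rho₁_lt_limit
  have k6 := hS1.gap
  set c₁ := (8 * K₁) ^ (L / (1 - ρ₁))
  set c₃ := (8 * K₃) ^ (L / (α / (1 - α) - ρ₁))
  set c₄ := (8 * K₄) ^ (L / (2 * β₁ / (1 - α) - ρ₁))
  set c₆ := (2 * D * K₆) ^ (L / (1 - 2 * β₂ - ρ₂))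
  refine ⟨c₁ + |C₂| + c₃ + c₄ + |C₅| + c₆, b₀, by positivity, hb₀, fun T hT r hr => ?_⟩
  have hr0 : 0 < r := by linarith
  have hb := rate_pos hd (a T)
  set b := rate (a T).1
  have hδ := hbound b hT
  have hδpos : 0 < b ^ (-α / 2) := by positivity
  have hhalf : 0 < (1 - α) / 2 := by linarith
  let B₁ : Set Ω := {ω | r ^ (1 - ρ₁) / 8 < ‖score (H T ω) θs (a T).1‖}
  let B₂ : Set Ω := {ω | lambdaMin (Γ ω) < r ^ (-ρ₁)}
  -- The inequality between r and b is part of `B₃` and `B₄`. It is automatic when some u with |u| ≥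
  -- r is near, since |u| ≤ b^{1/2}|a u| < b^{(1−α)/2}. It turns the powers b^{-α/2} and b^{-β₁} of
  -- the bounds into powers of r; when it fails these events are empty.
  let B₃ : Set Ω := {ω | r ≤ b ^ ((1 - α) / 2) ∧ ω ∈ {ω | ∃ θ ∈ Θ, ‖θ - θs‖ ≤ b ^ (-α / 2) ∧
    r ^ (-ρ₁) / 8 < frob (obsInfo (H T ω) (a T).1 θ - obsInfo (H T ω) (a T).1 θs)}}
  let B₄ : Set Ω := {ω | r ≤ b ^ ((1 - α) / 2) ∧
    ω ∈ {ω | r ^ (-ρ₁) / 8 < frob (obsInfo (H T ω) (a T).1 θs - Γ ω)}}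
  let B₅ : Set Ω := {ω | χ₀ ω ≤ r ^ (-(ρ₂ - 2 * α))}
  let B₆ : Set Ω := {ω | ∃ θ ∈ Θ, b ^ (-α / 2) ≤ ‖θ - θs‖ ∧
    r ^ (1 - 2 * β₂ - ρ₂) / (2 * D) < b ^ (1 / 2 - β₂) * |contrast (H T ω) θs (a T).1 θ - Y ω θ|}
  let B₇ : Set Ω := {ω | ¬(Y ω θs = 0 ∧ ∀ θ ∈ Θ, Y ω θ ≤ -χ₀ ω * ‖θ - θs‖ ^ 2)}
  have p₁ : P.real B₁ ≤ c₁ / r ^ L := by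
    refine (t₁ T _ (by positivity)).trans (rpow_div_le_of_le (by positivity) hr0 k1 hL
      (by positivity) (le_of_eq ?_))
    rw [Real.rpow_neg hr0.le]
    field_simp
  have p₂ : P.real B₂ ≤ |C₂| / r ^ L := (t₂ r hr0).trans (by gcongr; exact le_abs_self _)
  have p₃ : P.real B₃ ≤ c₃ / r ^ L := by
    by_cases hrb : r ≤ b ^ ((1 - α) / 2)
    · refine (measureReal_mono fun ω hω => hω.2).trans ((t₃ _
        ⟨hδpos, hδ.trans_le (min_le_right _ _)⟩ T _ (by positivity)).trans
        (rpow_div_le_of_le (by positivity) hr0 k3 hL (by positivity) ?_))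
      have h := rpow_neg_le_rpow_neg_of_le_rpow (t := α / 2) hb hr0 hhalf (by linarith) hrb
      have e : α / 2 / ((1 - α) / 2) = α / (1 - α) := by
        field_simp
      rw [e, ← neg_div] at h
      have e2 : r ^ (-(α / (1 - α) - ρ₁)) = r ^ (-(α / (1 - α))) * r ^ ρ₁ := by
        rw [← Real.rpow_add hr0]
        ring_nf
      rw [e2, Real.rpow_neg hr0.le ρ₁]
      calc K₃ * b ^ (-α / 2) / ((r ^ ρ₁)⁻¹ / 8) = 8 * K₃ * (b ^ (-α / 2) * r ^ ρ₁) := by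
            field_simp
        _ ≤ _ := by gcongr
    · have : B₃ = ∅ := Set.eq_empty_of_forall_notMem fun ω hω => hrb hω.1
      rw [this, measureReal_empty]
      positivity
  have p₄ : P.real B₄ ≤ c₄ / r ^ L := by
    by_cases hrb : r ≤ b ^ ((1 - α) / 2)
    · refine (measureReal_mono fun ω hω => hω.2).trans ((t₄ T _ (by positivity)).trans
        (rpow_div_le_of_le (by positivity) hr0 k4 hL (by positivity) ?_))
      have h := rpow_neg_le_rpow_neg_of_le_rpow (t := β₁) hb hr0 hhalf hS1.beta₁_pos.le hrb
      have e : β₁ / ((1 - α) / 2) = 2 * β₁ / (1 - α) := by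
        field_simp
      rw [e] at h
      have e2 : r ^ (-(2 * β₁ / (1 - α) - ρ₁)) = r ^ (-(2 * β₁ / (1 - α))) * r ^ ρ₁ := by
        rw [← Real.rpow_add hr0]
        ring_nf
      rw [e2, Real.rpow_neg hr0.le ρ₁]
      calc K₄ * b ^ (-β₁) / ((r ^ ρ₁)⁻¹ / 8) = 8 * K₄ * (b ^ (-β₁) * r ^ ρ₁) := by
            field_simp
        _ ≤ _ := by gcongr
    · have : B₄ = ∅ := Set.eq_empty_of_forall_notMem fun ω hω => hrb hω.1
      rw [this, measureReal_empty]
      positivity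
  have p₅ : P.real B₅ ≤ |C₅| / r ^ L := (t₅ r hr0).trans (by gcongr; exact le_abs_self _)
  have p₆ : P.real B₆ ≤ c₆ / r ^ L := by
    refine (t₆ T _ (by positivity)).trans (rpow_div_le_of_le (by positivity) hr0 k6 hL
      (by positivity) (le_of_eq ?_))
    rw [Real.rpow_neg hr0.le]
    field_simp
  have p₇ : P.real B₇ = 0 := by
    rw [measureReal_def, ENNReal.toReal_eq_zero_iff]
    exact .inl hsep
  have hsub : {ω | ∃ u, θs + act (a T).1 u ∈ Θ ∧ r ≤ ‖u‖ ∧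
      -‖u‖ / 4 < H T ω (θs + act (a T).1 u) - H T ω θs}
        ⊆ B₁ ∪ B₂ ∪ B₃ ∪ B₄ ∪ B₅ ∪ B₆ ∪ B₇ := by
    rintro ω ⟨u, huΘ, hru, hlt⟩
    by_contra hω
    simp only [Set.mem_union, not_or] at hω
    obtain ⟨⟨⟨⟨⟨⟨n₁, n₂⟩, n₃⟩, n₄⟩, n₅⟩, n₆⟩, n₇⟩ := hω
    have n₁ : ‖score (H T ω) θs (a T).1‖ ≤ r ^ (1 - ρ₁) / 8 := not_lt.1 n₁
    have n₂ : r ^ (-ρ₁) ≤ lambdaMin (Γ ω) := not_lt.1 n₂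
    have n₅ : r ^ (-(ρ₂ - 2 * α)) ≤ χ₀ ω := le_of_lt (not_le.1 n₅)
    have n₇ := (not_not.1 n₇).2
    refine absurd hlt (not_lt.2 ?_)
    rcases lt_or_ge ‖act (a T).1 u‖ (b ^ (-α / 2)) with hnear | hfar
    · have hrb : r ≤ b ^ ((1 - α) / 2) := by
        have h1 := sq_norm_le_rate_mul hd (a T) u
        refine hru.trans (abs_le_of_sq_le_sq' (h1.trans ?_) (by positivity)).2
        calc b * ‖act (a T).1 u‖ ^ 2 ≤ b * (b ^ (-α / 2)) ^ 2 := by gcongr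
          _ = (b ^ ((1 - α) / 2)) ^ 2 := by
            rw [← Real.rpow_natCast, ← Real.rpow_natCast, ← Real.rpow_mul hb.le,
              ← Real.rpow_mul hb.le]
            nth_rewrite 1 [← Real.rpow_one b]
            rw [← Real.rpow_add hb]
            congr 1
            push_cast
            ring
      refine sub_le_of_near hΘo ((hH T).contDiffOn ω) (hΓsymm ω) hr hS1.rho₁_lt_one.le
        ((Metric.ball_subset_ball (hδ.le.trans (min_le_left _ _))).trans hball) hnear hru n₁ n₂
        (fun θ hθ hθ' => ?_) ?_
      · exact not_lt.1 fun hlt => n₃ ⟨hrb, θ, hθ, hθ', hlt⟩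
      · exact not_lt.1 fun hlt => n₄ ⟨hrb, hlt⟩
    · exact sub_le_of_far hd hS1 hr hD1 hD huΘ hfar hru n₇ n₅
        fun θ hθ hθ' => not_lt.1 fun hlt => n₆ ⟨θ, hθ, hθ', hlt⟩
  refine (measureReal_mono hsub).trans ?_
  have u₁ := measureReal_union_le (μ := P) (B₁ ∪ B₂ ∪ B₃ ∪ B₄ ∪ B₅ ∪ B₆) B₇
  have u₂ := measureReal_union_le (μ := P) (B₁ ∪ B₂ ∪ B₃ ∪ B₄ ∪ B₅) B₆
  have u₃ := measureReal_union_le (μ := P) (B₁ ∪ B₂ ∪ B₃ ∪ B₄) B₅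
  have u₄ := measureReal_union_le (μ := P) (B₁ ∪ B₂ ∪ B₃) B₄
  have u₅ := measureReal_union_le (μ := P) (B₁ ∪ B₂) B₃
  have u₆ := measureReal_union_le (μ := P) B₁ B₂
  simp only [add_div]
  linarith

end LargeDeviationProbability

end QLA

namespace QLA

/-! ### Superpolynomial decay of the exponential tail -/

section ExponentialTail

variable (d : ℕ)

/-- The first moment of the exponential tail outside the ball of radius `r`. -/
noncomputable def expTail (r : ℝ) : ℝ := ∫ u in {u : E d | r ≤ ‖u‖}, ‖u‖ * Real.exp (-‖u‖ / 4)

variable {d}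

lemma one_add_pow_mul_exp_le (n : ℕ) {x : ℝ} (hx : 0 ≤ x) :
    (1 + x) ^ n * Real.exp (-x / 4) ≤ n.factorial * 4 ^ n * Real.exp (1 / 4) := by
  have h := Real.pow_div_factorial_le_exp ((1 + x) / 4) (by positivity) n
  rw [div_pow, div_div, div_le_iff₀ (by positivity)] at h
  calc (1 + x) ^ n * Real.exp (-x / 4)
      ≤ Real.exp ((1 + x) / 4) * (4 ^ n * n.factorial) * Real.exp (-x / 4) := by gcongr
    _ = n.factorial * 4 ^ n * (Real.exp ((1 + x) / 4) * Real.exp (-x / 4)) := by ring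
    _ = n.factorial * 4 ^ n * Real.exp (1 / 4) := by rw [← Real.exp_add]; ring_nf

lemma integrable_one_add_norm_zpow :
    Integrable fun u : E d => (1 + ‖u‖) ^ (-((d : ℝ) + 1)) :=
  integrable_one_add_norm (by simp)

/-- The exponential pays for N + d + 2 powers of 1 + |u|: one absorbs the factor |u|, d + 1 leave an
integrable weight, and N remain as decay. -/
lemma norm_mul_exp_le (N : ℕ) (u : E d) : ‖u‖ * Real.exp (-‖u‖ / 4)
    ≤ (N + d + 2).factorial * 4 ^ (N + d + 2) * Real.exp (1 / 4) / (1 + ‖u‖) ^ N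
      * (1 + ‖u‖) ^ (-((d : ℝ) + 1)) := by
  have h := one_add_pow_mul_exp_le (N + d + 2) (norm_nonneg u)
  have h1 : 0 < 1 + ‖u‖ := by positivity
  have e : (1 + ‖u‖) ^ (-((d : ℝ) + 1)) = ((1 + ‖u‖) ^ (d + 1))⁻¹ := by
    rw [Real.rpow_neg h1.le]
    norm_cast
  rw [e, div_mul_eq_mul_div, ← div_eq_mul_inv, div_div, le_div_iff₀ (by positivity)]
  refine le_trans ?_ h
  calc ‖u‖ * Real.exp (-‖u‖ / 4) * ((1 + ‖u‖) ^ (d + 1) * (1 + ‖u‖) ^ N)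
      ≤ (1 + ‖u‖) * Real.exp (-‖u‖ / 4) * ((1 + ‖u‖) ^ (d + 1) * (1 + ‖u‖) ^ N) := by
        gcongr
        linarith
    _ = (1 + ‖u‖) ^ (N + d + 2) * Real.exp (-‖u‖ / 4) := by ring

lemma integrable_norm_mul_exp : Integrable fun u : E d => ‖u‖ * Real.exp (-‖u‖ / 4) := by
  refine (integrable_one_add_norm_zpow.const_mul
    ((0 + d + 2).factorial * 4 ^ (0 + d + 2) * Real.exp (1 / 4))).mono'
    (by fun_prop) (.of_forall fun u => ?_)
  rw [Real.norm_of_nonneg (by positivity)]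
  simpa using norm_mul_exp_le 0 u

lemma expTail_nonneg (r : ℝ) : 0 ≤ expTail d r := by
  refine integral_nonneg fun u => ?_
  simp only [Pi.zero_apply]
  positivity

variable (d) in
lemma exists_expTail_le (N : ℕ) : ∃ C : ℝ, 0 ≤ C ∧ ∀ r : ℝ, 0 ≤ r →
    expTail d r ≤ C / (1 + r) ^ N := by
  set A : ℝ := (N + d + 2).factorial * 4 ^ (N + d + 2) * Real.exp (1 / 4)
  have hA : 0 ≤ A := by positivity
  have hJ : 0 ≤ ∫ u : E d, (1 + ‖u‖) ^ (-((d : ℝ) + 1)) :=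
    integral_nonneg fun u => by simp only [Pi.zero_apply]; positivity
  refine ⟨A * ∫ u : E d, (1 + ‖u‖) ^ (-((d : ℝ) + 1)), by positivity, fun r hr => ?_⟩
  have hset : MeasurableSet {u : E d | r ≤ ‖u‖} := measurableSet_le measurable_const measurable_norm
  calc expTail d r ≤ ∫ u in {u : E d | r ≤ ‖u‖}, A / (1 + r) ^ N * (1 + ‖u‖) ^ (-((d : ℝ) + 1)) := by
        refine setIntegral_mono_on integrable_norm_mul_exp.integrableOn
          (integrable_one_add_norm_zpow.const_mul _).integrableOn hset fun u hu => ?_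
        refine (norm_mul_exp_le N u).trans ?_
        have : r ≤ ‖u‖ := hu
        gcongr
    _ ≤ ∫ u : E d, A / (1 + r) ^ N * (1 + ‖u‖) ^ (-((d : ℝ) + 1)) := by
        refine setIntegral_le_integral (integrable_one_add_norm_zpow.const_mul _)
          (.of_forall fun u => ?_)
        simp only [Pi.zero_apply]
        positivity
    _ = _ := by rw [integral_const_mul]; ring

end ExponentialTail

/-! ### Means of unnormalized densities -/

section PosteriorMean

variable {d : ℕ}

/-- The mean of the density proportional to `G` on `U`. -/
noncomputable def densityMean (U : Set (E d)) (G : E d → ℝ) : E d :=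
  (∫ u in U, G u)⁻¹ • ∫ u in U, G u • u

variable {U : Set (E d)} {G : E d → ℝ}

lemma integrableOn_smul_of_bounded (hU : MeasurableSet U) (hUb : Bornology.IsBounded U)
    (hG : IntegrableOn G U) {F : E d → E d} (hF : Continuous F) :
    IntegrableOn (fun u => G u • F u) U := by
  obtain ⟨B, hB⟩ := (hUb.isCompact_closure.image hF).isBounded.exists_norm_le
  refine Integrable.mono' (hG.norm.mul_const B)
    (hG.aestronglyMeasurable.smul hF.aestronglyMeasurable) ?_
  filter_upwards [ae_restrict_mem hU] with u hu
  rw [norm_smul]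
  gcongr
  exact hB _ (Set.mem_image_of_mem F (subset_closure hu))

lemma densityMean_sub (hU : MeasurableSet U) (hUb : Bornology.IsBounded U)
    (hG : IntegrableOn G U) (hpos : 0 < ∫ u in U, G u) (m : E d) :
    densityMean U G - m = (∫ u in U, G u)⁻¹ • ∫ u in U, G u • (u - m) := by
  have h1 : ∫ u in U, G u • (u - m) = (∫ u in U, G u • u) - (∫ u in U, G u) • m := by
    have hid : IntegrableOn (fun u => G u • u) U :=
      integrableOn_smul_of_bounded hU hUb hG continuous_id
    rw [← integral_smul_const, ← integral_sub hid (hG.smul_const m)]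
    simp only [smul_sub]
  rw [h1, smul_sub, inv_smul_smul₀ hpos.ne', densityMean]

/-- Inside the ball of radius r the integrand has norm at most r G, which contributes at most r
after normalization. Outside, the exponential bound leaves the tail integral, divided by the lower
bound D of the normalizing constant. -/
lemma norm_densityMean_le (hU : MeasurableSet U)
    (hG : IntegrableOn G U) {r C D : ℝ} (hr : 0 ≤ r) (hC : 0 ≤ C) (hD : 0 < D)
    (hpos : ∀ u ∈ U, 0 ≤ G u) (htail : ∀ u ∈ U, r ≤ ‖u‖ → G u ≤ C * Real.exp (-‖u‖ / 4))
    (hint : D ≤ ∫ u in U, G u) : ‖densityMean U G‖ ≤ r + C * expTail d r / D := by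
  have hI : 0 < ∫ u in U, G u := hD.trans_le hint
  have hset : MeasurableSet {u : E d | r ≤ ‖u‖} := measurableSet_le measurable_const measurable_norm
  have hint2 : Integrable fun u : E d => C * {u : E d | r ≤ ‖u‖}.indicator
      (fun u => ‖u‖ * Real.exp (-‖u‖ / 4)) u :=
    (integrable_norm_mul_exp.indicator hset).const_mul C
  have hnum : ‖∫ u in U, G u • u‖ ≤ r * (∫ u in U, G u) + C * expTail d r := by
    calc ‖∫ u in U, G u • u‖ ≤ ∫ u in U, (r * G u + C * {u : E d | r ≤ ‖u‖}.indicator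
          (fun u => ‖u‖ * Real.exp (-‖u‖ / 4)) u) := by
          refine norm_integral_le_of_norm_le ((hG.const_mul r).add hint2.integrableOn) ?_
          filter_upwards [ae_restrict_mem hU] with u hu
          rw [norm_smul, Real.norm_of_nonneg (hpos u hu)]
          by_cases hru : r ≤ ‖u‖
          · rw [Set.indicator_of_mem (s := {u : E d | r ≤ ‖u‖}) hru]
            have := mul_le_mul_of_nonneg_right (htail u hu hru) (norm_nonneg u)
            have := mul_nonneg hr (hpos u hu)
            linarith
          · rw [Set.indicator_of_notMem (s := {u : E d | r ≤ ‖u‖}) hru]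
            have := mul_le_mul_of_nonneg_left (not_le.1 hru).le (hpos u hu)
            linarith
      _ = r * (∫ u in U, G u) + C * ∫ u in U, {u : E d | r ≤ ‖u‖}.indicator
          (fun u => ‖u‖ * Real.exp (-‖u‖ / 4)) u := by
          rw [integral_add (hG.const_mul r) hint2.integrableOn, integral_const_mul,
            integral_const_mul]
      _ ≤ r * (∫ u in U, G u) + C * expTail d r := by
          gcongr
          rw [expTail, ← integral_indicator hset]
          refine setIntegral_le_integral (integrable_norm_mul_exp.indicator hset)
            (.of_forall fun u => ?_)
          exact Set.indicator_nonneg (fun u _ => by positivity) u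
  rw [densityMean, norm_smul, norm_inv, Real.norm_of_nonneg hI.le, inv_mul_le_iff₀ hI]
  refine hnum.trans ?_
  have h2 : C * expTail d r ≤ (∫ u in U, G u) * (C * expTail d r / D) := by
    rw [← mul_div_assoc, le_div_iff₀ hD, mul_comm]
    gcongr
    exact mul_nonneg hC (expTail_nonneg r)
  linarith

/-- The reflection u ↦ 2m − u preserves volume and the ball and reverses the sign of the integrand,
so the integral equals its own negative. -/
lemma setIntegral_closedBall_odd_eq_zero (m : E d) (R : ℝ) {F : E d → ℝ} (hF : ∀ v, F (-v) = F v) :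
    ∫ u in Metric.closedBall m R, F (u - m) • (u - m) = 0 := by
  rw [← integral_indicator Metric.isClosed_closedBall.measurableSet]
  set J := (Metric.closedBall m R).indicator fun u => F (u - m) • (u - m)
  have hodd : ∀ u, J (m + m - u) = -J u := fun u => by
    have hmem : m + m - u ∈ Metric.closedBall m R ↔ u ∈ Metric.closedBall m R := by
      rw [mem_closedBall_iff_norm, mem_closedBall_iff_norm, ← norm_neg (u - m)]
      congr! 2
      abel
    have hs : m + m - u - m = -(u - m) := by abel
    by_cases hu : u ∈ Metric.closedBall m R
    · simp only [J]
      rw [Set.indicator_of_mem (hmem.2 hu), Set.indicator_of_mem hu, hs, hF, smul_neg]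
    · simp only [J]
      rw [Set.indicator_of_notMem (hmem.not.2 hu), Set.indicator_of_notMem hu, neg_zero]
  have h1 := integral_sub_left_eq_self J volume (m + m)
  simp only [hodd, integral_neg] at h1
  have h2 : (2 : ℝ) • ∫ u, J u = 0 := by
    rw [two_smul]
    nth_rewrite 1 [← h1]
    exact neg_add_cancel _
  simpa using h2

end PosteriorMean

end QLA

namespace QLA

/-! ### Mean of a nearly Gaussian density -/

section QuadraticApproximation

variable {d : ℕ}

lemma quadratic_eq_complete_square {Γ : Matrix (Fin d) (Fin d) ℝ} (hΓ : Γ.IsSymm) (m u : E d) :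
    inner ℝ (act Γ m) u - inner ℝ u (act Γ u) / 2
      = inner ℝ m (act Γ m) / 2 - inner ℝ (u - m) (act Γ (u - m)) / 2 := by
  have h1 : inner ℝ m (act Γ u) = inner ℝ (act Γ m) u := by
    have := inner_act_transpose Γ m u
    rw [hΓ.eq] at this
    rw [this, real_inner_comm]
  rw [act_sub, inner_sub_left, inner_sub_right, inner_sub_right, h1,
    real_inner_comm (act Γ m) u]
  ring

variable {U : Set (E d)} {g w : E d → ℝ} {Γ : Matrix (Fin d) (Fin d) ℝ} {m : E d}
  {c C K M R η w₀ : ℝ}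

/-- The error is relative to exp y. Writing exp x = exp y · exp(x − y), the factor exp(x − y) is at
most 3 and differs from 1 by at most 2η because η ≤ 1. -/
lemma abs_exp_mul_sub_le {x y v w₀ η C : ℝ} (hη : η ≤ 1) (hxy : |x - y| ≤ η)
    (hv : |v - w₀| ≤ η) (hw : 0 ≤ w₀) (hwC : w₀ ≤ C) :
    |Real.exp x * v - Real.exp y * w₀| ≤ Real.exp y * (η * (3 + 2 * C)) := by
  have hη0 : 0 ≤ η := (abs_nonneg _).trans hxy
  have h1 : Real.exp x = Real.exp y * Real.exp (x - y) := by rw [← Real.exp_add]; ring_nf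
  have h2 := Real.abs_exp_sub_one_le (hxy.trans hη)
  have h3 : Real.exp (x - y) ≤ 3 := by
    have := (abs_le.1 h2).2
    linarith
  have h4 : Real.exp x * v - Real.exp y * w₀
      = Real.exp y * (Real.exp (x - y) * (v - w₀) + w₀ * (Real.exp (x - y) - 1)) := by
    rw [h1]
    ring
  have h5 : |Real.exp (x - y) - 1| ≤ 2 * η := h2.trans (by linarith)
  rw [h4, abs_mul, Real.abs_exp]
  gcongr
  refine (abs_add_le _ _).trans ?_
  rw [abs_mul, abs_mul, Real.abs_exp, abs_of_nonneg hw]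
  calc Real.exp (x - y) * |v - w₀| + w₀ * |Real.exp (x - y) - 1|
      ≤ 3 * η + C * (2 * η) := by
        have := hw.trans hwC
        gcongr
    _ = η * (3 + 2 * C) := by ring

/-- A density which is nearly Gaussian on a large ball and exponentially small outside of it has
nearly the mean of the Gaussian density. -/
lemma norm_densityMean_sub_le (hU : MeasurableSet U) (hUb : Bornology.IsBounded U)
    (hG : IntegrableOn (fun u => Real.exp (g u) * w u) U) (hΓ : Γ.IsSymm) (hc : 0 < c)
    (hK : frob Γ ≤ K) (hm : ‖m‖ ≤ M) (hMR : 2 * M ≤ R) (hR : 2 ≤ R) (hη1 : η ≤ 1)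
    (hwU : ∀ u ∈ U, c ≤ w u ∧ w u ≤ C) (hw₀ : 0 ≤ w₀) (hw₀C : w₀ ≤ C)
    (hball : ∀ u, ‖u‖ ≤ 2 * R → u ∈ U ∧
      |g u - (inner ℝ (act Γ m) u - inner ℝ u (act Γ u) / 2)| ≤ η ∧ |w u - w₀| ≤ η)
    (htail : ∀ u ∈ U, R / 2 ≤ ‖u‖ → g u ≤ -‖u‖ / 4) :
    ‖densityMean U (fun u => Real.exp (g u) * w u) - m‖
      ≤ (C * (1 + M) * expTail d (R / 2) + Real.exp (K * M ^ 2 / 2 + K * R ^ 2 / 2)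
          * (η * (3 + 2 * C)) * R * volume.real (Metric.closedBall (0 : E d) R))
        / (c * Real.exp (-1 - K * M ^ 2 / 2 - K / 2)
          * volume.real (Metric.closedBall (0 : E d) 1)) := by
  set G := fun u => Real.exp (g u) * w u with hGdef
  have hM0 : 0 ≤ M := (norm_nonneg m).trans hm
  have hK0 : 0 ≤ K := (frob_nonneg Γ).trans hK
  have hC0 : 0 ≤ C := hw₀.trans hw₀C
  have hη0 : 0 ≤ η := (abs_nonneg _).trans (hball 0 (by simp; linarith)).2.1
  have hGpos : ∀ u ∈ U, 0 ≤ G u := fun u hu =>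
    mul_nonneg (Real.exp_pos _).le (hc.le.trans (hwU u hu).1)
  have hquad : ∀ v : E d, |inner ℝ v (act Γ v)| ≤ K * ‖v‖ ^ 2 := fun v =>
    (abs_inner_act_le Γ v).trans (by gcongr)
  have hmq : |inner ℝ m (act Γ m)| ≤ K * M ^ 2 := (hquad m).trans (by gcongr)
  set q : E d → ℝ := fun u => inner ℝ m (act Γ m) / 2 - inner ℝ (u - m) (act Γ (u - m)) / 2
  have hqcont : Continuous q := by
    have := continuous_act Γ
    fun_prop
  have hsub : ∀ ρ ≤ R, ∀ u ∈ Metric.closedBall m ρ, ‖u‖ ≤ 2 * R := fun ρ hρ u hu => by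
    rw [mem_closedBall_iff_norm] at hu
    have : ‖u‖ ≤ ‖u - m‖ + ‖m‖ := by simpa using norm_add_le (u - m) m
    linarith
  have hgq : ∀ u, ‖u‖ ≤ 2 * R → |g u - q u| ≤ η := fun u hu => by
    have := (hball u hu).2.1
    rwa [quadratic_eq_complete_square hΓ] at this
  have hBU : ∀ ρ ≤ R, Metric.closedBall m ρ ⊆ U := fun ρ hρ u hu =>
    (hball u (hsub ρ hρ u hu)).1
  have hvol : ∀ ρ, volume.real (Metric.closedBall m ρ)
      = volume.real (Metric.closedBall (0 : E d) ρ) := fun ρ => by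
    rw [measureReal_def, measureReal_def, Measure.addHaar_closedBall_center]
  have hV1 : 0 < volume.real (Metric.closedBall (0 : E d) 1) :=
    ENNReal.toReal_pos (Metric.measure_closedBall_pos _ _ one_pos).ne'
      (measure_closedBall_lt_top).ne
  -- the normalizing constant
  have hden : c * Real.exp (-1 - K * M ^ 2 / 2 - K / 2)
      * volume.real (Metric.closedBall (0 : E d) 1) ≤ ∫ u in U, G u := by
    calc _ = ∫ _u in Metric.closedBall m 1, c * Real.exp (-1 - K * M ^ 2 / 2 - K / 2) := by
          rw [setIntegral_const, hvol, smul_eq_mul, mul_comm]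
      _ ≤ ∫ u in Metric.closedBall m 1, G u := by
          refine setIntegral_mono_on (integrableOn_const (measure_closedBall_lt_top).ne)
            (hG.mono_set (hBU 1 (by linarith))) Metric.isClosed_closedBall.measurableSet
            fun u hu => ?_
          have hu2 := hsub 1 (by linarith) u hu
          have h1 := (hwU u (hball u hu2).1).1
          have h2 := (abs_le.1 (hgq u hu2)).1
          have h3 := (abs_le.1 hmq).1
          have h4 := (abs_le.1 (hquad (u - m))).2
          have h5 : ‖u - m‖ ^ 2 ≤ 1 := by
            rw [mem_closedBall_iff_norm] at hu
            exact pow_le_one₀ (norm_nonneg _) hu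
          have h6 : K * ‖u - m‖ ^ 2 ≤ K := mul_le_of_le_one_right hK0 h5
          rw [mul_comm]
          simp only [hGdef]
          gcongr
          simp only [q] at h2
          linarith
      _ ≤ ∫ u in U, G u := by
          refine setIntegral_mono_set hG ?_ (hBU 1 (by linarith)).eventuallyLE
          filter_upwards [ae_restrict_mem hU] with u hu using hGpos u hu
  have hDpos : 0 < c * Real.exp (-1 - K * M ^ 2 / 2 - K / 2)
      * volume.real (Metric.closedBall (0 : E d) 1) := by positivity
  have hIpos := hDpos.trans_le hden
  have hGm : IntegrableOn (fun u => G u • (u - m)) U :=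
    integrableOn_smul_of_bounded hU hUb hG (by fun_prop)
  -- Centring the ball at m makes the Gaussian part of the numerator odd, hence zero. Since |m| ≤
  -- R/2, the ball stays inside |u| ≤ 2R and its complement inside |u| ≥ R/2.
  set B := Metric.closedBall m R
  have hBm : MeasurableSet B := Metric.isClosed_closedBall.measurableSet
  -- the inner part of the numerator
  have hin : ‖∫ u in B, G u • (u - m)‖ ≤ Real.exp (K * M ^ 2 / 2 + K * R ^ 2 / 2)
      * (η * (3 + 2 * C)) * R * volume.real (Metric.closedBall (0 : E d) R) := by
    have hodd : ∫ u in B, (Real.exp (q u) * w₀) • (u - m) = 0 :=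
      setIntegral_closedBall_odd_eq_zero m R (F := fun v => Real.exp (inner ℝ m (act Γ m) / 2
        - inner ℝ v (act Γ v) / 2) * w₀) fun v => by simp [act_neg]
    have hqint : IntegrableOn (fun u => (Real.exp (q u) * w₀) • (u - m)) B := by
      refine ContinuousOn.integrableOn_compact (isCompact_closedBall m R)
        (Continuous.continuousOn ?_)
      fun_prop
    have hsubint : ∫ u in B, G u • (u - m)
        = ∫ u in B, (G u - Real.exp (q u) * w₀) • (u - m) := by
      simp only [sub_smul]
      rw [integral_sub (hGm.mono_set (hBU R le_rfl)) hqint, hodd, sub_zero]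
    rw [hsubint, ← hvol]
    refine norm_setIntegral_le_of_norm_le_const (measure_closedBall_lt_top) fun u hu => ?_
    have hu2 := hsub R le_rfl u hu
    rw [norm_smul, Real.norm_eq_abs]
    have h1 := abs_exp_mul_sub_le hη1 (hgq u hu2) (hball u hu2).2.2 hw₀ hw₀C
    have h2 : ‖u - m‖ ≤ R := mem_closedBall_iff_norm.1 hu
    have h3 : q u ≤ K * M ^ 2 / 2 + K * R ^ 2 / 2 := by
      have e1 := (abs_le.1 hmq).2
      have e2 := (abs_le.1 (hquad (u - m))).1
      have e3 : K * ‖u - m‖ ^ 2 ≤ K * R ^ 2 := by gcongr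
      simp only [q]
      linarith
    have h4 : 0 ≤ η * (3 + 2 * C) := by positivity
    calc |G u - Real.exp (q u) * w₀| * ‖u - m‖
        ≤ (Real.exp (q u) * (η * (3 + 2 * C))) * R := by gcongr
      _ ≤ _ := by gcongr
  -- the outer part of the numerator
  have hset : MeasurableSet {u : E d | R / 2 ≤ ‖u‖} :=
    measurableSet_le measurable_const measurable_norm
  have hout : ‖∫ u in U \ B, G u • (u - m)‖ ≤ C * (1 + M) * expTail d (R / 2) := by
    have hss : U \ B ⊆ {u : E d | R / 2 ≤ ‖u‖} := fun u hu => by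
      have h1 : R < ‖u - m‖ := by
        have := hu.2
        rwa [mem_closedBall_iff_norm, not_le] at this
      have h2 := norm_sub_le u m
      change R / 2 ≤ ‖u‖
      linarith
    calc ‖∫ u in U \ B, G u • (u - m)‖
        ≤ ∫ u in U \ B, C * (1 + M) * (‖u‖ * Real.exp (-‖u‖ / 4)) := by
          refine norm_integral_le_of_norm_le
            (integrable_norm_mul_exp.integrableOn.const_mul _) ?_
          filter_upwards [ae_restrict_mem (hU.diff hBm)] with u hu
          have hu1 : R / 2 ≤ ‖u‖ := hss hu
          have h1 : G u ≤ Real.exp (-‖u‖ / 4) * C := by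
            simp only [hGdef]
            have := htail u hu.1 hu1
            have := hwU u hu.1
            gcongr
            · linarith
            · linarith
          have h2 : ‖u - m‖ ≤ (1 + M) * ‖u‖ := by
            have h3 : M * 1 ≤ M * ‖u‖ := by gcongr; linarith
            linarith [norm_sub_le u m]
          rw [norm_smul, Real.norm_of_nonneg (hGpos u hu.1)]
          calc G u * ‖u - m‖ ≤ (Real.exp (-‖u‖ / 4) * C) * ((1 + M) * ‖u‖) := by
                have := hGpos u hu.1
                gcongr
            _ = _ := by ring
      _ ≤ ∫ u in {u : E d | R / 2 ≤ ‖u‖}, C * (1 + M) * (‖u‖ * Real.exp (-‖u‖ / 4)) := by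
          refine setIntegral_mono_set (integrable_norm_mul_exp.integrableOn.const_mul _)
            (.of_forall fun u => ?_) hss.eventuallyLE
          simp only [Pi.zero_apply]
          positivity
      _ = _ := by rw [integral_const_mul, expTail]
  rw [densityMean_sub hU hUb hG hIpos, norm_smul, norm_inv, Real.norm_of_nonneg hIpos.le,
    ← integral_inter_add_sdiff hBm hGm, Set.inter_eq_right.2 (hBU R le_rfl), inv_mul_eq_div]
  have hnum := (norm_add_le (∫ u in B, G u • (u - m)) (∫ u in U \ B, G u • (u - m))).trans
    (add_le_add hin hout)
  have := expTail_nonneg (d := d) (R / 2)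
  rw [add_comm (C * (1 + M) * expTail d (R / 2))]
  gcongr

end QuadraticApproximation

/-! ### Change of variables to the local coordinate -/

section LocalCoordinates

variable {d : ℕ} {Θ : Set (E d)} {ϖ h : E d → ℝ} {θs : E d} {a : Matrix (Fin d) (Fin d) ℝ}

lemma measurableEmbedding_add_act (θs : E d) (ha : IsUnit a.det) :
    MeasurableEmbedding fun u => θs + act a u := by
  refine Continuous.measurableEmbedding (continuous_const.add (continuous_act a)) fun u v huv => ?_
  have := congrArg (act a⁻¹) (add_left_cancel huv)
  rwa [act_inv_act ha, act_inv_act ha] at this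

lemma exists_map_add_act (θs : E d) (ha : IsUnit a.det) :
    ∃ k : ℝ, 0 < k ∧ Measure.map (fun u => θs + act a u) (volume : Measure (E d))
      = ENNReal.ofReal k • volume := by
  have hdet : LinearMap.det (actLin a) ≠ 0 := by
    have hinv : (actLin a).comp (actLin a⁻¹) = LinearMap.id := by
      ext1 v
      simp [act_act_inv ha]
    have := congrArg LinearMap.det hinv
    rw [LinearMap.det_comp, LinearMap.det_id] at this
    exact left_ne_zero_of_mul_eq_one this
  refine ⟨|(LinearMap.det (actLin a))⁻¹|, by positivity, ?_⟩
  have h1 := Measure.map_linearMap_addHaar_eq_smul_addHaar (volume : Measure (E d)) hdet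
  have hm : Measurable (actLin a) := (continuous_act a).measurable
  have h2 : (fun u => θs + act a u) = (fun v => θs + v) ∘ actLin a := rfl
  rw [h2, ← Measure.map_map (measurable_const_add θs) hm, h1,
    Measure.map_smul, map_add_left_eq_self]

/-- Continuity up to the compact closure of Θ bounds each path of the field, so the integrand is
bounded on a set of finite volume. -/
lemma integrableOn_exp_mul_prior (hΘo : IsOpen Θ) (hΘb : Bornology.IsBounded Θ)
    (hϖ : IsPrior Θ ϖ) (hh : ContinuousOn h (closure Θ)) :
    IntegrableOn (fun θ => Real.exp (h θ) * ϖ θ) Θ := by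
  obtain ⟨c, C, hc, hcC⟩ := hϖ.bounds
  obtain ⟨B, hB⟩ := (hΘb.isCompact_closure.image_of_continuousOn hh).isBounded.exists_norm_le
  have hfin : volume Θ < ∞ := hΘb.measure_lt_top
  have : IsFiniteMeasure (volume.restrict Θ) := ⟨by rwa [Measure.restrict_apply_univ]⟩
  refine Integrable.of_bound (C := Real.exp B * C) ?_ ?_
  · exact ((hh.mono subset_closure).rexp.mul hϖ.continuousOn).aestronglyMeasurable
      hΘo.measurableSet
  · filter_upwards [ae_restrict_mem hΘo.measurableSet] with θ hθ
    have h1 := hB _ (Set.mem_image_of_mem h (subset_closure hθ))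
    have h2 := hcC θ hθ
    rw [norm_mul, Real.norm_of_nonneg (Real.exp_pos _).le, Real.norm_of_nonneg (by linarith)]
    gcongr
    · linarith
    · exact (le_abs_self _).trans h1
    · exact h2.2

lemma integral_exp_mul_prior_pos (hΘo : IsOpen Θ) (hΘb : Bornology.IsBounded Θ) (hθs : θs ∈ Θ)
    (hϖ : IsPrior Θ ϖ) (hh : ContinuousOn h (closure Θ)) :
    0 < ∫ θ in Θ, Real.exp (h θ) * ϖ θ := by
  obtain ⟨c, C, hc, hcC⟩ := hϖ.bounds
  have hpos : ∀ θ ∈ Θ, 0 < Real.exp (h θ) * ϖ θ := fun θ hθ =>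
    mul_pos (Real.exp_pos _) (hc.trans_le (hcC θ hθ).1)
  rw [setIntegral_pos_iff_support_of_nonneg_ae _ (integrableOn_exp_mul_prior hΘo hΘb hϖ hh)]
  · rw [Set.inter_eq_right.2 fun θ hθ => Function.mem_support.2 (hpos θ hθ).ne']
    exact hΘo.measure_pos _ ⟨θs, hθs⟩
  · filter_upwards [ae_restrict_mem hΘo.measurableSet] with θ hθ using (hpos θ hθ).le

/-- The parameter space in the local coordinate `u`, where `θ = θ* + a u`. -/
def localSpace (Θ : Set (E d)) (θs : E d) (a : Matrix (Fin d) (Fin d) ℝ) : Set (E d) :=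
  {u | θs + act a u ∈ Θ}

/-- The unnormalized posterior density in the local coordinate. -/
noncomputable def localDensity (ϖ h : E d → ℝ) (θs : E d) (a : Matrix (Fin d) (Fin d) ℝ)
    (u : E d) : ℝ :=
  Real.exp (h (θs + act a u) - h θs) * ϖ (θs + act a u)

lemma isOpen_localSpace (hΘo : IsOpen Θ) : IsOpen (localSpace Θ θs a) :=
  hΘo.preimage (continuous_const.add (continuous_act a))

lemma isBounded_localSpace (hΘb : Bornology.IsBounded Θ) (ha : IsUnit a.det) :
    Bornology.IsBounded (localSpace Θ θs a) := by
  obtain ⟨D, hD⟩ := hΘb.subset_closedBall θs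
  refine isBounded_iff_forall_norm_le.2 ⟨frob a⁻¹ * D, fun u hu => ?_⟩
  have h1 : θs + act a u ∈ Metric.closedBall θs D := hD hu
  rw [mem_closedBall_iff_norm, add_sub_cancel_left] at h1
  rw [← act_inv_act ha u]
  exact (norm_act_le _ _).trans (mul_le_mul_of_nonneg_left h1 (frob_nonneg _))

lemma exp_mul_prior_eq_localDensity (u : E d) : Real.exp (h (θs + act a u)) * ϖ (θs + act a u)
    = Real.exp (h θs) * localDensity ϖ h θs a u := by
  rw [localDensity, ← mul_assoc, ← Real.exp_add]
  ring_nf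

lemma integrableOn_localDensity (ha : IsUnit a.det)
    (hint : IntegrableOn (fun θ => Real.exp (h θ) * ϖ θ) Θ) :
    IntegrableOn (localDensity ϖ h θs a) (localSpace Θ θs a) := by
  obtain ⟨k, hk, hmap⟩ := exists_map_add_act θs ha
  have h1 : IntegrableOn (fun θ => Real.exp (h θ) * ϖ θ) Θ
      (Measure.map (fun u => θs + act a u) volume) := by
    rw [hmap, IntegrableOn, Measure.restrict_smul]
    exact Integrable.smul_measure hint ENNReal.ofReal_ne_top
  rw [(measurableEmbedding_add_act θs ha).integrableOn_map_iff] at h1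
  have h2 := h1.const_mul (Real.exp (h θs))⁻¹
  refine h2.congr (.of_forall fun u => ?_)
  simp only [Function.comp_apply]
  rw [exp_mul_prior_eq_localDensity, inv_mul_cancel_left₀ (Real.exp_pos _).ne']

/-- The Jacobian `k` and the factor exp(h(θ*)) occur in numerator and denominator and cancel; the
mean commutes with the affine map u ↦ θ* + a u. -/
lemma qbeError_eq_densityMean (ha : IsUnit a.det) (hΘo : IsOpen Θ) (hΘb : Bornology.IsBounded Θ)
    (hθs : θs ∈ Θ) (hϖ : IsPrior Θ ϖ) (hh : ContinuousOn h (closure Θ)) :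
    qbeError Θ ϖ h θs a = densityMean (localSpace Θ θs a) (localDensity ϖ h θs a) := by
  obtain ⟨k, hk, hmap⟩ := exists_map_add_act θs ha
  have hemb := measurableEmbedding_add_act θs ha
  have hint := integrableOn_exp_mul_prior hΘo hΘb hϖ hh
  have hpos := integral_exp_mul_prior_pos hΘo hΘb hθs hϖ hh
  have hU := (isOpen_localSpace (θs := θs) (a := a) hΘo).measurableSet
  have hUb := isBounded_localSpace (θs := θs) hΘb ha
  have hG := integrableOn_localDensity (θs := θs) ha hint
  have hGu : IntegrableOn (fun u => localDensity ϖ h θs a u • u) (localSpace Θ θs a) :=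
    integrableOn_smul_of_bounded hU hUb hG continuous_id
  have h0 : k * ∫ θ in Θ, Real.exp (h θ) * ϖ θ
      = Real.exp (h θs) * ∫ u in localSpace Θ θs a, localDensity ϖ h θs a u := by
    have := hemb.setIntegral_map (μ := volume) (fun θ => Real.exp (h θ) * ϖ θ) Θ
    rw [hmap, Measure.restrict_smul, integral_smul_measure, ENNReal.toReal_ofReal hk.le,
      smul_eq_mul] at this
    rw [this, ← integral_const_mul]
    simp only [exp_mul_prior_eq_localDensity]
    rfl
  have h1 : k • ∫ θ in Θ, (Real.exp (h θ) * ϖ θ) • θ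
      = Real.exp (h θs) • ((∫ u in localSpace Θ θs a, localDensity ϖ h θs a u) • θs
        + act a (∫ u in localSpace Θ θs a, localDensity ϖ h θs a u • u)) := by
    have := hemb.setIntegral_map (μ := volume) (fun θ => (Real.exp (h θ) * ϖ θ) • θ) Θ
    rw [hmap, Measure.restrict_smul, integral_smul_measure, ENNReal.toReal_ofReal hk.le] at this
    rw [this, ← integral_smul_const]
    have hact : act a (∫ u in localSpace Θ θs a, localDensity ϖ h θs a u • u)
        = ∫ u in localSpace Θ θs a, act a (localDensity ϖ h θs a u • u) :=
      ((actLin a).toContinuousLinearMap.integral_comp_comm hGu).symm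
    have hactint : IntegrableOn (fun u => act a (localDensity ϖ h θs a u • u))
        (localSpace Θ θs a) := (actLin a).toContinuousLinearMap.integrable_comp hGu
    rw [hact, ← integral_add (hG.smul_const θs) hactint, ← integral_smul]
    simp only [exp_mul_prior_eq_localDensity, act_smul, smul_add, smul_smul]
    rfl
  set I := ∫ u in localSpace Θ θs a, localDensity ϖ h θs a u
  set J := ∫ u in localSpace Θ θs a, localDensity ϖ h θs a u • u
  set I' := ∫ θ in Θ, Real.exp (h θ) * ϖ θ
  set J' := ∫ θ in Θ, (Real.exp (h θ) * ϖ θ) • θ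
  have hI : I ≠ 0 := by
    intro hI
    rw [hI, mul_zero] at h0
    exact (mul_pos hk hpos).ne' h0
  have hq : qbe Θ ϖ h = θs + act a (I⁻¹ • J) := by
    have : qbe Θ ϖ h = (k * I')⁻¹ • (k • J') := by
      rw [smul_smul, mul_inv, mul_comm k⁻¹, inv_mul_cancel_right₀ hk.ne']
      rfl
    rw [this, h0, h1, smul_smul, mul_inv, mul_comm _ I⁻¹,
      inv_mul_cancel_right₀ (Real.exp_pos _).ne', smul_add, inv_smul_smul₀ hI, act_smul]
  rw [qbeError, hq, add_sub_cancel_left, act_inv_act ha]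
  rfl

end LocalCoordinates

end QLA

namespace QLA

/-! ### The error of the estimator is asymptotically Γ⁻¹Δ_T -/

section Consistency

variable {d : ℕ}

/-- For |u| ≤ 2R the Taylor remainder is half the sum of two quadratic forms with matrices of norm
at most η/(4R²). Each form is at most η, so the exponent is within η of the quadratic centred at
Γ⁻¹Δ_T. -/
lemma norm_qbeError_sub_le {Θ : Set (E d)} (hΘo : IsOpen Θ) (hΘb : Bornology.IsBounded Θ)
    {θs : E d} (hθs : θs ∈ Θ) {ϖ : E d → ℝ} (hϖ : IsPrior Θ ϖ) {c C : ℝ} (hc : 0 < c)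
    (hcC : ∀ θ ∈ Θ, c ≤ ϖ θ ∧ ϖ θ ≤ C) {h : E d → ℝ} (hh : ContDiffOn ℝ 2 h Θ)
    (hhc : ContinuousOn h (closure Θ)) {a Γ : Matrix (Fin d) (Fin d) ℝ} (ha : IsUnit a.det)
    (hΓ : Γ.IsSymm) (hdet : IsUnit Γ.det) {K M R η δ : ℝ} (hK : frob Γ ≤ K)
    (hm : ‖act Γ⁻¹ (score h θs a)‖ ≤ M) (hMR : 2 * M ≤ R) (hR : 2 ≤ R) (hη1 : η ≤ 1)
    (hδ : frob a * (2 * R) ≤ δ) (hball : Metric.closedBall θs δ ⊆ Θ)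
    (hmod : ∀ θ ∈ Θ, ‖θ - θs‖ ≤ δ →
      frob (obsInfo h a θ - obsInfo h a θs) ≤ η / (4 * R ^ 2))
    (hlim : frob (obsInfo h a θs - Γ) ≤ η / (4 * R ^ 2))
    (hprior : ∀ θ ∈ Metric.closedBall θs δ, |ϖ θ - ϖ θs| ≤ η)
    (htail : ∀ u, θs + act a u ∈ Θ → R / 2 ≤ ‖u‖ → h (θs + act a u) - h θs ≤ -‖u‖ / 4) :
    ‖qbeError Θ ϖ h θs a - act Γ⁻¹ (score h θs a)‖
      ≤ (C * (1 + M) * expTail d (R / 2) + Real.exp (K * M ^ 2 / 2 + K * R ^ 2 / 2)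
          * (η * (3 + 2 * C)) * R * volume.real (Metric.closedBall (0 : E d) R))
        / (c * Real.exp (-1 - K * M ^ 2 / 2 - K / 2)
          * volume.real (Metric.closedBall (0 : E d) 1)) := by
  rw [qbeError_eq_densityMean ha hΘo hΘb hθs hϖ hhc]
  have hw := hcC θs hθs
  refine norm_densityMean_sub_le (w₀ := ϖ θs) (isOpen_localSpace hΘo).measurableSet
    (isBounded_localSpace hΘb ha)
    (integrableOn_localDensity ha (integrableOn_exp_mul_prior hΘo hΘb hϖ hhc)) hΓ hc hK hm hMR hR
    hη1 (fun u hu => hcC _ hu) (by linarith) hw.2 (fun u hu => ?_) (fun u hu => htail u hu)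
  have hau : ‖act a u‖ ≤ δ := (norm_act_le a u).trans
    ((mul_le_mul_of_nonneg_left hu (frob_nonneg a)).trans hδ)
  have hseg : ∀ s ∈ Set.Icc (0 : ℝ) 1, θs + s • act a u ∈ Metric.closedBall θs δ := fun s hs => by
    rw [mem_closedBall_iff_norm, add_sub_cancel_left, norm_smul, Real.norm_of_nonneg hs.1]
    exact (mul_le_of_le_one_left (norm_nonneg _) hs.2).trans hau
  have hu1 : θs + act a u ∈ Metric.closedBall θs δ := by
    simpa using hseg 1 (by simp)
  refine ⟨hball hu1, ?_, hprior _ hu1⟩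
  obtain ⟨s, hs, heq⟩ := exists_sub_eq_quadratic hΘo hh θs a u fun s hs => hball (hseg s hs)
  have hθ := hseg s (Set.Ioo_subset_Icc_self hs)
  rw [heq, act_act_inv hdet]
  set θ := θs + s • act a u
  have e3 := abs_inner_act_le (obsInfo h a θ - obsInfo h a θs) u
  have e4 := abs_inner_act_le (obsInfo h a θs - Γ) u
  rw [sub_act, inner_sub_right] at e3 e4
  have hsq : ‖u‖ ^ 2 ≤ (2 * R) ^ 2 := by gcongr
  have hbound : ∀ x : ℝ, 0 ≤ x → x ≤ η / (4 * R ^ 2) → x * ‖u‖ ^ 2 ≤ η := fun x hx0 hx => by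
    calc x * ‖u‖ ^ 2 ≤ η / (4 * R ^ 2) * (2 * R) ^ 2 := by gcongr; exact hx0.trans hx
      _ = η := by field_simp; ring
  have g3 := e3.trans (hbound _ (frob_nonneg _)
    (hmod θ (hball hθ) (mem_closedBall_iff_norm.1 hθ)))
  have g4 := e4.trans (hbound _ (frob_nonneg _) hlim)
  rw [abs_le] at g3 g4 ⊢
  constructor <;> linarith [g3.1, g3.2, g4.1, g4.2]

variable {Ω : Type*}

/-- The inverse is det⁻¹ times the adjugate, also at singular matrices, where both sides vanish by
convention. The argument is valid for every σ-field, in particular for 𝒢. -/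
lemma measurable_inv_apply [MeasurableSpace Ω] {M : Ω → Matrix (Fin d) (Fin d) ℝ}
    (hM : ∀ i j, Measurable fun ω => M ω i j) (i j : Fin d) :
    Measurable fun ω => (M ω)⁻¹ i j := by
  have hpi : Measurable fun ω => (fun k l => M ω k l : Fin d → Fin d → ℝ) :=
    measurable_pi_iff.2 fun k => measurable_pi_iff.2 fun l => hM k l
  have hdet : Continuous fun f : Fin d → Fin d → ℝ => (Matrix.of f).det := by
    exact Continuous.matrix_det continuous_id
  have hadj : Continuous fun f : Fin d → Fin d → ℝ => (Matrix.of f).adjugate i j :=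
    (continuous_apply j).comp ((continuous_apply i).comp (Continuous.matrix_adjugate continuous_id))
  have heq : ∀ ω, (M ω)⁻¹ i j = (Matrix.of (fun k l => M ω k l)).det⁻¹
      * (Matrix.of (fun k l => M ω k l)).adjugate i j := fun ω => by
    rw [Matrix.inv_def, Ring.inverse_eq_inv', Matrix.smul_apply, smul_eq_mul]
    rfl
  simp only [heq]
  exact (hdet.measurable.comp hpi).inv.mul (hadj.measurable.comp hpi)

variable [MeasurableSpace Ω] {P : Measure Ω} [IsProbabilityMeasure P]

lemma exists_measureReal_gt_le {X : Ω → ℝ} (hX : Measurable X) {η : ℝ} (hη : 0 < η) :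
    ∃ K : ℝ, 0 ≤ K ∧ P.real {ω | K < X ω} ≤ η := by
  have hlim : Tendsto (fun n : ℕ => P {ω | (n : ℝ) < X ω}) atTop
      (𝓝 (P (⋂ n : ℕ, {ω | (n : ℝ) < X ω}))) := by
    refine tendsto_measure_iInter_atTop
      (fun n => (measurableSet_lt measurable_const hX).nullMeasurableSet) (fun m n hmn ω hω => ?_)
      ⟨0, measure_ne_top _ _⟩
    have h1 : (n : ℝ) < X ω := hω
    have h2 : (m : ℝ) ≤ n := by exact_mod_cast hmn
    exact h2.trans_lt h1
  have hempty : ⋂ n : ℕ, {ω | (n : ℝ) < X ω} = ∅ := by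
    refine Set.eq_empty_of_forall_notMem fun ω hω => ?_
    obtain ⟨n, hn⟩ := exists_nat_gt (X ω)
    have : (n : ℝ) < X ω := Set.mem_iInter.1 hω n
    linarith
  rw [hempty, measure_empty] at hlim
  obtain ⟨n, hn⟩ := (hlim.eventually_le_const (ENNReal.ofReal_pos.2 hη)).exists
  exact ⟨n, n.cast_nonneg, ENNReal.toReal_le_of_le_ofReal hη.le hn⟩

variable {Θ : Set (E d)} {θs : E d} {𝕋 : Set ℝ≥0} {H : 𝕋 → Ω → E d → ℝ} {a : 𝕋 → GL (Fin d) ℝ}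
  {Y : Ω → E d → ℝ} {Γ : Ω → Matrix (Fin d) (Fin d) ℝ} {L α β₁ β₂ ρ₁ ρ₂ : ℝ}

/-- The event that `lambdaMin (Γ ω)` is not positive is contained in the event of [S2] (ii) for
every r; let r → ∞. -/
lemma S2.ae_lambdaMin_pos (hS2 : S2 P Θ θs Y Γ L α ρ₁ ρ₂) (hL : 0 < L) :
    ∀ᵐ ω ∂P, 0 < lambdaMin (Γ ω) := by
  obtain ⟨C, hC⟩ := hS2.nondegenerate
  have hle : ∀ r : ℝ, 0 < r → P.real {ω | ¬0 < lambdaMin (Γ ω)} ≤ C / r ^ L := fun r hr => by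
    refine (measureReal_mono fun ω hω => ?_).trans (hC r hr)
    exact (not_lt.1 hω).trans_lt (Real.rpow_pos_of_pos hr _)
  have hlim : Tendsto (fun r : ℝ => C / r ^ L) atTop (𝓝 0) :=
    (tendsto_rpow_atTop hL).const_div_atTop C
  have h0 : P.real {ω | ¬0 < lambdaMin (Γ ω)} ≤ 0 :=
    ge_of_tendsto hlim ((eventually_gt_atTop 0).mono hle)
  have h1 := le_antisymm h0 measureReal_nonneg
  rw [measureReal_def, ENNReal.toReal_eq_zero_iff] at h1
  exact h1.resolve_right (measure_ne_top _ _)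

lemma exists_pos_forall_rpow_mul_le {K p η : ℝ} (hp : 0 < p) (hη : 0 < η) :
    ∃ δ₀ > 0, ∀ δ, 0 ≤ δ → δ ≤ δ₀ → (K * δ) ^ p ≤ η := by
  have hc : ContinuousAt (fun δ : ℝ => (K * δ) ^ p) 0 :=
    (Real.continuous_rpow_const hp.le).continuousAt.comp (by fun_prop)
  have h0 : (fun δ : ℝ => (K * δ) ^ p) 0 < η := by simpa [Real.zero_rpow hp.ne'] using hη
  obtain ⟨ε, hε, hball⟩ := Metric.eventually_nhds_iff.1 (hc.eventually_lt_const h0)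
  refine ⟨ε / 2, by positivity, fun δ h0 h1 => (hball ?_).le⟩
  rw [Real.dist_eq, sub_zero, abs_of_nonneg h0]
  linarith

/-- The error of the quasi-Bayesian estimator is asymptotically `Γ⁻¹ Δ_T`. -/
theorem eventually_measureReal_qbeError_sub_le (hd : 0 < d) (hΘo : IsOpen Θ)
    (hΘb : Bornology.IsBounded Θ) (hθs : θs ∈ Θ) (hH : ∀ T, IsC2RandomField Θ (H T))
    (ha : Tendsto (fun T => frob (a T).1) atTop (𝓝 0)) (hY : IsContRandomField Θ Y)
    {ϖ : E d → ℝ} (hϖ : IsPrior Θ ϖ)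
    (hΓsymm : ∀ ω, (Γ ω).IsSymm) (hΓ : ∀ i j, Measurable fun ω => Γ ω i j)
    (hS1 : S1 α β₁ β₂ ρ₁ ρ₂) (hS2 : S2 P Θ θs Y Γ L α ρ₁ ρ₂)
    (hS3 : S3 P Θ θs H a Y Γ L α β₁ β₂ ρ₁ ρ₂) (hL : 0 < L) {ε η : ℝ} (hε : 0 < ε) (hη : 0 < η) :
    ∀ᶠ T in atTop, P.real {ω | ε ≤ ‖qbeError Θ ϖ (H T ω) θs (a T).1
      - act (Γ ω)⁻¹ (score (H T ω) θs (a T).1)‖} ≤ η := by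
  obtain ⟨c, C, hc, hcC⟩ := hϖ.bounds
  have hC0 : 0 ≤ C := by linarith [hcC θs hθs]
  obtain ⟨K₁, hK₁, t₁⟩ := hS3.score_tail hS1 hL hΘo hθs hH
  obtain ⟨K₃, hK₃, δ₀, hδ₀, t₃⟩ := hS3.info_modulus_tail hS1 hL hΘo hθs hH
  obtain ⟨K₄, hK₄, t₄⟩ := hS3.info_limit_tail hS1 hd hL hΘo hθs hH hΓ
  obtain ⟨C₅, b₀, hC₅, hb₀, t₅⟩ :=
    exists_large_deviation hd hΘo hΘb hθs hH hY hΓsymm hΓ hS1 hS2 hS3 hL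
  have k1 : 0 < L / (1 - ρ₁) := div_pos hL (sub_pos.2 hS1.rho₁_lt_one)
  have k3 : 0 < L / (α / (1 - α) - ρ₁) := div_pos hL hS1.rho₁_lt_modulus
  have k4 : 0 < L / (2 * β₁ / (1 - α) - ρ₁) := div_pos hL hS1.rho₁_lt_limit
  -- Six exceptional events receive η/6 each; a seventh, where Γ may be singular, is null.
  have hη7 : 0 < η / 6 := by positivity
  have hfrob : Measurable fun ω => frob (Γ ω) := by
    simpa using measurable_frob_sub hΓ (N := fun _ => 0) (fun i j => measurable_const)
  have hfrobinv : Measurable fun ω => frob (Γ ω)⁻¹ := by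
    simpa using measurable_frob_sub (measurable_inv_apply hΓ) (N := fun _ => 0)
      (fun i j => measurable_const)
  obtain ⟨K, hK, e₁⟩ := exists_measureReal_gt_le (P := P) hfrob hη7
  obtain ⟨K', hK', e₂⟩ := exists_measureReal_gt_le (P := P) hfrobinv hη7
  obtain ⟨M₁, hM₁, e₃⟩ : ∃ M₁ > 0, ∀ T,
      P.real {ω | M₁ < ‖score (H T ω) θs (a T).1‖} ≤ η / 6 := by
    obtain ⟨δ, hδ, hle⟩ := exists_pos_forall_rpow_mul_le (K := K₁) k1 hη7
    refine ⟨δ⁻¹, by positivity, fun T => (t₁ T _ (by positivity)).trans ?_⟩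
    rw [div_inv_eq_mul]
    exact hle δ hδ.le le_rfl
  set M := K' * M₁ with hM
  have hM0 : 0 ≤ M := by positivity
  set D := c * Real.exp (-1 - K * M ^ 2 / 2 - K / 2) * volume.real (Metric.closedBall (0 : E d) 1)
  have hD : 0 < D := by
    have : 0 < volume.real (Metric.closedBall (0 : E d) 1) :=
      ENNReal.toReal_pos (Metric.measure_closedBall_pos _ _ one_pos).ne'
        (measure_closedBall_lt_top).ne
    positivity
  -- The order of choice matters: K and M come from tightness, then R makes the outer part small.
  -- The inner part carries a constant of order exp(K R²/2), which the accuracy ξ of the quadratic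
  -- approximation, chosen next, offsets; only then are δ and T taken.
  obtain ⟨R, hR2, hRM, e₄, hRtail⟩ : ∃ R : ℝ, 2 ≤ R ∧ 2 * M ≤ R ∧ C₅ / (R / 2) ^ L ≤ η / 6 ∧
      C * (1 + M) * expTail d (R / 2) ≤ ε * D / 4 := by
    obtain ⟨A, hA, hAle⟩ := exists_expTail_le d 1
    have hhalf : Tendsto (fun R : ℝ => R / 2) atTop atTop :=
      tendsto_id.atTop_div_const two_pos
    have l1 : Tendsto (fun R : ℝ => C₅ / (R / 2) ^ L) atTop (𝓝 0) :=
      ((tendsto_rpow_atTop hL).comp hhalf).const_div_atTop C₅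
    have l2 : Tendsto (fun R : ℝ => C * (1 + M) * (A / (1 + R / 2) ^ 1)) atTop (𝓝 0) := by
      have : Tendsto (fun R : ℝ => A / (1 + R / 2) ^ 1) atTop (𝓝 0) := by
        simp only [pow_one]
        exact (tendsto_atTop_add_const_left _ _ hhalf).const_div_atTop A
      simpa using this.const_mul (C * (1 + M))
    obtain ⟨R, h1, h2, h3, h4⟩ := ((eventually_ge_atTop (2 : ℝ)).and
      ((eventually_ge_atTop (2 * M)).and ((l1.eventually_le_const hη7).and
        (l2.eventually_le_const (show 0 < ε * D / 4 by positivity))))).exists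
    refine ⟨R, h1, h2, h3, le_trans ?_ h4⟩
    gcongr
    exact hAle _ (by linarith)
  set B := Real.exp (K * M ^ 2 / 2 + K * R ^ 2 / 2) * (3 + 2 * C) * R
    * volume.real (Metric.closedBall (0 : E d) R)
  have hB : 0 ≤ B := by positivity
  obtain ⟨ξ, hξ, hξ1, hξB⟩ : ∃ ξ > 0, ξ ≤ 1 ∧ ξ * B ≤ ε * D / 4 := by
    refine ⟨min 1 (ε * D / 4 / (B + 1)), by positivity, min_le_left _ _, ?_⟩
    calc min 1 (ε * D / 4 / (B + 1)) * B ≤ ε * D / 4 / (B + 1) * (B + 1) := by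
          gcongr
          · exact min_le_right _ _
          · linarith
      _ = ε * D / 4 := by field_simp
  set x := ξ / (4 * R ^ 2)
  have hx : 0 < x := by positivity
  obtain ⟨δ₃, hδ₃, s₃⟩ := exists_pos_forall_rpow_mul_le (K := K₃ / x) k3 hη7
  obtain ⟨δ₄, hδ₄, s₄⟩ := exists_pos_forall_rpow_mul_le (K := K₄ / x) k4 hη7
  obtain ⟨δ₁, hδ₁, hball⟩ := Metric.isOpen_iff.1 hΘo θs hθs
  obtain ⟨δ₂, hδ₂, hpri⟩ := Metric.continuousAt_iff.1
    (hϖ.continuousOn.continuousAt (hΘo.mem_nhds hθs)) ξ hξ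
  set δ := min (min (δ₀ / 2) δ₃) (min (δ₁ / 2) (δ₂ / 2))
  have hδ : 0 < δ := by positivity
  have hδ0 : δ < δ₀ := ((min_le_left _ _).trans (min_le_left _ _)).trans_lt (by linarith)
  have hδ3 : δ ≤ δ₃ := (min_le_left _ _).trans (min_le_right _ _)
  have hδ1 : δ < δ₁ := ((min_le_right _ _).trans (min_le_left _ _)).trans_lt (by linarith)
  have hδ2 : δ < δ₂ := ((min_le_right _ _).trans (min_le_right _ _)).trans_lt (by linarith)
  have hrate := tendsto_rate hd ha
  have hrneg : Tendsto (fun T => rate (a T).1 ^ (-β₁)) atTop (𝓝 0) :=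
    (tendsto_rpow_neg_atTop hS1.beta₁_pos).comp hrate
  filter_upwards [hrate.eventually_ge_atTop b₀, hrneg.eventually_le_const hδ₄,
    (show Tendsto (fun T => frob (a T).1 * (2 * R)) atTop (𝓝 0) by
      simpa using ha.mul_const (2 * R)).eventually_le_const hδ] with T hT hT4 hTδ
  have hb := rate_pos hd (a T)
  have e₅ := t₃ δ ⟨hδ, hδ0⟩ T x hx
  rw [mul_div_right_comm] at e₅
  replace e₅ := e₅.trans (s₃ δ hδ.le hδ3)
  have e₆ := t₄ T x hx
  rw [mul_div_right_comm] at e₆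
  replace e₆ := e₆.trans (s₄ _ (by positivity) hT4)
  have e₇ := (t₅ T hT (R / 2) (by linarith)).trans e₄
  have e₀ : P.real {ω | ¬0 < lambdaMin (Γ ω)} = 0 := by
    rw [measureReal_def, ENNReal.toReal_eq_zero_iff]
    exact .inl (hS2.ae_lambdaMin_pos hL)
  set N₀ := {ω | ¬0 < lambdaMin (Γ ω)}
  set N₁ := {ω | K < frob (Γ ω)}
  set N₂ := {ω | K' < frob (Γ ω)⁻¹}
  set N₃ := {ω | M₁ < ‖score (H T ω) θs (a T).1‖}
  set N₅ := {ω | ∃ θ ∈ Θ, ‖θ - θs‖ ≤ δ ∧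
        x < frob (obsInfo (H T ω) (a T).1 θ - obsInfo (H T ω) (a T).1 θs)}
  set N₆ := {ω | x < frob (obsInfo (H T ω) (a T).1 θs - Γ ω)}
  set N₇ := {ω | ∃ u, θs + act (a T).1 u ∈ Θ ∧ R / 2 ≤ ‖u‖ ∧
        -‖u‖ / 4 < H T ω (θs + act (a T).1 u) - H T ω θs}
  have hsub : {ω | ε ≤ ‖qbeError Θ ϖ (H T ω) θs (a T).1
      - act (Γ ω)⁻¹ (score (H T ω) θs (a T).1)‖} ⊆ N₀ ∪ N₁ ∪ N₂ ∪ N₃ ∪ N₅ ∪ N₆ ∪ N₇ := by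
    intro ω hωε
    by_contra hω
    simp only [Set.mem_union, not_or] at hω
    obtain ⟨⟨⟨⟨⟨⟨n₀, n₁⟩, n₂⟩, n₃⟩, n₅⟩, n₆⟩, n₇⟩ := hω
    have n₂ : frob (Γ ω)⁻¹ ≤ K' := not_lt.1 n₂
    have n₃ : ‖score (H T ω) θs (a T).1‖ ≤ M₁ := not_lt.1 n₃
    have hm : ‖act (Γ ω)⁻¹ (score (H T ω) θs (a T).1)‖ ≤ M :=
      (norm_act_le _ _).trans (mul_le_mul n₂ n₃ (norm_nonneg _) hK')
    have hle := norm_qbeError_sub_le hΘo hΘb hθs hϖ hc hcC ((hH T).contDiffOn ω)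
      ((hH T).continuousOn ω) (isUnit_det (a T)) (hΓsymm ω)
      (isUnit_det_of_lambdaMin_pos (not_not.1 n₀)) (not_lt.1 n₁) hm hRM hR2 hξ1 hTδ
      ((Metric.closedBall_subset_ball hδ1).trans hball)
      (fun θ hθ hθ' => not_lt.1 fun hlt => n₅ ⟨θ, hθ, hθ', hlt⟩) (not_lt.1 n₆)
      (fun θ hθ => (hpri ((Metric.mem_closedBall.1 hθ).trans_lt hδ2)).le)
      (fun u hu hu' => not_lt.1 fun hlt => n₇ ⟨u, hu, hu', hlt⟩)
    have hlt : ‖qbeError Θ ϖ (H T ω) θs (a T).1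
        - act (Γ ω)⁻¹ (score (H T ω) θs (a T).1)‖ ≤ ε / 2 := by
      refine hle.trans ?_
      rw [div_le_iff₀ hD]
      have : Real.exp (K * M ^ 2 / 2 + K * R ^ 2 / 2) * (ξ * (3 + 2 * C)) * R
          * volume.real (Metric.closedBall (0 : E d) R) = ξ * B := by ring
      linarith
    have : ε ≤ _ := hωε
    linarith
  refine (measureReal_mono hsub).trans ?_
  have u₁ := measureReal_union_le (μ := P) (N₀ ∪ N₁ ∪ N₂ ∪ N₃ ∪ N₅ ∪ N₆) N₇
  have u₂ := measureReal_union_le (μ := P) (N₀ ∪ N₁ ∪ N₂ ∪ N₃ ∪ N₅) N₆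
  have u₃ := measureReal_union_le (μ := P) (N₀ ∪ N₁ ∪ N₂ ∪ N₃) N₅
  have u₄ := measureReal_union_le (μ := P) (N₀ ∪ N₁ ∪ N₂) N₃
  have u₅ := measureReal_union_le (μ := P) (N₀ ∪ N₁) N₂
  have u₆ := measureReal_union_le (μ := P) N₀ N₁
  linarith [e₃ T]

end Consistency

end QLA

namespace QLA

/-! ### Test functions for convergence in distribution -/

section Distribution

variable {Ω Ω' ι S : Type*} [MeasurableSpace Ω] [MeasurableSpace Ω'] {P : Measure Ω}
  [IsProbabilityMeasure P] {P' : Measure Ω'} [IsProbabilityMeasure P'] [MetricSpace S]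
  [MeasurableSpace S] [BorelSpace S] {l : Filter ι} {X : ι → Ω → S} {Z : Ω' → S}

lemma _root_.MeasureTheory.TendstoInDistribution.tendsto_integral
    (h : TendstoInDistribution (Ω := fun _ : ι => Ω) X l Z (fun _ => P) P') {f : S → ℝ}
    (hf : Continuous f) {B : ℝ} (hB : ∀ x, |f x| ≤ B) :
    Tendsto (fun i => ∫ ω, f (X i ω) ∂P) l (𝓝 (∫ ω', f (Z ω') ∂P')) := by
  have h1 := ProbabilityMeasure.tendsto_iff_forall_integral_tendsto.1 h.tendsto
    (BoundedContinuousFunction.ofNormedAddCommGroup f hf B hB)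
  simp only [ProbabilityMeasure.coe_mk, BoundedContinuousFunction.coe_ofNormedAddCommGroup] at h1
  rw [integral_map h.aemeasurable_limit hf.aestronglyMeasurable] at h1
  refine h1.congr fun i => ?_
  rw [integral_map (h.forall_aemeasurable i) hf.aestronglyMeasurable]

lemma tendstoInDistribution_of_lipschitz [l.IsCountablyGenerated]
    (hX : ∀ i, AEMeasurable (X i) P) (hZ : AEMeasurable Z P')
    (h : ∀ (f : S → ℝ) (K : ℝ≥0) (B : ℝ), LipschitzWith K f → (∀ x, |f x| ≤ B) →
      Tendsto (fun i => ∫ ω, f (X i ω) ∂P) l (𝓝 (∫ ω', f (Z ω') ∂P'))) :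
    TendstoInDistribution (Ω := fun _ : ι => Ω) X l Z (fun _ => P) P' where
  forall_aemeasurable := hX
  aemeasurable_limit := hZ
  tendsto := by
    refine tendsto_iff_forall_lipschitz_integral_tendsto.2 ?_
    rintro f ⟨C, hC⟩ ⟨K, hK⟩
    simp only [ProbabilityMeasure.coe_mk]
    rw [integral_map hZ hK.continuous.aestronglyMeasurable]
    rcases isEmpty_or_nonempty S with hS | ⟨⟨x₀⟩⟩
    · exact absurd (IsProbabilityMeasure.ne_zero P') (by
        have : IsEmpty Ω' := ⟨fun ω' => hS.elim (Z ω')⟩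
        simp [Measure.eq_zero_of_isEmpty])
    have hB : ∀ x, |f x| ≤ |f x₀| + C := fun x => by
      have h1 := hC x x₀
      rw [Real.dist_eq] at h1
      have h2 := abs_add_le (f x - f x₀) (f x₀)
      rw [sub_add_cancel] at h2
      linarith
    refine (h f K _ hK hB).congr fun i => ?_
    rw [integral_map (hX i) hK.continuous.aestronglyMeasurable]

end Distribution

/-! ### Stable convergence as joint convergence with 𝒢-measurable elements -/

section Stable

lemma exists_finite_range_approx {Ω S : Type*} {m : MeasurableSpace Ω} [MetricSpace S]
    [SecondCountableTopology S] [MeasurableSpace S] [BorelSpace S] {Ξ : Ω → S}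
    (hΞ : Measurable Ξ) :
    ∃ F : ℕ → Ω → S, (∀ n, (Set.range (F n)).Finite) ∧ (∀ n, Measurable (F n)) ∧
      ∀ ω, Tendsto (fun n => F n ω) atTop (𝓝 (Ξ ω)) :=
  ⟨fun n => hΞ.stronglyMeasurable.approx n, fun _ => SimpleFunc.finite_range _,
    fun _ => SimpleFunc.measurable _, fun ω => hΞ.stronglyMeasurable.tendsto_approx ω⟩

variable {Ω Ω' ι S S' : Type*} {𝒢 : MeasurableSpace Ω} [mΩ : MeasurableSpace Ω]
  [MeasurableSpace Ω'] [MetricSpace S] [SecondCountableTopology S] [MeasurableSpace S]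
  [BorelSpace S] [MetricSpace S'] [SecondCountableTopology S'] [MeasurableSpace S'] [BorelSpace S']
  {P : Measure Ω} [IsProbabilityMeasure P] {P' : Measure Ω'} [IsProbabilityMeasure P']
  {π : Ω' → Ω} {V : ι → Ω → S} {l : Filter ι} {Vlim : Ω' → S}

lemma StableConv.aemeasurable (h : StableConv 𝒢 P P' π V l Vlim) (i : ι) :
    AEMeasurable (V i) P :=
  measurable_fst.comp_aemeasurable ((h (fun _ => 0) measurable_const).forall_aemeasurable i)

lemma StableConv.aemeasurable_limit (h : StableConv 𝒢 P P' π V l Vlim) :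
    AEMeasurable Vlim P' :=
  measurable_fst.comp_aemeasurable (h (fun _ => 0) measurable_const).aemeasurable_limit

/-- The definition is applied with Ψ the indicator of A. Clamping the second coordinate to [0, 1]
keeps the test function bounded and does not change an indicator. -/
lemma StableConv.tendsto_integral_indicator (h : StableConv 𝒢 P P' π V l Vlim) {A : Set Ω}
    (hA : MeasurableSet[𝒢] A) {φ : S → ℝ} (hφ : Continuous φ) {B : ℝ} (hB : ∀ x, |φ x| ≤ B) :
    Tendsto (fun i => ∫ ω, A.indicator (fun ω => φ (V i ω)) ω ∂P) l
      (𝓝 (∫ ω', (π ⁻¹' A).indicator (fun ω' => φ (Vlim ω')) ω' ∂P')) := by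
  have hΨ : Measurable[𝒢] (A.indicator fun _ => (1 : ℝ)) :=
    (@measurable_const _ _ _ 𝒢 (1 : ℝ)).indicator hA
  have h1 := (h _ hΨ).tendsto_integral (f := fun q : S × ℝ => φ q.1 * max 0 (min 1 q.2))
    (by fun_prop) (B := B) fun q => by
      rw [abs_mul]
      have h2 : |max 0 (min 1 q.2)| ≤ 1 := by
        rw [abs_of_nonneg (le_max_left _ _)]
        exact max_le zero_le_one (min_le_left _ _)
      exact (mul_le_of_le_one_right (abs_nonneg _) h2).trans (hB _)
  have e1 : ∀ i, (fun ω => φ (V i ω) * max 0 (min 1 (A.indicator (fun _ => (1 : ℝ)) ω)))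
      = A.indicator (fun ω => φ (V i ω)) := fun i => by
    funext ω
    by_cases hω : ω ∈ A <;> simp [hω]
  have e2 : (fun ω' => φ (Vlim ω') * max 0 (min 1 (A.indicator (fun _ => (1 : ℝ)) (π ω'))))
      = (π ⁻¹' A).indicator (fun ω' => φ (Vlim ω')) := by
    funext ω'
    by_cases hω : π ω' ∈ A <;> simp [hω, Set.indicator]
  simpa only [e1, e2] using h1

/-- Splitting Ω according to the finitely many values of F reduces the claim to indicators of
𝒢-measurable sets. -/
lemma StableConv.tendsto_integral_of_finite_range (h : StableConv 𝒢 P P' π V l Vlim)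
    (h𝒢 : 𝒢 ≤ mΩ) (hπ : Measurable π) {F : Ω → S'} (hF : Measurable[𝒢] F)
    (hfin : (Set.range F).Finite) {G : S × S' → ℝ} (hG : Continuous G) {B : ℝ}
    (hB : ∀ x, |G x| ≤ B) :
    Tendsto (fun i => ∫ ω, G (V i ω, F ω) ∂P) l (𝓝 (∫ ω', G (Vlim ω', F (π ω')) ∂P')) := by
  classical
  have e1 : ∀ i ω, G (V i ω, F ω)
      = ∑ y ∈ hfin.toFinset, (F ⁻¹' {y}).indicator (fun ω => G (V i ω, y)) ω := fun i ω => by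
    rw [Finset.sum_eq_single (F ω)]
    · simp
    · intro y _ hy
      exact Set.indicator_of_notMem (fun hmem => hy hmem.symm) _
    · intro hmem
      simp at hmem
  have e2 : ∀ ω', G (Vlim ω', F (π ω')) = ∑ y ∈ hfin.toFinset,
      (π ⁻¹' (F ⁻¹' {y})).indicator (fun ω' => G (Vlim ω', y)) ω' := fun ω' => by
    rw [Finset.sum_eq_single (F (π ω'))]
    · simp
    · intro y _ hy
      exact Set.indicator_of_notMem (fun hmem => hy hmem.symm) _
    · intro hmem
      simp at hmem
  have hGy : ∀ y, Continuous fun x => G (x, y) := fun y => by fun_prop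
  have i1 : ∀ i y, Integrable ((F ⁻¹' {y}).indicator (fun ω => G (V i ω, y))) P := fun i y =>
    (Integrable.of_bound ((hGy y).measurable.comp_aemeasurable
      (h.aemeasurable i)).aestronglyMeasurable B (.of_forall fun ω => hB _)).indicator
      (h𝒢 _ (hF (measurableSet_singleton y)))
  have i2 : ∀ y, Integrable ((π ⁻¹' (F ⁻¹' {y})).indicator (fun ω' => G (Vlim ω', y))) P' :=
    fun y => (Integrable.of_bound ((hGy y).measurable.comp_aemeasurable
      h.aemeasurable_limit).aestronglyMeasurable B (.of_forall fun ω => hB _)).indicator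
      (hπ (h𝒢 _ (hF (measurableSet_singleton y))))
  simp only [e1, e2]
  rw [integral_finsetSum _ fun y _ => i2 y]
  simp only [fun i => integral_finsetSum hfin.toFinset fun y _ => i1 i y]
  exact tendsto_finsetSum _ fun y _ =>
    h.tendsto_integral_indicator (hF (measurableSet_singleton y)) (hGy y) fun x => hB _

/-- Stable convergence yields joint convergence with every `𝒢`-measurable random element. -/
theorem StableConv.tendstoInDistribution_prod [l.IsCountablyGenerated]
    (h : StableConv 𝒢 P P' π V l Vlim) (h𝒢 : 𝒢 ≤ mΩ) (hπ : MeasurePreserving π P' P) {Ξ : Ω → S'}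
    (hΞ : Measurable[𝒢] Ξ) :
    TendstoInDistribution (Ω := fun _ : ι => Ω) (fun i ω => (V i ω, Ξ ω)) l
      (fun ω' => (Vlim ω', Ξ (π ω'))) (fun _ => P) P' := by
  have hΞm : Measurable Ξ := hΞ.mono h𝒢 le_rfl
  refine tendstoInDistribution_of_lipschitz
    (fun i => (h.aemeasurable i).prodMk hΞm.aemeasurable)
    (h.aemeasurable_limit.prodMk (hΞm.comp hπ.measurable).aemeasurable) fun G K B hG hB => ?_
  obtain ⟨F, hFfin, hFm, hFlim⟩ := exists_finite_range_approx hΞ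
  have hFm' : ∀ n, Measurable (F n) := fun n => (hFm n).mono h𝒢 le_rfl
  -- Replacing Ξ by its approximation costs at most `e n`, by the Lipschitz bound or by the sup
  -- bound 2B, which also serves as dominating constant. The cost does not depend on i, and its
  -- integral is the same on the extension because π preserves measure.
  set e : ℕ → Ω → ℝ := fun n ω => min (K * dist (Ξ ω) (F n ω)) (2 * B) with he
  have hB0 : ∀ ω : Ω, 0 ≤ B := fun ω => by
    obtain ⟨ω', -⟩ : (Set.univ : Set Ω').Nonempty := nonempty_of_measure_ne_zero (μ := P') (by simp)
    exact (abs_nonneg _).trans (hB (Vlim ω', Ξ ω))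
  have hem : ∀ n, Measurable (e n) := fun n =>
    ((hΞm.dist (hFm' n)).const_mul _).min measurable_const
  have he0 : ∀ n ω, 0 ≤ e n ω := fun n ω =>
    le_min (by positivity) (by linarith [hB0 ω])
  have heB : ∀ n ω, ‖e n ω‖ ≤ 2 * B := fun n ω => by
    rw [Real.norm_of_nonneg (he0 n ω)]
    exact min_le_right _ _
  have hei : ∀ n, Integrable (e n) P := fun n =>
    .of_bound (hem n).aestronglyMeasurable (2 * B) (.of_forall fun ω => heB n ω)
  have helim : Tendsto (fun n => ∫ ω, e n ω ∂P) atTop (𝓝 0) := by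
    have := tendsto_integral_of_dominated_convergence (F := e) (f := fun _ => 0) (μ := P)
      (fun _ => 2 * B) (fun n => (hem n).aestronglyMeasurable) (integrable_const _)
      (fun n => .of_forall fun ω => heB n ω) (.of_forall fun ω => ?_)
    · simpa using this
    · have h1 : Tendsto (fun n => dist (Ξ ω) (F n ω)) atTop (𝓝 0) := by
        simpa using (tendsto_const_nhds (x := Ξ ω)).dist (hFlim ω)
      have h2 := (h1.const_mul (K : ℝ)).min (tendsto_const_nhds (x := 2 * B))
      simpa [hB0 ω] using h2
  have hclose : ∀ n x ω, |G (x, Ξ ω) - G (x, F n ω)| ≤ e n ω := fun n x ω => by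
    refine le_min ?_ ?_
    · have := hG.dist_le_mul (x, Ξ ω) (x, F n ω)
      rwa [Real.dist_eq, dist_prod_same_left] at this
    · have h1 := abs_sub (G (x, Ξ ω)) (G (x, F n ω))
      linarith [hB (x, Ξ ω), hB (x, F n ω)]
  have hint1 : ∀ i (f : Ω → S'), Measurable f → Integrable (fun ω => G (V i ω, f ω)) P :=
    fun i f hf => .of_bound (hG.continuous.measurable.comp_aemeasurable
      ((h.aemeasurable i).prodMk hf.aemeasurable)).aestronglyMeasurable B
      (.of_forall fun ω => hB _)
  have hint2 : ∀ (f : Ω → S'), Measurable f → Integrable (fun ω' => G (Vlim ω', f (π ω'))) P' :=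
    fun f hf => .of_bound (hG.continuous.measurable.comp_aemeasurable
      (h.aemeasurable_limit.prodMk (hf.comp hπ.measurable).aemeasurable)).aestronglyMeasurable B
      (.of_forall fun ω => hB _)
  have d1 : ∀ n i, |(∫ ω, G (V i ω, Ξ ω) ∂P) - ∫ ω, G (V i ω, F n ω) ∂P| ≤ ∫ ω, e n ω ∂P :=
    fun n i => by
      rw [← integral_sub (hint1 i Ξ hΞm) (hint1 i (F n) (hFm' n))]
      rw [← Real.norm_eq_abs]
      exact norm_integral_le_of_norm_le (hei n) (.of_forall fun ω => hclose n (V i ω) ω)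
  have d2 : ∀ n, |(∫ ω', G (Vlim ω', Ξ (π ω')) ∂P') - ∫ ω', G (Vlim ω', F n (π ω')) ∂P'|
      ≤ ∫ ω, e n ω ∂P := fun n => by
    have hmap : ∫ ω, e n ω ∂P = ∫ ω', e n (π ω') ∂P' := by
      rw [← hπ.map_eq, integral_map hπ.measurable.aemeasurable (hem n).aestronglyMeasurable]
    rw [← integral_sub (hint2 Ξ hΞm) (hint2 (F n) (hFm' n)), hmap]
    rw [← Real.norm_eq_abs]
    exact norm_integral_le_of_norm_le (hπ.integrable_comp_of_integrable (hei n))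
      (.of_forall fun ω' => hclose n (Vlim ω') (π ω'))
  rw [Metric.tendsto_nhds]
  intro ε hε
  obtain ⟨n, hn⟩ := (helim.eventually_lt_const (show 0 < ε / 3 by positivity)).exists
  have hconv := h.tendsto_integral_of_finite_range h𝒢 hπ.measurable (hFm n) (hFfin n)
    hG.continuous hB
  filter_upwards [Metric.tendsto_nhds.1 hconv (ε / 3) (by positivity)] with i hi
  rw [Real.dist_eq] at hi ⊢
  have b1 := abs_lt.1 hi
  have b2 := abs_le.1 (d1 n i)
  have b3 := abs_le.1 (d2 n)
  rw [abs_lt]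
  constructor <;> linarith [b1.1, b1.2, b2.1, b2.2, b3.1, b3.2]

end Stable

end QLA

namespace QLA

/-! ### Measurability of the estimator -/

section Measurability

variable {d : ℕ} {Ω : Type*} [MeasurableSpace Ω] {Θ : Set (E d)} {θs : E d} {ϖ : E d → ℝ}
  {h : Ω → E d → ℝ}

/-- Path continuity makes the integrands jointly measurable in (ω, θ), so their θ-integrals are
measurable in ω. -/
lemma IsC2RandomField.measurable_qbeError (hh : IsC2RandomField Θ h) (hΘo : IsOpen Θ)
    (hϖ : IsPrior Θ ϖ) (θs : E d) (a : Matrix (Fin d) (Fin d) ℝ) :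
    Measurable fun ω => qbeError Θ ϖ (h ω) θs a := by
  have hg : Measurable fun q : Ω × E d =>
      Θ.indicator (fun θ => Real.exp (h q.1 θ) * ϖ θ) q.2 :=
    measurable_indicator_uncurry (g := fun ω θ => Real.exp (h ω θ) * ϖ θ) hΘo.measurableSet
      (fun θ hθ => (hh.measurable θ hθ).exp.mul_const _)
      fun ω => (((hh.continuousOn ω).mono subset_closure).rexp).mul hϖ.continuousOn
  have h0 : Measurable fun ω => ∫ θ in Θ, Real.exp (h ω θ) * ϖ θ := by
    have := (hg.stronglyMeasurable.integral_prod_right' (ν := volume)).measurable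
    simpa only [integral_indicator hΘo.measurableSet] using this
  have h1 : Measurable fun ω => ∫ θ in Θ, (Real.exp (h ω θ) * ϖ θ) • θ := by
    have hg' : Measurable fun q : Ω × E d =>
        Θ.indicator (fun θ => (Real.exp (h q.1 θ) * ϖ θ) • θ) q.2 := by
      have heq : (fun q : Ω × E d => Θ.indicator (fun θ => (Real.exp (h q.1 θ) * ϖ θ) • θ) q.2)
          = fun q : Ω × E d => Θ.indicator (fun θ => Real.exp (h q.1 θ) * ϖ θ) q.2 • q.2 :=
        funext fun q => Set.indicator_smul_apply_left Θ _ (fun θ => θ) q.2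
      rw [heq]
      exact hg.smul measurable_snd
    have := (hg'.stronglyMeasurable.integral_prod_right' (ν := volume)).measurable
    simpa only [integral_indicator hΘo.measurableSet] using this
  exact (continuous_act _).measurable.comp ((h0.inv.smul h1).sub_const θs)

end Measurability

/-! ### Stable convergence of the normalized error -/

section StableEstimator

/-- An unbounded 𝕋 is cofinal in ℝ≥0, so its `atTop` is pulled back from the countably generated one
there. -/
lemma isCountablyGenerated_atTop_of_not_bddAbove {𝕋 : Set ℝ≥0} (h𝕋 : ¬BddAbove 𝕋) :
    (atTop : Filter 𝕋).IsCountablyGenerated := by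
  rw [← comap_embedding_atTop (e := ((↑) : 𝕋 → ℝ≥0)) (fun _ _ => Iff.rfl) fun c => ?_]
  · infer_instance
  · obtain ⟨T, hT, hcT⟩ := not_bddAbove_iff.1 h𝕋 c
    exact ⟨⟨T, hT⟩, hcT.le⟩

lemma measurable_matrix_prodMk {d : ℕ} {Ω : Type*} {m : MeasurableSpace Ω}
    {M : Ω → Matrix (Fin d) (Fin d) ℝ} (hM : ∀ i j, Measurable fun ω => M ω i j) {Ψ : Ω → ℝ}
    (hΨ : Measurable Ψ) : Measurable fun ω => ((fun i j => M ω i j : Fin d → Fin d → ℝ), Ψ ω) :=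
  (measurable_pi_iff.2 fun i => measurable_pi_iff.2 fun j => hM i j).prodMk hΨ

variable {d : ℕ} {Ω Ω' ι : Type*} {𝒢 : MeasurableSpace Ω} [mΩ : MeasurableSpace Ω]
  [MeasurableSpace Ω'] {P : Measure Ω} [IsProbabilityMeasure P] {P' : Measure Ω'}
  [IsProbabilityMeasure P'] {π : Ω' → Ω} {l : Filter ι}
  {Γ : Ω → Matrix (Fin d) (Fin d) ℝ} {V W : ι → Ω → E d} {Vlim : Ω' → E d}

/-- The pair (Γ, Ψ) is a 𝒢-measurable random element, and the matrix action is jointly continuous,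
so continuous mapping applies to the joint limit. -/
lemma StableConv.act [l.IsCountablyGenerated] (h : StableConv 𝒢 P P' π V l Vlim) (h𝒢 : 𝒢 ≤ mΩ)
    (hπ : MeasurePreserving π P' P) (hΓ : ∀ i j, Measurable[𝒢] fun ω => Γ ω i j) :
    StableConv 𝒢 P P' π (fun i ω => act (Γ ω) (V i ω)) l (fun ω' => act (Γ (π ω')) (Vlim ω')) := by
  intro Ψ hΨ
  have hΞ : Measurable[𝒢] fun ω => ((fun i j => Γ ω i j : Fin d → Fin d → ℝ), Ψ ω) :=
    measurable_matrix_prodMk hΓ hΨ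
  have hc : Continuous fun q : E d × ((Fin d → Fin d → ℝ) × ℝ) =>
      (QLA.act (Matrix.of q.2.1) q.1, q.2.2) :=
    (continuous_act_uncurry.comp (((continuous_fst.comp continuous_snd : Continuous
      fun q : E d × ((Fin d → Fin d → ℝ) × ℝ) => q.2.1)).prodMk continuous_fst)).prodMk
      (continuous_snd.comp continuous_snd)
  exact (h.tendstoInDistribution_prod h𝒢 hπ hΞ).continuous_comp hc

/-- This is Slutsky's lemma for the pairs with Ψ, whose second coordinates do not differ. -/
lemma StableConv.of_tendstoInMeasure_sub [l.IsCountablyGenerated]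
    (h : StableConv 𝒢 P P' π V l Vlim) (h𝒢 : 𝒢 ≤ mΩ) (hW : ∀ i, AEMeasurable (W i) P)
    (hsub : TendstoInMeasure P (fun i ω => W i ω - V i ω) l (fun _ => 0)) :
    StableConv 𝒢 P P' π W l Vlim := by
  intro Ψ hΨ
  have hΨm : Measurable Ψ := hΨ.mono h𝒢 le_rfl
  refine tendstoInDistribution_of_tendstoInMeasure_sub (fun i ω => (W i ω, Ψ ω)) _ (h Ψ hΨ) ?_
    fun i => (hW i).prodMk hΨm.aemeasurable
  rw [tendstoInMeasure_iff_norm] at hsub ⊢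
  intro ε hε
  refine (hsub ε hε).congr fun i => ?_
  congr 1
  ext ω
  simp [Prod.norm_def]

variable {Θ : Set (E d)} {θs : E d} {𝕋 : Set ℝ≥0} {H : 𝕋 → Ω → E d → ℝ} {a : 𝕋 → GL (Fin d) ℝ}
  {Y : Ω → E d → ℝ} {L α β₁ β₂ ρ₁ ρ₂ : ℝ}

lemma tendstoInMeasure_qbeError_sub (hd : 0 < d) (hΘo : IsOpen Θ)
    (hΘb : Bornology.IsBounded Θ) (hθs : θs ∈ Θ) (hH : ∀ T, IsC2RandomField Θ (H T))
    (ha : Tendsto (fun T => frob (a T).1) atTop (𝓝 0)) (hY : IsContRandomField Θ Y)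
    {ϖ : E d → ℝ} (hϖ : IsPrior Θ ϖ)
    (hΓsymm : ∀ ω, (Γ ω).IsSymm) (hΓ : ∀ i j, Measurable fun ω => Γ ω i j)
    (hS1 : S1 α β₁ β₂ ρ₁ ρ₂) (hS2 : S2 P Θ θs Y Γ L α ρ₁ ρ₂)
    (hS3 : S3 P Θ θs H a Y Γ L α β₁ β₂ ρ₁ ρ₂) (hL : 0 < L) :
    TendstoInMeasure P (fun T ω => qbeError Θ ϖ (H T ω) θs (a T).1
      - QLA.act (Γ ω)⁻¹ (score (H T ω) θs (a T).1)) atTop (fun _ => 0) := by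
  rw [tendstoInMeasure_iff_measureReal_norm]
  intro ε hε
  simp only [sub_zero]
  rw [tendsto_order]
  refine ⟨fun b hb => .of_forall fun T => hb.trans_le measureReal_nonneg, fun b hb => ?_⟩
  filter_upwards [eventually_measureReal_qbeError_sub_le hd hΘo hΘb hθs hH ha hY hϖ hΓsymm hΓ
    hS1 hS2 hS3 hL hε (half_pos hb)] with T hT
  linarith

end StableEstimator

end QLA

namespace QLA

/-! ### Lower bound for the normalizing constant -/

section LowerBound

variable {d : ℕ}

lemma abs_le_half_add_rpow {x q : ℝ} (hq : 1 ≤ q) : |x| ≤ 1 / 2 + 2 ^ q * |x| ^ q / 2 := by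
  rcases le_or_gt |x| (1 / 2) with h | h
  · have : 0 ≤ 2 ^ q * |x| ^ q / 2 := by positivity
    linarith
  · have h1 : (2 * |x|) ^ (1 : ℝ) ≤ (2 * |x|) ^ q :=
      Real.rpow_le_rpow_of_exponent_le (by linarith) hq
    rw [Real.rpow_one, Real.mul_rpow (by norm_num) (abs_nonneg x)] at h1
    linarith

/-- From |x| ≤ 1/2 + (2|x|)^q/2 the hypothesis makes the average of |g| over B at most 1. The
tangent line bound exp x ≥ e⁻¹(2 − |x|) is then averaged. -/
lemma exp_neg_one_mul_le_setIntegral_exp {B : Set (E d)} (hB : IsCompact B) {g : E d → ℝ}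
    (hg : ContinuousOn g B) {q : ℝ} (hq : 1 ≤ q)
    (h : 2 ^ q * ∫ u in B, |g u| ^ q ≤ volume.real B) :
    Real.exp (-1) * volume.real B ≤ ∫ u in B, Real.exp (g u) := by
  have hfin : volume B ≠ ∞ := hB.measure_lt_top.ne
  have h1 : IntegrableOn (fun u => |g u| ^ q) B :=
    ContinuousOn.integrableOn_compact hB (hg.abs.rpow_const fun u _ => .inr (by linarith))
  have hc : ∀ c : ℝ, IntegrableOn (fun _ : E d => c) B := fun c => integrableOn_const hfin
  have hi : IntegrableOn (fun u => 1 / 2 + 2 ^ q / 2 * |g u| ^ q) B :=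
    (hc _).add (h1.const_mul _)
  have h2 : ∫ u in B, Real.exp (-1) * (2 - (1 / 2 + 2 ^ q / 2 * |g u| ^ q))
      ≤ ∫ u in B, Real.exp (g u) := by
    refine setIntegral_mono_on (((hc 2).sub hi).const_mul _)
      (ContinuousOn.integrableOn_compact hB hg.rexp) hB.measurableSet fun u _ => ?_
    have e1 := abs_le_half_add_rpow (x := g u) hq
    have e2 := Real.add_one_le_exp (g u + 1)
    have e3 : Real.exp (g u) = Real.exp (-1) * Real.exp (g u + 1) := by
      rw [← Real.exp_add]
      ring_nf
    rw [e3]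
    gcongr
    linarith [neg_abs_le (g u)]
  rw [integral_const_mul, integral_sub (hc 2) hi,
    integral_add (hc _) (h1.const_mul _), integral_const_mul, setIntegral_const,
    setIntegral_const, smul_eq_mul, smul_eq_mul] at h2
  refine le_trans ?_ h2
  gcongr
  linarith

variable {Ω : Type*} [MeasurableSpace Ω] {P : Measure Ω} [IsProbabilityMeasure P]
  {Θ : Set (E d)} {θs : E d} {h : Ω → E d → ℝ} {a : Matrix (Fin d) (Fin d) ℝ}

/-- The indicator is needed because the field is known to be measurable only at points of Θ; on the
small balls used below it has no effect. -/
lemma IsC2RandomField.measurable_local (hh : IsC2RandomField Θ h) (hΘo : IsOpen Θ) (hθs : θs ∈ Θ)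
    (a : Matrix (Fin d) (Fin d) ℝ) :
    Measurable fun z : Ω × E d => Θ.indicator (h z.1) (θs + act a z.2) - h z.1 θs := by
  have h1 := measurable_indicator_uncurry hΘo.measurableSet hh.measurable
    fun ω => (hh.continuousOn ω).mono subset_closure
  have h2 : Measurable fun z : Ω × E d => (z.1, θs + act a z.2) :=
    measurable_fst.prodMk (((continuous_act a).measurable.comp measurable_snd).const_add θs)
  exact (h1.comp h2).sub ((hh.measurable θs hθs).comp measurable_fst)

/-- The normalizing constant of the posterior is not too small, with high probability. -/
lemma measureReal_setIntegral_exp_lt_le (hh : IsC2RandomField Θ h) (hΘo : IsOpen Θ)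
    (hθs : θs ∈ Θ) {q c₀ ε : ℝ} (hq : 1 ≤ q) (hc₀ : 0 ≤ c₀) (hε : 0 < ε)
    (hball : ∀ u ∈ Metric.closedBall (0 : E d) ε, θs + act a u ∈ Θ)
    (hmom : ∀ u ∈ Metric.closedBall (0 : E d) ε,
      ∫⁻ ω, ENNReal.ofReal (|h ω (θs + act a u) - h ω θs| ^ q) ∂P
        ≤ ENNReal.ofReal (c₀ * ‖u‖ ^ q)) :
    P.real {ω | ∫ u in Metric.closedBall (0 : E d) ε, Real.exp (h ω (θs + act a u) - h ω θs)
        < Real.exp (-1) * volume.real (Metric.closedBall (0 : E d) ε)} ≤ 2 ^ q * c₀ * ε ^ q := by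
  set B := Metric.closedBall (0 : E d) ε
  have hBc : IsCompact B := isCompact_closedBall _ _
  have hBm : MeasurableSet B := hBc.measurableSet
  have hV : 0 < volume.real B :=
    ENNReal.toReal_pos (Metric.measure_closedBall_pos _ _ hε).ne' measure_closedBall_lt_top.ne
  have hVeq : volume B = ENNReal.ofReal (volume.real B) :=
    (ENNReal.ofReal_toReal measure_closedBall_lt_top.ne).symm
  set g : Ω → E d → ℝ := fun ω u => Θ.indicator (h ω) (θs + act a u) - h ω θs with hg
  have hgeq : ∀ ω, ∀ u ∈ B, g ω u = h ω (θs + act a u) - h ω θs := fun ω u hu => by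
    simp only [hg]
    rw [Set.indicator_of_mem (hball u hu)]
  have hgm : Measurable fun z : Ω × E d => ENNReal.ofReal (|g z.1 z.2| ^ q) :=
    ((hh.measurable_local hΘo hθs a).norm.pow_const q).ennreal_ofReal
  -- By Tonelli's theorem the pointwise moment bound becomes a bound on the mean of `X`; Markov's
  -- inequality at level vol(B)/2^q then gives 2^q c₀ ε^q.
  set X : Ω → ℝ≥0∞ := fun ω => ∫⁻ u in B, ENNReal.ofReal (|g ω u| ^ q)
  have hXm : Measurable X := hgm.lintegral_prod_right'
  have hX : ∫⁻ ω, X ω ∂P ≤ ENNReal.ofReal (volume.real B * (c₀ * ε ^ q)) := by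
    calc ∫⁻ ω, X ω ∂P = ∫⁻ u in B, ∫⁻ ω, ENNReal.ofReal (|g ω u| ^ q) ∂P :=
          lintegral_lintegral_swap hgm.aemeasurable
      _ ≤ ∫⁻ _u in B, ENNReal.ofReal (c₀ * ε ^ q) := by
          refine setLIntegral_mono measurable_const fun u hu => ?_
          simp only [fun ω => hgeq ω u hu]
          refine (hmom u hu).trans (ENNReal.ofReal_le_ofReal ?_)
          gcongr
          exact mem_closedBall_zero_iff.1 hu
      _ = ENNReal.ofReal (volume.real B * (c₀ * ε ^ q)) := by
          rw [setLIntegral_const, hVeq, ← ENNReal.ofReal_mul (by positivity), mul_comm]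
  have hx : 0 < volume.real B / 2 ^ q := by positivity
  have hmarkov := meas_ge_le_lintegral_div (μ := P) hXm.aemeasurable
    (ε := ENNReal.ofReal (volume.real B / 2 ^ q)) (by simpa using hx) ENNReal.ofReal_ne_top
  refine ENNReal.toReal_le_of_le_ofReal (by positivity) ?_
  refine le_trans (measure_mono fun ω hω => ?_) (hmarkov.trans (b := _) ?_)
  · rw [Set.mem_ofPred_eq] at hω ⊢
    by_contra hlt
    rw [not_le] at hlt
    have hcont : ContinuousOn (fun u => h ω (θs + act a u) - h ω θs) B :=
      (((hh.continuousOn ω).mono subset_closure).comp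
        (continuous_const.add (continuous_act a)).continuousOn hball).sub continuousOn_const
    have hint : IntegrableOn (fun u => |h ω (θs + act a u) - h ω θs| ^ q) B :=
      ContinuousOn.integrableOn_compact hBc (hcont.abs.rpow_const fun u _ => .inr (by linarith))
    have hXω : X ω = ENNReal.ofReal (∫ u in B, |h ω (θs + act a u) - h ω θs| ^ q) := by
      rw [ofReal_integral_eq_lintegral_ofReal hint (.of_forall fun u => by
        simp only [Pi.zero_apply]; positivity)]
      exact setLIntegral_congr_fun hBm fun u hu => by simp only [hgeq ω u hu]
    rw [hXω, ENNReal.ofReal_lt_ofReal_iff hx, lt_div_iff₀ (by positivity)] at hlt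
    exact absurd hω (not_lt.2 (exp_neg_one_mul_le_setIntegral_exp hBc hcont hq
      (by rw [mul_comm]; exact hlt.le)))
  · refine (ENNReal.div_le_div_right hX _).trans ?_
    rw [← ENNReal.ofReal_div_of_pos hx]
    refine ENNReal.ofReal_le_ofReal (le_of_eq ?_)
    field_simp

end LowerBound

/-! ### Polynomial tail of the normalized error -/

section EstimatorTail

variable {d : ℕ} {Θ : Set (E d)} {θs : E d} {ϖ h : E d → ℝ} {a : Matrix (Fin d) (Fin d) ℝ}

lemma setIntegral_localDensity_pos (ha : IsUnit a.det) (hΘo : IsOpen Θ)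
    (hΘb : Bornology.IsBounded Θ) (hθs : θs ∈ Θ) (hϖ : IsPrior Θ ϖ)
    (hh : ContinuousOn h (closure Θ)) :
    0 < ∫ u in localSpace Θ θs a, localDensity ϖ h θs a u := by
  obtain ⟨c, C, hc, hcC⟩ := hϖ.bounds
  have hU := isOpen_localSpace (θs := θs) (a := a) hΘo
  have hpos : ∀ u ∈ localSpace Θ θs a, 0 < localDensity ϖ h θs a u := fun u hu =>
    mul_pos (Real.exp_pos _) (hc.trans_le (hcC _ hu).1)
  rw [setIntegral_pos_iff_support_of_nonneg_ae _
    (integrableOn_localDensity ha (integrableOn_exp_mul_prior hΘo hΘb hϖ hh))]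
  · rw [Set.inter_eq_right.2 fun u hu => Function.mem_support.2 (hpos u hu).ne']
    exact hU.measure_pos _ ⟨0, by simpa [localSpace] using hθs⟩
  · filter_upwards [ae_restrict_mem hU.measurableSet] with u hu using (hpos u hu).le

/-- A mean over a bounded set is bounded. In `norm_densityMean_le` the radius is taken beyond the
whole local space, which makes the tail condition vacuous with constant 0. -/
lemma exists_norm_qbeError_le (ha : IsUnit a.det) (hΘo : IsOpen Θ) (hΘb : Bornology.IsBounded Θ)
    (hθs : θs ∈ Θ) (hϖ : IsPrior Θ ϖ) :
    ∃ B : ℝ, ∀ h : E d → ℝ, ContinuousOn h (closure Θ) → ‖qbeError Θ ϖ h θs a‖ ≤ B := by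
  obtain ⟨c, C, hc, hcC⟩ := hϖ.bounds
  obtain ⟨B, hB⟩ := (isBounded_localSpace (θs := θs) hΘb ha).exists_norm_le
  have hB0 : 0 ≤ B := (norm_nonneg _).trans (hB 0 (by simpa [localSpace] using hθs))
  refine ⟨B + 1, fun h hh => ?_⟩
  rw [qbeError_eq_densityMean ha hΘo hΘb hθs hϖ hh]
  have := norm_densityMean_le (isOpen_localSpace (θs := θs) (a := a) hΘo).measurableSet
    (integrableOn_localDensity ha (integrableOn_exp_mul_prior hΘo hΘb hϖ hh))
    (r := B + 1) (C := 0) (by linarith) le_rfl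
    (setIntegral_localDensity_pos ha hΘo hΘb hθs hϖ hh)
    (fun u hu => mul_nonneg (Real.exp_pos _).le (hc.le.trans (hcC _ hu).1))
    (fun u hu hru => by linarith [hB u hu]) le_rfl
  simpa using this

lemma norm_qbeError_le (ha : IsUnit a.det) (hΘo : IsOpen Θ) (hΘb : Bornology.IsBounded Θ)
    (hθs : θs ∈ Θ) (hϖ : IsPrior Θ ϖ) {c C : ℝ} (hc : 0 < c)
    (hcC : ∀ θ ∈ Θ, c ≤ ϖ θ ∧ ϖ θ ≤ C) (hh : ContinuousOn h (closure Θ)) {r D : ℝ} (hr : 0 ≤ r)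
    (hD : 0 < D) {B : Set (E d)} (hBc : IsCompact B) (hB : ∀ u ∈ B, θs + act a u ∈ Θ)
    (hint : D ≤ ∫ u in B, Real.exp (h (θs + act a u) - h θs))
    (htail : ∀ u, θs + act a u ∈ Θ → r ≤ ‖u‖ → h (θs + act a u) - h θs ≤ -‖u‖ / 4) :
    ‖qbeError Θ ϖ h θs a‖ ≤ r + C * expTail d r / (c * D) := by
  rw [qbeError_eq_densityMean ha hΘo hΘb hθs hϖ hh]
  have hG := integrableOn_localDensity (θs := θs) ha (integrableOn_exp_mul_prior hΘo hΘb hϖ hh)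
  have hU := (isOpen_localSpace (θs := θs) (a := a) hΘo).measurableSet
  have hpos : ∀ u ∈ localSpace Θ θs a, 0 ≤ localDensity ϖ h θs a u := fun u hu =>
    mul_nonneg (Real.exp_pos _).le (hc.le.trans (hcC _ hu).1)
  have hC0 : 0 ≤ C := by linarith [hcC θs hθs]
  refine norm_densityMean_le hU hG hr hC0 (by positivity) hpos (fun u hu hru => ?_) ?_
  · rw [localDensity, mul_comm]
    have := hcC _ hu
    gcongr
    · linarith
    · exact htail u hu hru
  · have hcont : ContinuousOn (fun u => Real.exp (h (θs + act a u) - h θs)) B :=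
      (((hh.mono subset_closure).comp
        (continuous_const.add (continuous_act a)).continuousOn hB).sub continuousOn_const).rexp
    calc c * D ≤ c * ∫ u in B, Real.exp (h (θs + act a u) - h θs) := by gcongr
      _ = ∫ u in B, c * Real.exp (h (θs + act a u) - h θs) := (integral_const_mul _ _).symm
      _ ≤ ∫ u in B, localDensity ϖ h θs a u := by
          refine setIntegral_mono_on ((hcont.integrableOn_compact hBc).const_mul _)
            (hG.mono_set hB) hBc.measurableSet fun u hu => ?_
          rw [localDensity, mul_comm]
          gcongr
          exact (hcC _ (hB u hu)).1
      _ ≤ ∫ u in localSpace Θ θs a, localDensity ϖ h θs a u := by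
          refine setIntegral_mono_set hG ?_ (show B ⊆ localSpace Θ θs a from hB).eventuallyLE
          filter_upwards [ae_restrict_mem hU] with u hu using hpos u hu

variable {Ω : Type*} [MeasurableSpace Ω] {P : Measure Ω} [IsProbabilityMeasure P]
  {𝕋 : Set ℝ≥0} {H : 𝕋 → Ω → E d → ℝ} {a : 𝕋 → GL (Fin d) ℝ}
  {Y : Ω → E d → ℝ} {Γ : Ω → Matrix (Fin d) (Fin d) ℝ} {L α β₁ β₂ ρ₁ ρ₂ : ℝ}

/-- Polynomial tail bound for the normalized error of the quasi-Bayesian estimator. -/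
theorem exists_qbeError_tail (hd : 0 < d) (hΘo : IsOpen Θ) (hΘb : Bornology.IsBounded Θ)
    (hθs : θs ∈ Θ) (hH : ∀ T, IsC2RandomField Θ (H T))
    (ha : Tendsto (fun T => frob (a T).1) atTop (𝓝 0)) (hY : IsContRandomField Θ Y)
    (hϖ : IsPrior Θ ϖ)
    (hΓsymm : ∀ ω, (Γ ω).IsSymm) (hΓ : ∀ i j, Measurable fun ω => Γ ω i j)
    (hS1 : S1 α β₁ β₂ ρ₁ ρ₂) (hS2 : S2 P Θ θs Y Γ L α ρ₁ ρ₂)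
    (hS3 : S3 P Θ θs H a Y Γ L α β₁ β₂ ρ₁ ρ₂) (hL : 0 < L) {q c₀ δ : ℝ} (T₀ : 𝕋) (hq : 1 ≤ q)
    (hc₀ : 0 < c₀) (hδ : 0 < δ)
    (hmom : ∀ u ∈ Metric.ball (0 : E d) δ, ∀ T : 𝕋, T₀ ≤ T → θs + act (a T).1 u ∈ Θ →
      ∫⁻ ω, ENNReal.ofReal (|H T ω (θs + act (a T).1 u) - H T ω θs| ^ q) ∂P
        ≤ ENNReal.ofReal (c₀ * ‖u‖ ^ q)) :
    ∃ C r₀ : ℝ, 0 < r₀ ∧ ∀ᶠ T in atTop, ∀ r, r₀ ≤ r →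
      P.real {ω | 2 * r < ‖qbeError Θ ϖ (H T ω) θs (a T).1‖} ≤ C / r ^ L := by
  obtain ⟨c, C, hc, hcC⟩ := hϖ.bounds
  have hC0 : 0 ≤ C := by linarith [hcC θs hθs]
  obtain ⟨C₅, b₀, hC₅, hb₀, t₅⟩ :=
    exists_large_deviation hd hΘo hΘb hθs hH hY hΓsymm hΓ hS1 hS2 hS3 hL
  -- The normalizing constant is bounded below by a multiple of ε^d = r^{-Ld/q}; a tail decay of
  -- order `N` ≥ Ld/q compensates for this.
  obtain ⟨N, hN⟩ := exists_nat_ge (L / q * d)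
  obtain ⟨A, hA, hAle⟩ := exists_expTail_le d N
  obtain ⟨δ₁, hδ₁, hball⟩ := Metric.isOpen_iff.1 hΘo θs hθs
  have hq0 : 0 < q := by linarith
  have hLq : 0 < L / q := by positivity
  set v := volume.real (Metric.closedBall (0 : E d) 1)
  have hv : 0 < v :=
    ENNReal.toReal_pos (Metric.measure_closedBall_pos _ _ one_pos).ne' measure_closedBall_lt_top.ne
  obtain ⟨r₁, hr₁⟩ := eventually_atTop.1
    ((tendsto_rpow_neg_atTop hLq).eventually_lt_const hδ)
  set κ := C * A / (c * (Real.exp (-1) * v))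
  -- Beyond `r₁` the small radius is below δ; beyond `κ` the tail contribution is at most r, so that
  -- the norm is at most 2r; r ≥ 1 is required by the large deviation bound. None of the conditions
  -- on T below involves r.
  refine ⟨C₅ + 2 ^ q * c₀, max (max r₁ κ) 1, by positivity, ?_⟩
  filter_upwards [(tendsto_rate hd ha).eventually_ge_atTop b₀, eventually_ge_atTop T₀,
    (show Tendsto (fun T => frob (a T).1 * δ) atTop (𝓝 0) by
      simpa using ha.mul_const δ).eventually_lt_const hδ₁] with T hT hT₀ hTδ r hr
  have hr1 : 1 ≤ r := (le_max_right _ _).trans hr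
  have hrκ : κ ≤ r := ((le_max_right _ _).trans (le_max_left _ _)).trans hr
  have hrr₁ : r₁ ≤ r := ((le_max_left _ _).trans (le_max_left _ _)).trans hr
  have hr0 : 0 < r := by linarith
  -- With this radius the failure probability 2^q c₀ ε^q equals 2^q c₀ r^{-L}.
  set ε := r ^ (-(L / q))
  have hε : 0 < ε := by positivity
  have hεδ : ε < δ := hr₁ r hrr₁
  have hBδ : ∀ u ∈ Metric.closedBall (0 : E d) ε, u ∈ Metric.ball (0 : E d) δ := fun u hu =>
    Metric.closedBall_subset_ball hεδ hu
  have hBΘ : ∀ u ∈ Metric.closedBall (0 : E d) ε, θs + act (a T).1 u ∈ Θ := fun u hu => by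
    refine hball ?_
    rw [mem_ball_iff_norm, add_sub_cancel_left]
    have h1 : ‖u‖ ≤ δ := (mem_ball_zero_iff.1 (hBδ u hu)).le
    exact ((norm_act_le _ _).trans
      (mul_le_mul_of_nonneg_left h1 (frob_nonneg _))).trans_lt hTδ
  have hvol : volume.real (Metric.closedBall (0 : E d) ε) = ε ^ d * v := by
    rw [Measure.addHaar_real_closedBall' _ _ hε.le, finrank_euclideanSpace_fin]
  have e₁ := t₅ T hT r hr1
  have e₂ := measureReal_setIntegral_exp_lt_le (hH T) hΘo hθs hq hc₀.le hε hBΘ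
    fun u hu => hmom u (hBδ u hu) T hT₀ (hBΘ u hu)
  have hεq : ε ^ q = (r ^ L)⁻¹ := by
    rw [← Real.rpow_mul hr0.le, ← Real.rpow_neg hr0.le]
    congr 1
    field_simp
  rw [hεq, ← div_eq_mul_inv] at e₂
  have hsub : {ω | 2 * r < ‖qbeError Θ ϖ (H T ω) θs (a T).1‖}
      ⊆ {ω | ∃ u, θs + act (a T).1 u ∈ Θ ∧ r ≤ ‖u‖ ∧
        -‖u‖ / 4 < H T ω (θs + act (a T).1 u) - H T ω θs}
        ∪ {ω | ∫ u in Metric.closedBall (0 : E d) ε,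
          Real.exp (H T ω (θs + act (a T).1 u) - H T ω θs)
            < Real.exp (-1) * volume.real (Metric.closedBall (0 : E d) ε)} := by
    intro ω hω
    by_contra hn
    simp only [Set.mem_union, not_or] at hn
    obtain ⟨n₁, n₂⟩ := hn
    have hle := norm_qbeError_le (isUnit_det (a T)) hΘo hΘb hθs hϖ hc hcC ((hH T).continuousOn ω)
      hr0.le (by rw [hvol]; positivity) (isCompact_closedBall (0 : E d) ε) hBΘ (not_lt.1 n₂)
      (fun u hu hu' => not_lt.1 fun hlt => n₁ ⟨u, hu, hu', hlt⟩)
    have hbound : C * expTail d r / (c * (Real.exp (-1)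
        * volume.real (Metric.closedBall (0 : E d) ε))) ≤ κ := by
      have hεd : 1 ≤ (1 + r) ^ N * ε ^ d := by
        have h1 : ε ^ d = r ^ (-(L / q * d)) := by
          rw [← Real.rpow_natCast, ← Real.rpow_mul hr0.le]
          ring_nf
        have h2 : r ^ (L / q * d) ≤ (1 + r) ^ N := by
          calc r ^ (L / q * d) ≤ r ^ (N : ℝ) := Real.rpow_le_rpow_of_exponent_le hr1 hN
            _ = r ^ N := Real.rpow_natCast r N
            _ ≤ (1 + r) ^ N := by gcongr; linarith
        rw [h1, Real.rpow_neg hr0.le, ← div_eq_mul_inv, le_div_iff₀ (by positivity), one_mul]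
        exact h2
      rw [hvol]
      calc C * expTail d r / (c * (Real.exp (-1) * (ε ^ d * v)))
          ≤ C * (A / (1 + r) ^ N) / (c * (Real.exp (-1) * (ε ^ d * v))) := by
            gcongr
            exact hAle r hr0.le
        _ = κ / ((1 + r) ^ N * ε ^ d) := by
            simp only [κ]
            field_simp
        _ ≤ κ := div_le_self (by positivity) hεd
    have : 2 * r < _ := hω
    linarith
  refine (measureReal_mono hsub).trans ((measureReal_union_le _ _).trans ?_)
  rw [add_div]
  exact add_le_add e₁ e₂

end EstimatorTail

end QLA

namespace QLA

/-! ### Moments from tails, and polynomial growth -/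

section Moments

variable {S : Type*} [NormedAddCommGroup S] [MeasurableSpace S] [BorelSpace S]

/-- A polynomial tail bound controls the moments of lower order. -/
lemma exists_integral_norm_rpow_le (C : ℝ) {t₀ L p : ℝ} (ht₀ : 0 < t₀) (hp : 0 < p) (hpL : p < L) :
    ∃ K : ℝ, 0 ≤ K ∧ ∀ μ : Measure S, IsProbabilityMeasure μ →
      (∀ t, t₀ ≤ t → μ.real {x | t < ‖x‖} ≤ C / t ^ L) →
      Integrable (fun x => ‖x‖ ^ p) μ ∧ ∫ x, ‖x‖ ^ p ∂μ ≤ K := by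
  -- In the layer-cake formula the tail probability is bounded by 1 up to t₀ and by |C| t^{-L}
  -- beyond. The first integral converges because p > 0, the second because p < L.
  have i1 : IntegrableOn (fun t : ℝ => t ^ (p - 1)) (Set.Ioc 0 t₀) :=
    (intervalIntegrable_iff_integrableOn_Ioc_of_le ht₀.le).1
      (intervalIntegral.intervalIntegrable_rpow' (by linarith))
  have i2 : IntegrableOn (fun t : ℝ => |C| * t ^ (p - 1 - L)) (Set.Ioi t₀) :=
    (integrableOn_Ioi_rpow_of_lt (by linarith) ht₀).const_mul _
  set K := p * ((∫ t in Set.Ioc 0 t₀, t ^ (p - 1)) + ∫ t in Set.Ioi t₀, |C| * t ^ (p - 1 - L))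
  have p1 : ∀ t ∈ Set.Ioc 0 t₀, 0 ≤ t ^ (p - 1) := fun t ht => Real.rpow_nonneg ht.1.le _
  have p2 : ∀ t ∈ Set.Ioi t₀, 0 ≤ |C| * t ^ (p - 1 - L) := fun t ht =>
    mul_nonneg (abs_nonneg _) (Real.rpow_nonneg (ht₀.trans ht).le _)
  have n1 := setIntegral_nonneg (μ := volume) measurableSet_Ioc p1
  have n2 := setIntegral_nonneg (μ := volume) measurableSet_Ioi p2
  have hK : 0 ≤ K := by positivity
  refine ⟨K, hK, fun μ _ htail => ?_⟩
  have hm : Measurable fun x : S => ‖x‖ ^ p := measurable_norm.pow_const p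
  have hle : ∫⁻ x, ENNReal.ofReal (‖x‖ ^ p) ∂μ ≤ ENNReal.ofReal K := by
    rw [lintegral_rpow_eq_lintegral_meas_lt_mul μ (.of_forall fun x => norm_nonneg x)
      measurable_norm.aemeasurable hp, ← Set.Ioc_union_Ioi_eq_Ioi ht₀.le,
      ENNReal.ofReal_mul hp.le, ENNReal.ofReal_add n1 n2]
    gcongr
    refine (lintegral_union_le _ _ _).trans (add_le_add ?_ ?_)
    · rw [ofReal_integral_eq_lintegral_ofReal i1
        ((ae_restrict_mem measurableSet_Ioc).mono p1)]
      exact lintegral_mono fun t => mul_le_of_le_one_left' prob_le_one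
    · rw [ofReal_integral_eq_lintegral_ofReal i2
        ((ae_restrict_mem measurableSet_Ioi).mono p2)]
      refine setLIntegral_mono (by fun_prop) fun t ht => ?_
      have ht0 : 0 < t := ht₀.trans ht
      calc μ {x | t < ‖x‖} * ENNReal.ofReal (t ^ (p - 1))
          = ENNReal.ofReal (μ.real {x | t < ‖x‖}) * ENNReal.ofReal (t ^ (p - 1)) := by
            rw [ofReal_measureReal]
        _ = ENNReal.ofReal (μ.real {x | t < ‖x‖} * t ^ (p - 1)) :=
            (ENNReal.ofReal_mul measureReal_nonneg).symm
        _ ≤ ENNReal.ofReal (|C| * t ^ (p - 1 - L)) := by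
            refine ENNReal.ofReal_le_ofReal ?_
            rw [Real.rpow_sub ht0 (p - 1) L, ← mul_div_assoc, mul_div_right_comm]
            gcongr
            refine (htail t (le_of_lt ht)).trans ?_
            gcongr
            exact le_abs_self C
  have hint : Integrable (fun x => ‖x‖ ^ p) μ := by
    refine ⟨hm.aestronglyMeasurable, ?_⟩
    rw [hasFiniteIntegral_iff_ofReal (.of_forall fun x => by positivity)]
    exact hle.trans_lt ENNReal.ofReal_lt_top
  refine ⟨hint, ?_⟩
  rw [← ENNReal.ofReal_le_ofReal_iff hK, ofReal_integral_eq_lintegral_ofReal hint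
    (.of_forall fun x => by positivity)]
  exact hle

/-- The limsup controls f outside some ball, and continuity bounds it on the ball. Enlarging the
radius to at least 1 ensures that |x|^{-p} can be inverted outside. -/
lemma PolyGrowth.exists_le {d : ℕ} {p : ℝ} {f : E d → ℝ} (hf : Continuous f)
    (h : PolyGrowth p f) : ∃ A : ℝ, 0 ≤ A ∧ ∀ x, |f x| ≤ A * (1 + ‖x‖ ^ p) := by
  obtain ⟨M, hM, hM'⟩ := ENNReal.lt_iff_exists_nnreal_btwn.1 h
  have h1 := eventually_lt_of_limsup_lt hM
  obtain ⟨R, hR, hR'⟩ := (Metric.hasBasis_cobounded_compl_closedBall (0 : E d)).eventually_iff.1 h1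
  obtain ⟨B, hB⟩ := (isCompact_closedBall (0 : E d) (max R 1)).exists_bound_of_continuousOn
    hf.continuousOn
  have hB0 : 0 ≤ B := (norm_nonneg _).trans (hB 0 (by simp))
  refine ⟨B + M, by positivity, fun x => ?_⟩
  have hxp : 0 ≤ ‖x‖ ^ p := by positivity
  rcases le_or_gt ‖x‖ (max R 1) with hx | hx
  · have h2 := hB x (mem_closedBall_zero_iff.2 hx)
    rw [Real.norm_eq_abs] at h2
    nlinarith [M.2, mul_nonneg (add_nonneg hB0 M.2) hxp, NNReal.coe_nonneg M]
  · have hx0 : 0 < ‖x‖ := by linarith [le_max_right R 1]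
    have h2 : ENNReal.ofReal (‖x‖ ^ (-p) * |f x|) < M := hR' (by
      simp only [Set.mem_compl_iff, mem_closedBall_zero_iff, not_le]
      exact (le_max_left _ _).trans_lt hx)
    rw [← ENNReal.ofReal_coe_nnreal, ENNReal.ofReal_lt_ofReal_iff_of_nonneg (by positivity),
      Real.rpow_neg hx0.le, inv_mul_lt_iff₀ (by positivity)] at h2
    nlinarith [mul_nonneg hB0 hxp, NNReal.coe_nonneg M]

end Moments

/-! ### Cutting off a function of polynomial growth -/

section Truncation

variable {S : Type*} [NormedAddCommGroup S] {f : S → ℝ} {A p p' R : ℝ}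

/-- The function `f` cut off outside the ball of radius `2 R`. -/
noncomputable def truncate (f : S → ℝ) (R : ℝ) (x : S) : ℝ := f x * max 0 (min 1 (2 - ‖x‖ / R))

lemma continuous_truncate (hf : Continuous f) : Continuous (truncate f R) := by
  unfold truncate
  fun_prop

lemma abs_truncate_le (hf : ∀ x, |f x| ≤ A * (1 + ‖x‖ ^ p)) (hA : 0 ≤ A) (hp : 0 ≤ p) (hR : 0 < R)
    (x : S) : |truncate f R x| ≤ A * (1 + (2 * R) ^ p) := by
  have h1 : |max 0 (min 1 (2 - ‖x‖ / R))| ≤ 1 := by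
    rw [abs_of_nonneg (le_max_left _ _)]
    exact max_le zero_le_one (min_le_left _ _)
  rw [truncate, abs_mul]
  rcases le_or_gt ‖x‖ (2 * R) with hx | hx
  · calc |f x| * |max 0 (min 1 (2 - ‖x‖ / R))| ≤ |f x| :=
          mul_le_of_le_one_right (abs_nonneg _) h1
      _ ≤ A * (1 + ‖x‖ ^ p) := hf x
      _ ≤ A * (1 + (2 * R) ^ p) := by gcongr
  · have h2 : 2 - ‖x‖ / R ≤ 0 := by
      rw [sub_nonpos, le_div_iff₀ hR]
      exact hx.le
    rw [max_eq_left ((min_le_right _ _).trans h2), abs_zero, mul_zero]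
    positivity

/-- The difference vanishes for |x| ≤ R. For |x| > R ≥ 1 one has 1 + |x|^p ≤ 2|x|^p, and the excess
p' − p of the exponent yields the factor R^{p−p'}. -/
lemma abs_sub_truncate_le (hf : ∀ x, |f x| ≤ A * (1 + ‖x‖ ^ p)) (hA : 0 ≤ A) (hp : 0 ≤ p)
    (hp' : p ≤ p') (hR : 1 ≤ R) (x : S) :
    |f x - truncate f R x| ≤ 2 * A * R ^ (p - p') * ‖x‖ ^ p' := by
  have hR0 : 0 < R := by linarith
  have h0 : f x - truncate f R x = f x * (1 - max 0 (min 1 (2 - ‖x‖ / R))) := by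
    rw [truncate]
    ring
  rw [h0, abs_mul]
  rcases le_or_gt ‖x‖ R with hx | hx
  · have h2 : 1 ≤ 2 - ‖x‖ / R := by
      have := (div_le_one hR0).2 hx
      linarith
    rw [min_eq_left h2, max_eq_right zero_le_one, sub_self, abs_zero, mul_zero]
    positivity
  · have hx0 : 0 < ‖x‖ := hR0.trans hx
    have h1 : |1 - max 0 (min 1 (2 - ‖x‖ / R))| ≤ 1 := by
      have e1 : max 0 (min 1 (2 - ‖x‖ / R)) ≤ 1 := max_le zero_le_one (min_le_left _ _)
      have e2 : 0 ≤ max 0 (min 1 (2 - ‖x‖ / R)) := le_max_left _ _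
      rw [abs_le]
      constructor <;> linarith
    have h3 : 1 ≤ ‖x‖ ^ p := Real.one_le_rpow (hR.trans hx.le) hp
    calc |f x| * |1 - max 0 (min 1 (2 - ‖x‖ / R))| ≤ |f x| :=
          mul_le_of_le_one_right (abs_nonneg _) h1
      _ ≤ A * (1 + ‖x‖ ^ p) := hf x
      _ ≤ A * (2 * ‖x‖ ^ p) := by gcongr; linarith
      _ = 2 * A * ‖x‖ ^ (p - p') * ‖x‖ ^ p' := by
          rw [mul_assoc (2 * A), ← Real.rpow_add hx0, sub_add_cancel]
          ring
      _ ≤ 2 * A * R ^ (p - p') * ‖x‖ ^ p' := by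
          gcongr 2 * A * ?_ * _
          exact Real.rpow_le_rpow_of_nonpos hR0 hx.le (by linarith)

end Truncation

/-! ### Convergence of expectations under a higher moment bound -/

section MomentConvergence

lemma integrable_mul_of_growth {Ω S : Type*} [MeasurableSpace Ω] {P : Measure Ω}
    [IsFiniteMeasure P] [NormedAddCommGroup S] [MeasurableSpace S] [BorelSpace S]
    {f : S → ℝ} {A B p p' : ℝ} (hfc : Continuous f)
    (hf : ∀ x, |f x| ≤ A * (1 + ‖x‖ ^ p)) (hA : 0 ≤ A) (hp : 0 ≤ p) (hp' : p ≤ p') {X : Ω → S}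
    (hX : AEMeasurable X P) (hint : Integrable (fun ω => ‖X ω‖ ^ p') P) {Φ : Ω → ℝ}
    (hΦ : AEMeasurable Φ P) (hΦB : ∀ ω, |Φ ω| ≤ B) :
    Integrable (fun ω => f (X ω) * Φ ω) P := by
  refine Integrable.mono' ((((integrable_const 2).add hint).const_mul A).mul_const B)
    ((hfc.measurable.comp_aemeasurable hX).mul hΦ).aestronglyMeasurable
    (.of_forall fun ω => ?_)
  rw [Real.norm_eq_abs, abs_mul]
  have h1 : ‖X ω‖ ^ p ≤ 1 + ‖X ω‖ ^ p' := by
    rcases le_or_gt ‖X ω‖ 1 with h | h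
    · have := Real.rpow_le_one (norm_nonneg _) h hp
      have : 0 ≤ ‖X ω‖ ^ p' := by positivity
      linarith
    · linarith [Real.rpow_le_rpow_of_exponent_le h.le hp']
  change |f (X ω)| * |Φ ω| ≤ A * (2 + ‖X ω‖ ^ p') * B
  refine mul_le_mul ((hf _).trans ?_) (hΦB ω) (abs_nonneg _) (by positivity)
  exact mul_le_mul_of_nonneg_left (by linarith) hA

variable {Ω Ω' ι S : Type*} [MeasurableSpace Ω] [MeasurableSpace Ω'] {P : Measure Ω}
  [IsProbabilityMeasure P] {P' : Measure Ω'} [IsProbabilityMeasure P'] [NormedAddCommGroup S]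
  [MeasurableSpace S] [BorelSpace S] {l : Filter ι}

lemma abs_integral_mul_sub_le {f : S → ℝ} {A B p p' R K : ℝ} (hfc : Continuous f)
    (hf : ∀ x, |f x| ≤ A * (1 + ‖x‖ ^ p)) (hA : 0 ≤ A) (hB : 0 ≤ B) (hp : 0 ≤ p) (hp' : p ≤ p')
    (hR : 1 ≤ R) {X : Ω → S} (hX : AEMeasurable X P) (hint : Integrable (fun ω => ‖X ω‖ ^ p') P)
    (hK : ∫ ω, ‖X ω‖ ^ p' ∂P ≤ K) {Φ : Ω → ℝ} (hΦ : AEMeasurable Φ P) (hΦB : ∀ ω, |Φ ω| ≤ B) :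
    |(∫ ω, f (X ω) * Φ ω ∂P) - ∫ ω, truncate f R (X ω) * Φ ω ∂P|
      ≤ 2 * A * R ^ (p - p') * K * B := by
  have hR0 : 0 < R := by linarith
  have h1 : Integrable (fun ω => truncate f R (X ω) * Φ ω) P := by
    refine .of_bound (((continuous_truncate hfc).measurable.comp_aemeasurable hX).mul
      hΦ).aestronglyMeasurable (A * (1 + (2 * R) ^ p) * B) (.of_forall fun ω => ?_)
    rw [Real.norm_eq_abs, abs_mul]
    exact mul_le_mul (abs_truncate_le hf hA hp hR0 _) (hΦB ω) (abs_nonneg _) (by positivity)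
  rw [← integral_sub (integrable_mul_of_growth hfc hf hA hp hp' hX hint hΦ hΦB) h1,
    ← Real.norm_eq_abs]
  refine (norm_integral_le_of_norm_le ((hint.const_mul (2 * A * R ^ (p - p'))).mul_const B)
    (.of_forall fun ω => ?_)).trans ?_
  · rw [← sub_mul, Real.norm_eq_abs, abs_mul]
    exact mul_le_mul (abs_sub_truncate_le hf hA hp hp' hR _) (hΦB ω) (abs_nonneg _)
      (by positivity)
  · rw [integral_mul_const, integral_const_mul]
    gcongr

/-- Convergence in distribution together with a moment bound of higher order yields convergence
of the expectations of functions of polynomial growth. -/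
theorem tendsto_integral_mul_of_growth [SecondCountableTopology S] {X : ι → Ω → S} {Z : Ω' → S}
    {Φ : Ω → ℝ} {Φ' : Ω' → ℝ}
    (h : TendstoInDistribution (Ω := fun _ : ι => Ω) (fun i ω => (X i ω, Φ ω)) l
      (fun ω' => (Z ω', Φ' ω')) (fun _ => P) P')
    {f : S → ℝ} {A B p p' K : ℝ} (hfc : Continuous f) (hf : ∀ x, |f x| ≤ A * (1 + ‖x‖ ^ p))
    (hA : 0 ≤ A) (hB : 0 ≤ B) (hp : 0 ≤ p) (hp' : p < p') (hΦB : ∀ ω, |Φ ω| ≤ B)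
    (hΦB' : ∀ ω', |Φ' ω'| ≤ B)
    (hX : ∀ᶠ i in l, Integrable (fun ω => ‖X i ω‖ ^ p') P ∧ ∫ ω, ‖X i ω‖ ^ p' ∂P ≤ K)
    (hZ : Integrable (fun ω' => ‖Z ω'‖ ^ p') P') (hZK : ∫ ω', ‖Z ω'‖ ^ p' ∂P' ≤ K) :
    Tendsto (fun i => ∫ ω, f (X i ω) * Φ ω ∂P) l (𝓝 (∫ ω', f (Z ω') * Φ' ω' ∂P')) := by
  have hXm : ∀ i, AEMeasurable (X i) P := fun i =>
    measurable_fst.comp_aemeasurable (h.forall_aemeasurable i)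
  have hZm : AEMeasurable Z P' := measurable_fst.comp_aemeasurable h.aemeasurable_limit
  have hΦm' : AEMeasurable Φ' P' := measurable_snd.comp_aemeasurable h.aemeasurable_limit
  have hlim : Tendsto (fun R : ℝ => 2 * A * R ^ (p - p') * K * B) atTop (𝓝 0) := by
    have h1 := tendsto_rpow_neg_atTop (sub_pos.2 hp')
    rw [neg_sub] at h1
    simpa using ((h1.const_mul (2 * A)).mul_const K).mul_const B
  rw [Metric.tendsto_nhds]
  intro ε hε
  obtain ⟨R, hRε, hR⟩ := ((hlim.eventually_lt_const (show 0 < ε / 3 by positivity)).and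
    (eventually_ge_atTop 1)).exists
  -- Convergence in distribution requires a bounded test function of the pair; clamping the second
  -- coordinate to [−B, B] achieves this and leaves Φ and Φ' unchanged.
  have hclamp : ∀ y : ℝ, |max (-B) (min B y)| ≤ B := fun y =>
    abs_le.2 ⟨le_max_left _ _, max_le (by linarith) (min_le_left _ _)⟩
  have hid : ∀ y : ℝ, |y| ≤ B → max (-B) (min B y) = y := fun y hy => by
    rw [min_eq_right (abs_le.1 hy).2, max_eq_right (abs_le.1 hy).1]
  have htr : Tendsto (fun i => ∫ ω, truncate f R (X i ω) * Φ ω ∂P) l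
      (𝓝 (∫ ω', truncate f R (Z ω') * Φ' ω' ∂P')) := by
    have hc := continuous_truncate (R := R) hfc
    have := h.tendsto_integral (f := fun q : S × ℝ => truncate f R q.1 * max (-B) (min B q.2))
      (by fun_prop) (B := A * (1 + (2 * R) ^ p) * B) fun q => by
        rw [abs_mul]
        exact mul_le_mul (abs_truncate_le hf hA hp (by linarith) _) (hclamp _) (abs_nonneg _)
          (by positivity)
    simpa only [hid _ (hΦB _), hid _ (hΦB' _)] using this
  have d2 := abs_integral_mul_sub_le hfc hf hA hB hp hp'.le hR hZm hZ hZK hΦm' hΦB'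
  filter_upwards [hX, Metric.tendsto_nhds.1 htr (ε / 3) (by positivity)] with i hi hi'
  have d1 := abs_integral_mul_sub_le hfc hf hA hB hp hp'.le hR (hXm i) hi.1 hi.2
    (show AEMeasurable Φ P from measurable_snd.comp_aemeasurable (h.forall_aemeasurable i)) hΦB
  rw [Real.dist_eq] at hi' ⊢
  have b1 := abs_lt.1 hi'
  have b2 := abs_le.1 d1
  have b3 := abs_le.1 d2
  rw [abs_lt]
  constructor <;> linarith [b1.1, b1.2, b2.1, b2.2, b3.1, b3.2]

/-- The set {|x| > t} is open, so the portmanteau theorem passes the tail bound to the limit law. -/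
lemma measureReal_norm_gt_le_of_tendsto [l.NeBot] {X : ι → Ω → S} {Z : Ω' → S}
    (h : TendstoInDistribution (Ω := fun _ : ι => Ω) X l Z (fun _ => P) P') {t b : ℝ}
    (hb : ∀ᶠ i in l, P.real {ω | t < ‖X i ω‖} ≤ b) : P'.real {ω' | t < ‖Z ω'‖} ≤ b := by
  have hG : IsOpen {x : S | t < ‖x‖} := isOpen_lt continuous_const continuous_norm
  have h1 := ProbabilityMeasure.le_liminf_measure_open_of_tendsto h.tendsto hG
  simp only [ProbabilityMeasure.coe_mk] at h1
  rw [Measure.map_apply_of_aemeasurable h.aemeasurable_limit hG.measurableSet] at h1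
  obtain ⟨i, hi⟩ := hb.exists
  refine ENNReal.toReal_le_of_le_ofReal (measureReal_nonneg.trans hi) (h1.trans ?_)
  refine (liminf_le_liminf (v := fun _ => ENNReal.ofReal b) ?_).trans (liminf_const _).le
  filter_upwards [hb] with i hi
  rw [Measure.map_apply_of_aemeasurable (h.forall_aemeasurable i) hG.measurableSet]
  rw [← ENNReal.ofReal_toReal (measure_ne_top P _)]
  exact ENNReal.ofReal_le_ofReal hi

end MomentConvergence

end QLA

namespace QLA

/-! ### Convergence of expectations under a tail bound -/

section MomentBound

variable {Ω Ω' ι S : Type*} [MeasurableSpace Ω] [MeasurableSpace Ω'] {P : Measure Ω}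
  [IsProbabilityMeasure P] {P' : Measure Ω'} [IsProbabilityMeasure P'] [NormedAddCommGroup S]
  [SecondCountableTopology S] [MeasurableSpace S] [BorelSpace S] {l : Filter ι}

/-- Convergence in distribution together with a uniform polynomial tail bound yields convergence
of the expectations of functions of polynomial growth of lower order. -/
theorem integrable_and_tendsto_integral_mul_of_tail [l.NeBot] {X : ι → Ω → S} {Z : Ω' → S}
    {Φ : Ω → ℝ} {Φ' : Ω' → ℝ}
    (h : TendstoInDistribution (Ω := fun _ : ι => Ω) (fun i ω => (X i ω, Φ ω)) l
      (fun ω' => (Z ω', Φ' ω')) (fun _ => P) P')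
    {f : S → ℝ} {A B C p L t₀ : ℝ} (hfc : Continuous f) (hf : ∀ x, |f x| ≤ A * (1 + ‖x‖ ^ p))
    (hA : 0 ≤ A) (hB : 0 ≤ B) (hp : 0 ≤ p) (hpL : p < L) (hΦB : ∀ ω, |Φ ω| ≤ B)
    (hΦB' : ∀ ω', |Φ' ω'| ≤ B) (ht₀ : 0 < t₀)
    (htail : ∀ᶠ i in l, ∀ t, t₀ ≤ t → P.real {ω | t < ‖X i ω‖} ≤ C / t ^ L) :
    Integrable (fun ω' => f (Z ω') * Φ' ω') P' ∧
      Tendsto (fun i => ∫ ω, f (X i ω) * Φ ω ∂P) l (𝓝 (∫ ω', f (Z ω') * Φ' ω' ∂P')) := by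
  -- The order `p'` is below L, so the tail bounds its moment, and above p, so that moment controls
  -- the truncation error.
  obtain ⟨p', hp', hp'L⟩ := exists_between hpL
  obtain ⟨K, hK, hmom⟩ := exists_integral_norm_rpow_le (S := S) C ht₀ (hp.trans_lt hp') hp'L
  have hXm : ∀ i, AEMeasurable (X i) P := fun i =>
    measurable_fst.comp_aemeasurable (h.forall_aemeasurable i)
  have hZm : AEMeasurable Z P' := measurable_fst.comp_aemeasurable h.aemeasurable_limit
  have hm : Measurable fun x : S => ‖x‖ ^ p' := measurable_norm.pow_const p'
  have hset : ∀ t : ℝ, MeasurableSet {x : S | t < ‖x‖} := fun t =>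
    measurableSet_lt measurable_const measurable_norm
  have hX : ∀ᶠ i in l, Integrable (fun ω => ‖X i ω‖ ^ p') P ∧ ∫ ω, ‖X i ω‖ ^ p' ∂P ≤ K := by
    filter_upwards [htail] with i hi
    have := hmom (P.map (X i)) (Measure.isProbabilityMeasure_map (hXm i)) fun t ht => by
      rw [map_measureReal_apply_of_aemeasurable (hXm i) (hset t)]
      exact hi t ht
    rwa [integrable_map_measure hm.aestronglyMeasurable (hXm i),
      integral_map (hXm i) hm.aestronglyMeasurable] at this
  have hlim : TendstoInDistribution (Ω := fun _ : ι => Ω) X l Z (fun _ => P) P' :=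
    h.continuous_comp continuous_fst
  have hZ := hmom (P'.map Z) (Measure.isProbabilityMeasure_map hZm) fun t ht => by
    rw [map_measureReal_apply_of_aemeasurable hZm (hset t)]
    exact measureReal_norm_gt_le_of_tendsto hlim (htail.mono fun i hi => hi t ht)
  rw [integrable_map_measure hm.aestronglyMeasurable hZm,
    integral_map hZm hm.aestronglyMeasurable] at hZ
  exact ⟨integrable_mul_of_growth hfc hf hA hp hp'.le hZm hZ.1
      (show AEMeasurable Φ' P' from measurable_snd.comp_aemeasurable h.aemeasurable_limit) hΦB',
    tendsto_integral_mul_of_growth h hfc hf hA hB hp hp' hΦB hΦB' hX hZ.1 hZ.2⟩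

end MomentBound

/-! ### Integrability at a fixed T -/

section BoundedError

variable {Ω : Type*} [MeasurableSpace Ω] {P : Measure Ω} [IsFiniteMeasure P] {d : ℕ}
  {Θ : Set (E d)} {θs : E d} {ϖ : E d → ℝ} {h : Ω → E d → ℝ} {a : Matrix (Fin d) (Fin d) ℝ}

lemma integrable_comp_qbeError_mul (ha : IsUnit a.det) (hΘo : IsOpen Θ)
    (hΘb : Bornology.IsBounded Θ) (hθs : θs ∈ Θ) (hϖ : IsPrior Θ ϖ) (hh : IsC2RandomField Θ h)
    {f : E d → ℝ} (hf : Continuous f) {Φ : Ω → ℝ} (hΦ : Measurable Φ) {B : ℝ}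
    (hΦB : ∀ ω, |Φ ω| ≤ B) :
    Integrable (fun ω => f (qbeError Θ ϖ (h ω) θs a) * Φ ω) P := by
  obtain ⟨R, hR⟩ := exists_norm_qbeError_le ha hΘo hΘb hθs hϖ
  obtain ⟨M, hM⟩ := (isCompact_closedBall (0 : E d) R).exists_bound_of_continuousOn
    hf.continuousOn
  refine .of_bound ((hf.measurable.comp (hh.measurable_qbeError hΘo hϖ θs a)).mul
    hΦ).aestronglyMeasurable (M * B) (.of_forall fun ω => ?_)
  have h1 := hM _ (mem_closedBall_zero_iff.2 (hR (h ω) (hh.continuousOn ω)))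
  rw [norm_mul]
  exact mul_le_mul h1 (hΦB ω) (norm_nonneg _) ((norm_nonneg _).trans h1)

end BoundedError

end QLA

/-! ### The theorem assembled -/

theorem theorem201912011335
    {Ω Ω' : Type*} (𝒢 : MeasurableSpace Ω)
    [mΩ : MeasurableSpace Ω] [mΩ' : MeasurableSpace Ω']
    (P : Measure Ω) [IsProbabilityMeasure P]
    -- the parameter space, the true value and the index set
    {d : ℕ} (hd : 0 < d) (Θ : Set (QLA.E d)) (hΘo : IsOpen Θ) (hΘb : Bornology.IsBounded Θ)
    (θs : QLA.E d) (hθs : θs ∈ Θ) (𝕋 : Set ℝ≥0) (h𝕋 : ¬ BddAbove 𝕋)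
    -- the random fields, the scaling matrices and the prior density
    (H : 𝕋 → Ω → QLA.E d → ℝ) (hH : ∀ T, QLA.IsC2RandomField Θ (H T))
    (a : 𝕋 → GL (Fin d) ℝ) (ha : QLA.IsScaling a)
    (Y : Ω → QLA.E d → ℝ) (hY : QLA.IsContRandomField Θ Y)
    (ϖ : QLA.E d → ℝ) (hϖ : QLA.IsPrior Θ ϖ)
    -- the σ-field `𝒢` with `σ[Γ] ⊆ 𝒢 ⊆ ℱ` and the symmetric random matrix `Γ`
    (h𝒢 : 𝒢 ≤ mΩ)
    (Γ : Ω → Matrix (Fin d) (Fin d) ℝ) (hΓsymm : ∀ ω, (Γ ω).IsSymm)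
    (hΓ : ∀ i j, Measurable[𝒢] fun ω => Γ ω i j)
    -- the extension of the probability space and the random vector `Δ` on it
    (P' : Measure Ω') [IsProbabilityMeasure P'] (π : Ω' → Ω) (hπ : MeasurePreserving π P' P)
    (Δ : Ω' → QLA.E d) (hΔ : Measurable Δ)
    -- conditions [S1], [S2], [S3] and the stable convergence of `Δ_T`
    (L α β₁ β₂ ρ₁ ρ₂ : ℝ) (hS1 : QLA.S1 α β₁ β₂ ρ₁ ρ₂)
    (hS2 : QLA.S2 P Θ θs Y Γ L α ρ₁ ρ₂) (hS3 : QLA.S3 P Θ θs H a Y Γ L α β₁ β₂ ρ₁ ρ₂)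
    (hconv : QLA.StableConv 𝒢 P P' π (fun T ω => QLA.score (H T ω) θs (a T).1) atTop Δ) :
    -- (I)
    (1 < L →
      TendstoInMeasure P
        (fun T ω => QLA.qbeError Θ ϖ (H T ω) θs (a T).1
          - QLA.act (Γ ω)⁻¹ (QLA.score (H T ω) θs (a T).1)) atTop (fun _ => 0) ∧
      QLA.StableConv 𝒢 P P' π (fun T ω => QLA.qbeError Θ ϖ (H T ω) θs (a T).1) atTop
        (fun ω' => QLA.act (Γ (π ω'))⁻¹ (Δ ω'))) ∧
    -- (II)
    (∀ p : ℝ, 0 ≤ p → max (p + 1) 2 < L →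
      ∀ (q c₀ δ : ℝ) (T₀ : 𝕋), (d : ℝ) < q → 0 < c₀ → 0 < δ →
      (∀ u ∈ Metric.ball (0 : QLA.E d) δ, ∀ T : 𝕋, T₀ ≤ T → θs + QLA.act (a T).1 u ∈ Θ →
        ∫⁻ ω, ENNReal.ofReal (|H T ω (θs + QLA.act (a T).1 u) - H T ω θs| ^ q) ∂P
          ≤ ENNReal.ofReal (c₀ * ‖u‖ ^ q)) →
      TendstoInMeasure P
        (fun T ω => QLA.qbeError Θ ϖ (H T ω) θs (a T).1
          - QLA.act (Γ ω)⁻¹ (QLA.score (H T ω) θs (a T).1)) atTop (fun _ => 0) ∧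
      ∀ (Φ : Ω → ℝ) (f : QLA.E d → ℝ), Measurable[𝒢] Φ → (∃ C : ℝ, ∀ ω, |Φ ω| ≤ C) →
        Continuous f → QLA.PolyGrowth p f →
        (∀ T : 𝕋, Integrable
          (fun ω => f (QLA.qbeError Θ ϖ (H T ω) θs (a T).1) * Φ ω) P) ∧
        Integrable (fun ω' => f (QLA.act (Γ (π ω'))⁻¹ (Δ ω')) * Φ (π ω')) P' ∧
        Tendsto
          (fun T : 𝕋 => ∫ ω, f (QLA.qbeError Θ ϖ (H T ω) θs (a T).1) * Φ ω ∂P) atTop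
          (𝓝 (∫ ω', f (QLA.act (Γ (π ω'))⁻¹ (Δ ω')) * Φ (π ω') ∂P'))) := by
  have hΓm : ∀ i j, Measurable fun ω => Γ ω i j := fun i j => (hΓ i j).mono h𝒢 le_rfl
  have : (atTop : Filter 𝕋).IsCountablyGenerated :=
    QLA.isCountablyGenerated_atTop_of_not_bddAbove h𝕋
  have : Nonempty 𝕋 := by
    obtain ⟨T, hT, -⟩ := not_bddAbove_iff.1 h𝕋 0
    exact ⟨⟨T, hT⟩⟩
  have hI : 0 < L → _ := QLA.tendstoInMeasure_qbeError_sub hd hΘo hΘb hθs hH ha.tendsto_zero hY hϖ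
    hΓsymm hΓm hS1 hS2 hS3
  -- Γ⁻¹ is again 𝒢-measurable, so Γ⁻¹Δ_T converges stably to Γ⁻¹Δ, and the error of the estimator
  -- follows it.
  have hstable := fun hL : 0 < L => QLA.StableConv.of_tendstoInMeasure_sub
    (QLA.StableConv.act hconv h𝒢 hπ (@QLA.measurable_inv_apply _ _ 𝒢 _ hΓ)) h𝒢
    (fun T => ((hH T).measurable_qbeError hΘo hϖ θs (a T).1).aemeasurable) (hI hL)
  refine ⟨fun hL => ⟨hI (by linarith), hstable (by linarith)⟩,
    fun p hp hpL q c₀ δ T₀ hq hc₀ hδ hmom => ?_⟩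
  have hL : 0 < L := by linarith [le_max_right (p + 1) 2]
  refine ⟨hI hL, fun Φ f hΦ ⟨B, hB⟩ hf hfp => ⟨fun T => ?_, ?_⟩⟩
  · exact QLA.integrable_comp_qbeError_mul (QLA.isUnit_det (a T)) hΘo hΘb hθs hϖ (hH T) hf
      (hΦ.mono h𝒢 le_rfl) hB
  · have hq1 : 1 ≤ q := (Nat.one_le_cast.2 hd).trans hq.le
    obtain ⟨C, r₀, hr₀, htail⟩ := QLA.exists_qbeError_tail hd hΘo hΘb hθs hH ha.tendsto_zero hY hϖ
      hΓsymm hΓm hS1 hS2 hS3 hL T₀ hq1 hc₀ hδ hmom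
    obtain ⟨A, hA, hfA⟩ := hfp.exists_le hf
    obtain ⟨ω₀⟩ : Nonempty Ω := P.nonempty_of_neZero
    -- The tail bound concerns 2r; substituting t = 2r doubles the threshold and multiplies the
    -- constant by 2^L.
    refine QLA.integrable_and_tendsto_integral_mul_of_tail (hstable hL Φ hΦ) hf hfA hA
      ((abs_nonneg _).trans (hB ω₀)) hp (by linarith [le_max_left (p + 1) 2]) hB (fun _ => hB _)
      (L := L) (t₀ := 2 * r₀) (C := C * 2 ^ L) (by linarith) ?_
    filter_upwards [htail] with T hT t ht
    have h1 := hT (t / 2) (by linarith)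
    rw [mul_div_cancel₀ _ two_ne_zero, Real.div_rpow (by linarith) zero_le_two, div_div_eq_mul_div]
      at h1
    exact h1
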